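/- Let $d\ge 1$, let $B_r\subset\mathbb R^d$ be the open ball of radius $r$ centred at $0$, $B_1^+=B_1\cap\{x_d>0\}$, and $t_+=\max\{t,0\}$. **Solutions.** Let $0\le f,g\in L^\infty(B_1)$ and $Q:B_1\to\mathbb R$. A pair $(u,v)$ of continuous non-negative functions on $B_1$ with $\Omega:=\{u>0\}=\{v>0\}$ is called a solution with data $(f,g,Q)$ if $-\Delta u=f$ and $-\Delta v=g$ in $\Omega$ (in the sense of distributions), and $\frac{\partial u}{\partial n}\frac{\partial v}{\partial n}=Q$ on $\partial\Omega\cap B_1$ in the following sense: whenever $x_0\in\partial\Omega\cap B_1$ and there is a ball $B$, contained in $\Omega$ or in $\mathbb R^d\setminus\overline\Omega$, with $\partial B\cap\partial\Omega=\{x_0\}$, there are a decreasing sequence $r_k\to0$ of positive numbers, constants $\alpha,\beta>0$ with $\alpha\beta=Q(x_0)$ and a unit vector $\nu$ such that $\frac1{r_k}u(x_0+r_kx)\to\alpha(x\cdot\nu)_+$ and $\frac1{r_k}v(x_0+r_kx)\to\beta(x\cdot\nu)_+$ uniformly in $B_1$. **Linearizing sequences.** Let $\varepsilon_n>0$ with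 $\varepsilon_n\to0$, and let $(u_n,v_n)$ be solutions with data $(f_n,g_n,Q_n)$, where $$\|f_n\|_{L^\infty(B_1)}+\|g_n\|_{L^\infty(B_1)}=o(\varepsilon_n)\qquad\text{and}\qquad \sup_{B_1}|Q_n-1|=o(\varepsilon_n)$$ (in particular, $f_n=g_n=0$ and $Q_n=1$ is allowed). Let $\Omega_n:=\{u_n>0\}=\{v_n>0\}$, suppose that $0\in\partial\Omega_n$, and that for all $n$ and all $x\in B_1$ $$(x_d-\varepsilon_n)_+\le u_n(x)\le(x_d+\varepsilon_n)_+\qquad\text{and}\qquad(x_d-\varepsilon_n)_+\le v_n(x)\le(x_d+\varepsilon_n)_+ .$$ Set $\widetilde u_n=(u_n-x_d)/\varepsilon_n$ and $\widetilde v_n=(v_n-x_d)/\varepsilon_n$ on $\overline\Omega_n\cap B_1$. Let $\widetilde u_\infty,\widetilde v_\infty:B_1\cap\{x_d\ge0\}\to\mathbb R$ be continuous functions that are the limits of $\widetilde u_n$ and $\widetilde v_n$ (passing to a subsequence beforehand if necessary) in the sense that the graphs of $\widetilde u_n,\widetilde v_n$ over $\overline\Omega_n\cap B_1$ converge in the Hausdorff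 sense, locally in $B_1$, to the graphs of $\widetilde u_\infty,\widetilde v_\infty$: for all $\rho<1$ and $\eta>0$ and all large $n$, the part of each of the two graphs (the $n$-th and the limit one) over $B_\rho$ lies in the $\eta$-neighbourhood of the other graph. **Claim.** The functions $$M:=\tfrac12(\widetilde u_\infty+\widetilde v_\infty)\qquad\text{and}\qquad D:=\tfrac12(\widetilde u_\infty-\widetilde v_\infty)$$ are classical solutions of $$\begin{cases}\Delta M=0&\text{in }B_1^+,\\ \partial_{x_d}M=0&\text{on }B_1\cap\{x_d=0\},\end{cases}\qquad\qquad\begin{cases}\Delta D=0&\text{in }B_1^+,\\ D=0&\text{on }B_1\cap\{x_d=0\}.\end{cases}$$ That is, $M$ and $D$ are $C^2$ and harmonic in $B_1^+$; $M$ is $C^1$ on $B_1\cap\{x_d\ge0\}$ and its one-sided derivative in the direction $e_d$ vanishes at every point of $B_1\cap\{x_d=0\}$; and $D$ is continuous on $B_1\cap\{x_d\ge0\}$ and vanishes on $B_1\cap\{x_d=0\}$. -/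

import Mathlib

open Filter Topology MeasureTheory Metric Set
open scoped ContDiff ENNReal

namespace FreeBoundarySystem

/-- The Euclidean space of dimension `d + 1 ≥ 1`. Its last coordinate plays the role of the
coordinate called `x_d` on paper. -/
abbrev Space (d : ℕ) : Type := EuclideanSpace ℝ (Fin (d + 1))

/-- The last coordinate of a point. -/
def height {d : ℕ} (x : Space d) : ℝ := x (Fin.last d)

/-- The unit vector in the direction of the last coordinate. -/
noncomputable def eLast (d : ℕ) : Space d := EuclideanSpace.single (Fin.last d) (1 : ℝ)

/-- The open unit ball `B_1`. -/
def unitBall (d : ℕ) : Set (Space d) := ball 0 1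

/-- The open half ball `B_1 ∩ {x_d > 0}`. -/
def halfBall (d : ℕ) : Set (Space d) := {x | x ∈ unitBall d ∧ 0 < height x}

/-- The half ball with its flat boundary, `B_1 ∩ {x_d ≥ 0}`. -/
def closedHalfBall (d : ℕ) : Set (Space d) := {x | x ∈ unitBall d ∧ 0 ≤ height x}

/-- The flat boundary `B_1 ∩ {x_d = 0}`. -/
def flatBoundary (d : ℕ) : Set (Space d) := {x | x ∈ unitBall d ∧ height x = 0}

/-- The positivity set `{u > 0}` of a function on `B_1`. -/
def posSet {d : ℕ} (u : Space d → ℝ) : Set (Space d) := {x | x ∈ unitBall d ∧ 0 < u x}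

/-- `-Δ u = f` in the open set `Ω` in the sense of distributions. -/
def SolvesPoisson {d : ℕ} (Ω : Set (Space d)) (u f : Space d → ℝ) : Prop :=
  ∀ φ : Space d → ℝ, ContDiff ℝ ∞ φ → HasCompactSupport φ → tsupport φ ⊆ Ω →
    ∫ x, u x * Laplacian.laplacian φ x = -∫ x, f x * φ x

/-- There is a ball contained in `Ω` whose boundary sphere meets `∂Ω` exactly at `x₀`. -/
def HasInnerTangentBall {d : ℕ} (Ω : Set (Space d)) (x₀ : Space d) : Prop :=
  ∃ r : ℝ, 0 < r ∧ ∃ y₀ : Space d, y₀ ∈ Ω ∧ ball y₀ r ⊆ Ω ∧ sphere y₀ r ∩ frontier Ω = {x₀}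

/-- There is a ball contained in the complement of the closure of `Ω` whose boundary sphere meets
`∂Ω` exactly at `x₀`. -/
def HasOuterTangentBall {d : ℕ} (Ω : Set (Space d)) (x₀ : Space d) : Prop :=
  ∃ r : ℝ, 0 < r ∧ ∃ y₀ : Space d, y₀ ∈ (closure Ω)ᶜ ∧ ball y₀ r ⊆ (closure Ω)ᶜ ∧
    sphere y₀ r ∩ frontier Ω = {x₀}

/-- The pair `(u, v)` has, along one decreasing sequence of radii `r k → 0`, blow-up limits
`α (x · ν)_+` and `β (x · ν)_+` at `x₀`, uniformly in `B_1`, where `ν` is a unit vector and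
`α, β > 0` satisfy `α β = q`. -/
def HasHalfPlaneBlowUp {d : ℕ} (u v : Space d → ℝ) (x₀ : Space d) (q : ℝ) : Prop :=
  ∃ r : ℕ → ℝ, (∀ k, 0 < r k) ∧ Antitone r ∧ Tendsto r atTop (𝓝 0) ∧
    ∃ α β : ℝ, 0 < α ∧ 0 < β ∧ α * β = q ∧
      ∃ ν : Space d, ‖ν‖ = 1 ∧
        TendstoUniformlyOn (fun k x => u (x₀ + r k • x) / r k)
          (fun x => α * max (inner ℝ x ν) 0) atTop (unitBall d) ∧
        TendstoUniformlyOn (fun k x => v (x₀ + r k • x) / r k)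
          (fun x => β * max (inner ℝ x ν) 0) atTop (unitBall d)

/-- The free boundary condition `∂u/∂n · ∂v/∂n = Q` on `∂Ω ∩ B_1`, for `Ω = {u > 0}`, in the
blow-up sense: at every free boundary point in `B_1` with a one-sided tangent ball, there are
half-plane blow-up limits whose slopes have product `Q`. -/
def FreeBoundaryCondition {d : ℕ} (Q u v : Space d → ℝ) : Prop :=
  ∀ x₀ ∈ frontier (posSet u) ∩ unitBall d,
    HasInnerTangentBall (posSet u) x₀ ∨ HasOuterTangentBall (posSet u) x₀ →
      HasHalfPlaneBlowUp u v x₀ (Q x₀)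

/-- `(u, v)` is a pair of continuous non-negative functions on `B_1`, with the same positivity set
`Ω`, which solves `-Δ u = f` and `-Δ v = g` in `Ω`, and `∂u/∂n · ∂v/∂n = Q` on `∂Ω ∩ B_1`.
Only the values of the functions in `B_1` matter. -/
structure IsSolution {d : ℕ} (f g Q u v : Space d → ℝ) : Prop where
  continuousOn_left : ContinuousOn u (unitBall d)
  continuousOn_right : ContinuousOn v (unitBall d)
  nonneg_left : ∀ x ∈ unitBall d, 0 ≤ u x
  nonneg_right : ∀ x ∈ unitBall d, 0 ≤ v x
  posSet_eq : posSet u = posSet v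
  equation_left : SolvesPoisson (posSet u) u f
  equation_right : SolvesPoisson (posSet u) v g
  boundary : FreeBoundaryCondition Q u v

/-- `(x_d - ε)_+ ≤ u ≤ (x_d + ε)_+` in `B_1`. -/
def IsFlat {d : ℕ} (ε : ℝ) (u : Space d → ℝ) : Prop :=
  ∀ x ∈ unitBall d, max (height x - ε) 0 ≤ u x ∧ u x ≤ max (height x + ε) 0

/-- `f` is a non-negative element of `L^∞(B_1)`. -/
def IsNonnegBounded {d : ℕ} (f : Space d → ℝ) : Prop :=
  MemLp f ∞ (volume.restrict (unitBall d)) ∧ ∀ᵐ x ∂(volume.restrict (unitBall d)), 0 ≤ f x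

/-- The norm of `f` in `L^∞(B_1)`. -/
noncomputable def supNorm {d : ℕ} (f : Space d → ℝ) : ℝ≥0∞ :=
  eLpNorm f ∞ (volume.restrict (unitBall d))

/-- The linearization `(u - x_d) / ε`. -/
noncomputable def linearization {d : ℕ} (ε : ℝ) (u : Space d → ℝ) (x : Space d) : ℝ :=
  (u x - height x) / ε

/-- The graph of `w` over the set `A`. -/
def graphOver {d : ℕ} (A : Set (Space d)) (w : Space d → ℝ) : Set (Space d × ℝ) :=
  (fun x => (x, w x)) '' A

/-- Hausdorff convergence, locally in `B_1`, of the graphs of `w n` over `A n` to the graph of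
`w'` over `A'`: for all `ρ < 1` and `η > 0`, as soon as `n` is large, the part of either graph
over `B_ρ` lies in the `η`-neighbourhood of the other graph. (Convergence to zero of the
Hausdorff distance of the graphs over `A n ∩ B_1` and `A' ∩ B_1` implies this.) -/
def GraphsConverge {d : ℕ} (A : ℕ → Set (Space d)) (w : ℕ → Space d → ℝ)
    (A' : Set (Space d)) (w' : Space d → ℝ) : Prop :=
  ∀ ρ : ℝ, ρ < 1 → ∀ η : ℝ, 0 < η → ∀ᶠ n in atTop,
    graphOver (A n ∩ ball 0 ρ) (w n) ⊆ thickening η (graphOver (A' ∩ unitBall d) w') ∧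
    graphOver (A' ∩ ball 0 ρ) w' ⊆ thickening η (graphOver (A n ∩ unitBall d) (w n))

/-- Classical solutions of `Δ M = 0` in `B_1 ∩ {x_d > 0}`, `∂_d M = 0` on `B_1 ∩ {x_d = 0}`:
`M` is `C^1` up to the flat boundary, (`C^2` and) harmonic inside, and its one-sided derivative in
the direction `e_d` vanishes at each point of the flat boundary. -/
structure IsClassicalNeumannSolution {d : ℕ} (M : Space d → ℝ) : Prop where
  contDiffOn : ContDiffOn ℝ 1 M (closedHalfBall d)
  harmonic : InnerProductSpace.HarmonicOnNhd M (halfBall d)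
  normal_derivative : ∀ x ∈ flatBoundary d,
    HasDerivWithinAt (fun t : ℝ => M (x + t • eLast d)) 0 (Ici 0) 0

/-- Classical solutions of `Δ D = 0` in `B_1 ∩ {x_d > 0}`, `D = 0` on `B_1 ∩ {x_d = 0}`:
`D` is continuous up to the flat boundary, (`C^2` and) harmonic inside, and vanishes on the flat
boundary. -/
structure IsClassicalDirichletSolution {d : ℕ} (D : Space d → ℝ) : Prop where
  continuousOn : ContinuousOn D (closedHalfBall d)
  harmonic : InnerProductSpace.HarmonicOnNhd D (halfBall d)
  boundary_value : ∀ x ∈ flatBoundary d, D x = 0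

end FreeBoundarySystem

/-! The Dirichlet half is soft. On the free boundary both `u n` and `v n` vanish, so there both
linearizations equal `-height / ε`. By flatness every short vertical segment through the hyperplane
meets the free boundary, so the two limits agree on it (`eq_on_flatBoundary`). Inside, sources of
size `o(ε)` disappear after division by `ε`, and Weyl's lemma makes both limits harmonic
(`harmonicOnNhd_of_convergesOn`).

For the Neumann half the condition `α β = Q` is nonlinear, and two means of `u` and `v` each see one
side of it. If a smooth `W` touches `(u + v) / 2` from above at a free boundary point, the blow-ups
give `(α + β) / 2 ≤ ‖∇W‖`, hence `Q ≤ ‖∇W‖ ^ 2` by AM-GM. If `W` touches `√(u v)` from below, then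
`‖∇W‖ ^ 2 ≤ α β = Q`; inside, `√(u v)` is superharmonic, being an infimum of positive combinations
of `u` and `v`. Both means linearize to the same `M`: their difference is `(√u - √v) ^ 2 / 2`, which
is `o(ε)` because the two limits agree on the flat boundary (`ConvergesOn.geomLin`).

Testing with `W = x_d + ε (φ + k)`, where `‖∇W‖ ^ 2 = 1 + 2 ε ∂_d φ + O(ε ^ 2)` while `Q = 1 +
o(ε)`, shows that `M` obeys comparison with strict super- and subsolutions `φ` of the Neumann
problem (`limit_le_of_supersolution`, `le_limit_of_subsolution`). Even harmonic polynomials plus a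
small barrier are such `φ`, so the even reflection of `M` is a locally uniform limit of harmonic
functions, hence harmonic, and evenness kills its normal derivative
(`isClassicalNeumannSolution_of_comparison`).

The potential theory behind this is elementary: averages against a smooth radial kernel give Weyl's
lemma and a minimum principle for distributional Laplacians, and linear algebra on polynomials
solves the Dirichlet problem on a ball. -/

open scoped Gradient

namespace FreeBoundarySystem

/-! ### Calculus of the Laplacian and Green's identity -/

section LaplacianBasics

variable {E : Type*} [NormedAddCommGroup E] [InnerProductSpace ℝ E]

lemma contDiff_fderiv_apply {f : E → ℝ} {m n : WithTop ℕ∞} (hf : ContDiff ℝ n f)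
    (hmn : m + 1 ≤ n) (v : E) : ContDiff ℝ m (fun y => fderiv ℝ f y v) :=
  (hf.fderiv_right hmn).clm_apply contDiff_const

variable [FiniteDimensional ℝ E]

lemma laplacian_eq_sum_fderiv {ι : Type*} [Fintype ι] (b : OrthonormalBasis ι ℝ E) {f : E → ℝ}
    (hf : ContDiff ℝ 2 f) (x : E) :
    Laplacian.laplacian f x = ∑ i, fderiv ℝ (fun y => fderiv ℝ f y (b i)) x (b i) := by
  rw [InnerProductSpace.laplacian_eq_iteratedFDeriv_orthonormalBasis f b]
  refine Finset.sum_congr rfl fun i _ => ?_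
  have h1 : DifferentiableAt ℝ (fderiv ℝ f) x :=
    ((hf.fderiv_right (m := 1) (by norm_num)).differentiable (by norm_num)) x
  rw [iteratedFDeriv_two_apply, fderiv_clm_apply h1 (differentiableAt_const _)]
  simp

lemma continuous_laplacian {f : E → ℝ} (hf : ContDiff ℝ 2 f) :
    Continuous (Laplacian.laplacian f) := by
  have : Laplacian.laplacian f = fun x => ∑ i,
      fderiv ℝ (fun y => fderiv ℝ f y (stdOrthonormalBasis ℝ E i)) x (stdOrthonormalBasis ℝ E i) :=
    funext fun x => laplacian_eq_sum_fderiv _ hf x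
  rw [this]
  refine continuous_finsetSum _ fun i _ => ?_
  exact (contDiff_fderiv_apply (m := 0) (contDiff_fderiv_apply (m := 1) hf (by norm_num) _)
    (by norm_num) _).continuous

lemma tsupport_laplacian_subset {f : E → ℝ} :
    tsupport (Laplacian.laplacian f : E → ℝ) ⊆ tsupport f := by
  refine closure_minimal ?_ (isClosed_tsupport f)
  intro x hx
  by_contra h
  apply hx
  have : f =ᶠ[𝓝 x] (fun _ => (0 : ℝ)) := by
    filter_upwards [(isClosed_tsupport f).isOpen_compl.mem_nhds h] with y hy
    exact image_eq_zero_of_notMem_tsupport hy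
  rw [(InnerProductSpace.laplacian_congr_nhds this).eq_of_nhds]
  simp

lemma hasCompactSupport_laplacian {f : E → ℝ} (hf : HasCompactSupport f) :
    HasCompactSupport (Laplacian.laplacian f : E → ℝ) :=
  IsCompact.of_isClosed_subset hf (isClosed_tsupport _) tsupport_laplacian_subset

/-- The trace of the second derivative may be taken in any orthonormal basis, here in one basis at
`x` and in its image under `e` at `e x`. -/
lemma laplacian_comp_linearIsometryEquiv (e : E ≃ₗᵢ[ℝ] E) {f : E → ℝ} (hf : ContDiff ℝ 2 f)
    (x : E) : Laplacian.laplacian (fun y => f (e y)) x = Laplacian.laplacian f (e x) := by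
  rw [InnerProductSpace.laplacian_eq_iteratedFDeriv_orthonormalBasis f
      ((stdOrthonormalBasis ℝ E).map e),
    InnerProductSpace.laplacian_eq_iteratedFDeriv_orthonormalBasis _ (stdOrthonormalBasis ℝ E)]
  refine Finset.sum_congr rfl fun i _ => ?_
  have := ContinuousLinearMap.iteratedFDeriv_comp_right
    (e.toContinuousLinearEquiv : E →L[ℝ] E) hf x (i := 2) le_rfl
  have h2 : (fun y => f (e y)) = f ∘ (e.toContinuousLinearEquiv : E →L[ℝ] E) := rfl
  rw [h2, this]
  simp only [ContinuousMultilinearMap.compContinuousLinearMap_apply, OrthonormalBasis.map_apply]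
  congr 1
  ext j
  fin_cases j <;> rfl

lemma laplacian_comp_smul_sub {f : E → ℝ} (hf : ContDiff ℝ 2 f) (b : ℝ) (x y : E) :
    Laplacian.laplacian (fun y => f (b • (x - y))) y =
      b ^ 2 * Laplacian.laplacian f (b • (x - y)) := by
  have hg : ContDiff ℝ 2 (fun y => f (b • (x - y))) := by fun_prop
  rw [laplacian_eq_sum_fderiv (stdOrthonormalBasis ℝ E) hg,
    laplacian_eq_sum_fderiv (stdOrthonormalBasis ℝ E) hf, Finset.mul_sum]
  refine Finset.sum_congr rfl fun i _ => ?_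
  set v := stdOrthonormalBasis ℝ E i
  have key : ∀ (g : E → ℝ), Differentiable ℝ g → ∀ y : E,
      fderiv ℝ (fun y => g (b • (x - y))) y v = -b * fderiv ℝ g (b • (x - y)) v := by
    intro g hg y
    have h1 : HasFDerivAt (fun y : E => b • (x - y)) (-(b • ContinuousLinearMap.id ℝ E)) y := by
      have := ((hasFDerivAt_id (𝕜 := ℝ) y).const_sub x).const_smul b
      rw [smul_neg] at this
      exact this
    have h2 := (hg (b • (x - y))).hasFDerivAt.comp y h1
    have h3 : fderiv ℝ (fun y => g (b • (x - y))) y = _ := h2.fderiv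
    rw [h3]; simp
  have h1 : (fun y => fderiv ℝ (fun y => f (b • (x - y))) y v) =
      fun y => -b * (fun z => fderiv ℝ f z v) (b • (x - y)) :=
    funext fun y => key f (hf.differentiable (by norm_num)) y
  have hd : Differentiable ℝ (fun z => fderiv ℝ f z v) :=
    (contDiff_fderiv_apply (m := 1) hf (by norm_num) v).differentiable (by norm_num)
  have hd' : Differentiable ℝ (fun y => (fun z => fderiv ℝ f z v) (b • (x - y))) := by
    exact hd.comp (by fun_prop)
  rw [h1, fderiv_const_mul (hd' y)]
  have := key _ hd y
  simp only [smul_apply, smul_eq_mul] at *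
  rw [this]; ring

variable [MeasurableSpace E] [BorelSpace E]

/-- Green's second identity with a compactly supported test function. -/
lemma integral_mul_laplacian_eq {w ψ : E → ℝ} (hw : ContDiff ℝ 2 w) (hψ : ContDiff ℝ 2 ψ)
    (hc : HasCompactSupport ψ) :
    ∫ x, w x * Laplacian.laplacian ψ x = ∫ x, Laplacian.laplacian w x * ψ x := by
  have cs1 : ∀ v, HasCompactSupport (fun y => fderiv ℝ ψ y v) := fun v => hc.fderiv_apply ℝ v
  have cs2 : ∀ v, HasCompactSupport (fun x => fderiv ℝ (fun y => fderiv ℝ ψ y v) x v) :=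
    fun v => (cs1 v).fderiv_apply ℝ v
  have d1 : ∀ v, ContDiff ℝ 1 (fun y => fderiv ℝ ψ y v) := fun v =>
    contDiff_fderiv_apply hψ (by norm_num) v
  have d1w : ∀ v, ContDiff ℝ 1 (fun y => fderiv ℝ w y v) := fun v =>
    contDiff_fderiv_apply hw (by norm_num) v
  have c2 : ∀ v, Continuous (fun x => fderiv ℝ (fun y => fderiv ℝ ψ y v) x v) := fun v =>
    (contDiff_fderiv_apply (m := 0) (d1 v) (by norm_num) v).continuous
  have c2w : ∀ v, Continuous (fun x => fderiv ℝ (fun y => fderiv ℝ w y v) x v) := fun v =>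
    (contDiff_fderiv_apply (m := 0) (d1w v) (by norm_num) v).continuous
  have I : ∀ {p q : E → ℝ}, Continuous p → Continuous q → HasCompactSupport q →
      Integrable (fun x => p x * q x) := fun hp hq hqc =>
    (hp.mul hq).integrable_of_hasCompactSupport hqc.mul_left
  simp_rw [laplacian_eq_sum_fderiv (stdOrthonormalBasis ℝ E) hψ,
    laplacian_eq_sum_fderiv (stdOrthonormalBasis ℝ E) hw, Finset.mul_sum, Finset.sum_mul]
  rw [integral_finsetSum _ fun i _ => I hw.continuous (c2 _) (cs2 _),
    integral_finsetSum _ fun i _ => I (c2w _) hψ.continuous hc]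
  refine Finset.sum_congr rfl fun i _ => ?_
  set v := stdOrthonormalBasis ℝ E i
  rw [integral_mul_fderiv_eq_neg_fderiv_mul_of_integrable
      (I (d1w v).continuous (d1 v).continuous (cs1 v))
      (I hw.continuous (c2 v) (cs2 v)) (I hw.continuous (d1 v).continuous (cs1 v))
      (fun x _ => hw.differentiable (by norm_num) x)
      (fun x _ => (d1 v).differentiable (by norm_num) x),
    integral_mul_fderiv_eq_neg_fderiv_mul_of_integrable
      (I (c2w v) hψ.continuous hc) (I (d1w v).continuous (d1 v).continuous (cs1 v))
      (I (d1w v).continuous hψ.continuous hc)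
      (fun x _ => (d1w v).differentiable (by norm_num) x)
      (fun x _ => hψ.differentiable (by norm_num) x), neg_neg]

end LaplacianBasics

lemma two_le_infty : (2 : WithTop ℕ∞) ≤ (⊤ : ℕ∞) :=
  WithTop.coe_le_coe.2 (le_top : (2 : ℕ∞) ≤ ⊤)

/-! ### A smooth radial kernel and the averages it defines -/

section Kernel

set_option linter.unusedSectionVars false

variable {E : Type*} [NormedAddCommGroup E] [InnerProductSpace ℝ E]

/-- A smooth radial bump supported in the closed unit ball. -/
noncomputable def radialBump (z : E) : ℝ := expNegInvGlue (1 - ‖z‖ ^ 2)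

/-- The radial kernel `ρ` with `∇ radialBump z = - ρ z • z`. -/
noncomputable def radialKernel (z : E) : ℝ := 2 * deriv expNegInvGlue (1 - ‖z‖ ^ 2)

lemma contDiff_radialBump : ContDiff ℝ ∞ (radialBump : E → ℝ) :=
  (expNegInvGlue.contDiff (n := ⊤)).comp (contDiff_const.sub (contDiff_norm_sq ℝ))

lemma contDiff_deriv_expNegInvGlue : ContDiff ℝ ∞ (deriv expNegInvGlue) := by
  have h : ContDiff ℝ ∞ expNegInvGlue := expNegInvGlue.contDiff (n := ⊤)
  exact (contDiff_infty_iff_deriv.1 h).2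

lemma contDiff_radialKernel : ContDiff ℝ ∞ (radialKernel : E → ℝ) :=
  contDiff_const.mul
    (contDiff_deriv_expNegInvGlue.comp (contDiff_const.sub (contDiff_norm_sq ℝ)))

lemma radialBump_nonneg (z : E) : 0 ≤ radialBump z := expNegInvGlue.nonneg _

lemma radialBump_pos {z : E} (hz : ‖z‖ < 1) : 0 < radialBump z :=
  expNegInvGlue.pos_of_pos (by nlinarith [norm_nonneg z])

lemma radialBump_eq_zero {z : E} (hz : 1 ≤ ‖z‖) : radialBump z = 0 :=
  expNegInvGlue.zero_of_nonpos (by nlinarith [norm_nonneg z])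

lemma deriv_expNegInvGlue_nonneg (s : ℝ) : 0 ≤ deriv expNegInvGlue s :=
  expNegInvGlue.monotone.deriv_nonneg

lemma radialKernel_nonneg (z : E) : 0 ≤ radialKernel z :=
  mul_nonneg zero_le_two (deriv_expNegInvGlue_nonneg _)

lemma radialKernel_eq_zero {z : E} (hz : 1 ≤ ‖z‖) : radialKernel z = 0 := by
  -- Every nonpositive argument is a global minimum of `expNegInvGlue`; this covers the boundary
  -- case `‖z‖ = 1` as well.
  have h : IsLocalMin expNegInvGlue (1 - ‖z‖ ^ 2) := by
    refine Eventually.of_forall fun s => ?_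
    rw [expNegInvGlue.zero_of_nonpos (by nlinarith [norm_nonneg z] : 1 - ‖z‖ ^ 2 ≤ 0)]
    exact expNegInvGlue.nonneg s
  simp [radialKernel, h.deriv_eq_zero]

lemma radialKernel_zero_pos : 0 < radialKernel (0 : E) := by
  have h : expNegInvGlue =ᶠ[𝓝 1] fun x => Real.exp (-x⁻¹) := by
    filter_upwards [lt_mem_nhds (zero_lt_one' ℝ)] with x hx
    simp [expNegInvGlue, hx.not_ge]
  have h2 : HasDerivAt (fun x : ℝ => Real.exp (-x⁻¹)) (Real.exp (-1⁻¹) * (-(-(1 ^ 2)⁻¹))) 1 :=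
    ((hasDerivAt_inv (one_ne_zero (α := ℝ))).neg).exp
  simp only [radialKernel, norm_zero]
  rw [show (1 : ℝ) - 0 ^ 2 = 1 by norm_num, h.deriv_eq, h2.deriv]
  have := Real.exp_pos (-1⁻¹)
  norm_num
  positivity

lemma fderiv_radialBump (z v : E) :
    fderiv ℝ radialBump z v = -(radialKernel z * inner ℝ z v) := by
  have h1 : HasFDerivAt (fun z : E => 1 - ‖z‖ ^ 2) (-(2 • (innerSL ℝ z))) z :=
    ((hasStrictFDerivAt_norm_sq z).hasFDerivAt).const_sub 1
  have h2 : HasDerivAt expNegInvGlue (deriv expNegInvGlue (1 - ‖z‖ ^ 2)) (1 - ‖z‖ ^ 2) :=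
    ((expNegInvGlue.contDiff (n := 1)).differentiable (by norm_num) _).hasDerivAt
  have h3 := h2.comp_hasFDerivAt z h1
  have h4 : fderiv ℝ radialBump z = _ := h3.fderiv
  rw [h4]
  simp [radialKernel]
  ring

variable [FiniteDimensional ℝ E]

lemma hasCompactSupport_radialKernel : HasCompactSupport (radialKernel : E → ℝ) :=
  HasCompactSupport.intro (isCompact_closedBall 0 1) fun z hz =>
    radialKernel_eq_zero (by simpa using (not_le.1 (mem_closedBall_zero_iff.not.1 hz)).le)

/-- This is the divergence of `-radialKernel z • z`. The same combination appears when `b ^ N *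
radialKernel (b • z)` is differentiated in `b`, which links changes of scale to the Laplacian. -/
lemma laplacian_radialBump (z : E) : Laplacian.laplacian (radialBump : E → ℝ) z =
    -(Module.finrank ℝ E * radialKernel z + fderiv ℝ radialKernel z z) := by
  set b := stdOrthonormalBasis ℝ E
  rw [laplacian_eq_sum_fderiv b (contDiff_radialBump.of_le two_le_infty)]
  have hd : DifferentiableAt ℝ (radialKernel : E → ℝ) z :=
    contDiff_radialKernel.differentiable (by norm_num) z
  have h : ∀ v : E, fderiv ℝ (fun y => fderiv ℝ radialBump y v) z v =
      -(radialKernel z * inner ℝ v v + inner ℝ v z * fderiv ℝ radialKernel z v) := by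
    intro v
    have e : (fun y => fderiv ℝ radialBump y v) = fun y => -(radialKernel y * inner ℝ y v) :=
      funext fun y => fderiv_radialBump y v
    have h1 : HasFDerivAt (fun y : E => inner ℝ y v) (innerSL ℝ v) z := by
      have := (innerSL ℝ v).hasFDerivAt (x := z)
      refine this.congr_of_eventuallyEq (Eventually.of_forall fun y => ?_)
      simp [real_inner_comm]
    have h2 : HasFDerivAt (fun y : E => -(radialKernel y * inner ℝ y v)) _ z :=
      (hd.hasFDerivAt.mul h1).neg
    rw [e, h2.fderiv]
    simp [real_inner_comm]
  simp_rw [h, Finset.sum_neg_distrib, Finset.sum_add_distrib]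
  congr 2
  · simp [mul_comm]
  · have hz := congrArg (fderiv ℝ (radialKernel : E → ℝ) z) (b.sum_repr' z)
    rw [map_sum] at hz
    rw [← hz]
    simp

variable (E) in
lemma contDiff_scaled_radialBump (b : ℝ) (x : E) :
    ContDiff ℝ ∞ (fun y => radialBump (b • (x - y))) :=
  contDiff_radialBump.comp (by fun_prop)

lemma tsupport_scaled_radialBump {b : ℝ} (hb : 0 < b) (x : E) :
    tsupport (fun y => radialBump (b • (x - y))) ⊆ closedBall x b⁻¹ := by
  refine closure_minimal (fun y hy => ?_) isClosed_closedBall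
  by_contra h
  apply hy
  apply radialBump_eq_zero
  rw [mem_closedBall, not_le, dist_comm, dist_eq_norm] at h
  rw [norm_smul, Real.norm_of_nonneg hb.le]
  exact ((inv_lt_iff_one_lt_mul₀' hb).1 h).le

lemma hasCompactSupport_scaled_radialBump {b : ℝ} (hb : 0 < b) (x : E) :
    HasCompactSupport (fun y => radialBump (b • (x - y))) :=
  (isCompact_closedBall x b⁻¹).of_isClosed_subset (isClosed_tsupport _)
    (tsupport_scaled_radialBump hb x)

variable [MeasurableSpace E] [BorelSpace E]

lemma integral_radialKernel_pos : 0 < ∫ z : E, radialKernel z :=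
  contDiff_radialKernel.continuous.integral_pos_of_hasCompactSupport_nonneg_nonzero
    hasCompactSupport_radialKernel radialKernel_nonneg radialKernel_zero_pos.ne'

/-- The (unnormalized) average of `w` around `x` at scale `1 / b`. -/
noncomputable def radialAverage (w : E → ℝ) (x : E) (b : ℝ) : ℝ :=
  ∫ y, w y * (b ^ Module.finrank ℝ E * radialKernel (b • (x - y)))

/-- The kernel at scale `b` lives in `closedBall x b⁻¹`. Truncating `w` makes it integrable on the
whole space. -/
lemma radialAverage_eq_indicator {w : E → ℝ} {x : E} {R b : ℝ} (hb : 0 < b) (hR : b⁻¹ ≤ R) :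
    radialAverage w x b = radialAverage ((closedBall x R).indicator w) x b := by
  refine integral_congr_ae (Eventually.of_forall fun y => ?_)
  by_cases hy : y ∈ closedBall x R
  · simp [indicator_of_mem hy]
  · have : radialKernel (b • (x - y)) = 0 := by
      apply radialKernel_eq_zero
      rw [mem_closedBall, not_le, dist_comm, dist_eq_norm] at hy
      rw [norm_smul, Real.norm_of_nonneg hb.le]
      exact ((inv_lt_iff_one_lt_mul₀' hb).1 (hR.trans_lt hy)).le
    simp [this]

lemma integrable_indicator_closedBall {w : E → ℝ} {x : E} {R : ℝ}
    (hw : ContinuousOn w (closedBall x R)) :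
    Integrable ((closedBall x R).indicator w) :=
  (hw.integrableOn_compact (isCompact_closedBall x R)).integrable_indicator measurableSet_closedBall

/-- After division by its integral the kernel is an approximate identity as `b → ∞`. -/
lemma tendsto_radialAverage {w : E → ℝ} {x : E} {R : ℝ} (hR : 0 < R)
    (hw : ContinuousOn w (closedBall x R)) :
    Tendsto (radialAverage w x) atTop (𝓝 (w x * ∫ z : E, radialKernel z)) := by
  set I := ∫ z : E, radialKernel z with hI
  have hIpos : 0 < I := integral_radialKernel_pos
  have hcont : ContinuousAt ((closedBall x R).indicator w) x := by
    refine ((hw.continuousAt (closedBall_mem_nhds x hR))).congr ?_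
    filter_upwards [closedBall_mem_nhds x hR] with y hy
    rw [indicator_of_mem hy]
  have h := tendsto_integral_comp_smul_smul_of_integrable' (μ := (volume : Measure E))
    (φ := fun z : E => I⁻¹ * radialKernel z)
    (fun z => mul_nonneg (inv_nonneg.2 hIpos.le) (radialKernel_nonneg z))
    (by rw [integral_const_mul, ← hI, inv_mul_cancel₀ hIpos.ne'])
    (by
      refine tendsto_const_nhds.congr' ?_
      filter_upwards [Bornology.isBounded_def.1
        (isBounded_closedBall (x := (0 : E)) (r := 1))] with z hz
      have hz' : 1 ≤ ‖z‖ := by simpa using (not_le.1 (mem_closedBall_zero_iff.not.1 hz)).le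
      simp [radialKernel_eq_zero hz'])
    (integrable_indicator_closedBall hw) hcont
  rw [indicator_of_mem (mem_closedBall_self hR.le)] at h
  have h2 := h.mul_const I
  refine h2.congr' ?_
  filter_upwards [eventually_ge_atTop R⁻¹, eventually_gt_atTop 0] with b hb hb0
  rw [radialAverage_eq_indicator hb0 (inv_le_of_inv_le₀ hR hb), radialAverage,
    ← integral_mul_const]
  refine integral_congr_ae (Eventually.of_forall fun y => ?_)
  simp only [smul_eq_mul]
  field_simp

/-- Differentiation falls on the kernel, so `w` need only be continuous. By `laplacian_radialBump`
the derived kernel is the Laplacian of a bump: one factor `b⁻¹` comes from the scale derivative and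
`b⁻²` from rescaling the Laplacian, whence `b ^ 3`. -/
lemma hasDerivAt_radialAverage {w : E → ℝ} {x : E} {R b : ℝ} (hR : 0 < R) (hb : R⁻¹ < b)
    (hw : ContinuousOn w (closedBall x R)) :
    HasDerivAt (radialAverage w x) (-(b ^ Module.finrank ℝ E / b ^ 3) *
      ∫ y, w y * Laplacian.laplacian (fun y => radialBump (b • (x - y))) y) b := by
  have hRi : 0 < R⁻¹ := inv_pos.2 hR
  have hb0 : 0 < b := hRi.trans hb
  set N := Module.finrank ℝ E with hN
  set W : E → ℝ := (closedBall x R).indicator w with hW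
  have hWint : Integrable W := integrable_indicator_closedBall hw
  set K : ℝ → E → ℝ := fun c y => c ^ N * radialKernel (c • (x - y)) with hK
  set K' : ℝ → E → ℝ := fun c y => N * c ^ (N - 1) * radialKernel (c • (x - y)) +
    c ^ N * fderiv ℝ radialKernel (c • (x - y)) (x - y) with hK'
  have hρ : Differentiable ℝ (radialKernel : E → ℝ) :=
    contDiff_radialKernel.differentiable (by norm_num)
  have hρ' : Continuous (fderiv ℝ (radialKernel : E → ℝ)) :=
    contDiff_radialKernel.continuous_fderiv (by norm_num)
  have hρc : Continuous (radialKernel : E → ℝ) := hρ.continuous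
  have hderiv : ∀ c y, HasDerivAt (fun c => K c y) (K' c y) c := by
    intro c y
    have h1 : HasDerivAt (fun c : ℝ => c • (x - y)) (x - y) c := by
      simpa using (hasDerivAt_id c).smul_const (x - y)
    have h2 := (hρ (c • (x - y))).hasFDerivAt.comp_hasDerivAt c h1
    exact (hasDerivAt_pow N c).mul h2
  have hK'c : Continuous (fun p : ℝ × E => K' p.1 p.2) := by
    simp only [hK']
    have : Continuous fun p : ℝ × E => fderiv ℝ radialKernel (p.1 • (x - p.2)) (x - p.2) :=
      (hρ'.comp (by fun_prop)).clm_apply (by fun_prop)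
    fun_prop
  have hKc : ∀ c, Continuous (K c) := fun c => by simp only [hK]; fun_prop
  obtain ⟨C, hC⟩ := ((isCompact_Icc (a := R⁻¹) (b := 2 * b)).prod
    (isCompact_closedBall x R)).exists_bound_of_continuousOn hK'c.continuousOn
  obtain ⟨C₂, hC₂⟩ := (isCompact_closedBall x R).exists_bound_of_continuousOn
    (hKc b).continuousOn
  have hs : Ioo R⁻¹ (2 * b) ∈ 𝓝 b := Ioo_mem_nhds hb (by linarith)
  have hmeas : ∀ c, AEStronglyMeasurable (fun y => W y * K c y) volume := fun c =>
    hWint.aestronglyMeasurable.mul (hKc c).aestronglyMeasurable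
  have key := hasDerivAt_integral_of_dominated_loc_of_deriv_le (μ := (volume : Measure E))
    (F := fun c y => W y * K c y) (F' := fun c y => W y * K' c y) (x₀ := b)
    (bound := fun y => ‖W y‖ * C) hs (Eventually.of_forall hmeas)
    (by
      refine (hWint.norm.mul_const C₂).mono' (hmeas b) (Eventually.of_forall fun y => ?_)
      by_cases hy : y ∈ closedBall x R
      · rw [norm_mul]
        exact mul_le_mul_of_nonneg_left (hC₂ y hy) (norm_nonneg _)
      · simp [hW, indicator_of_notMem hy])
    (hWint.aestronglyMeasurable.mul
      (hK'c.comp (Continuous.prodMk_right b)).aestronglyMeasurable)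
    (Eventually.of_forall fun y c hc => by
      by_cases hy : y ∈ closedBall x R
      · rw [norm_mul]
        exact mul_le_mul_of_nonneg_left (hC (c, y) ⟨Ioo_subset_Icc_self hc, hy⟩) (norm_nonneg _)
      · simp [hW, indicator_of_notMem hy])
    (hWint.norm.mul_const C)
    (Eventually.of_forall fun y c _ => (hderiv c y).const_mul (W y))
  have h1 := key.2
  have heq : radialAverage w x =ᶠ[𝓝 b] fun c => ∫ y, W y * K c y := by
    filter_upwards [hs] with c hc
    exact radialAverage_eq_indicator (hRi.trans hc.1) (inv_le_of_inv_le₀ hR hc.1.le)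
  have h2 := h1.congr_of_eventuallyEq heq
  refine h2.congr_deriv ?_
  symm
  rw [← integral_const_mul]
  refine integral_congr_ae (Eventually.of_forall fun y => ?_)
  by_cases hy : y ∈ closedBall x R
  · simp only [hW, indicator_of_mem hy]
    rw [laplacian_comp_smul_sub (contDiff_radialBump.of_le two_le_infty),
      laplacian_radialBump]
    simp only [hK', map_smul, smul_eq_mul, ← hN]
    -- The truncated `N - 1` is harmless for `N = 0` because of the factor `N`.
    have hpow : (N : ℝ) * b ^ (N - 1) = N * b ^ N / b := by
      rcases Nat.eq_zero_or_pos N with h0 | h0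
      · simp [h0]
      · obtain ⟨m, hm⟩ := Nat.exists_eq_succ_of_ne_zero h0.ne'
        rw [hm]; simp only [Nat.succ_eq_add_one, Nat.add_sub_cancel]; rw [pow_succ]; field_simp
    rw [hpow]
    field_simp
  · have hz : Laplacian.laplacian (fun y => radialBump (b • (x - y))) y = 0 := by
      apply image_eq_zero_of_notMem_tsupport
      intro h
      apply hy
      have := tsupport_scaled_radialBump hb0 x (tsupport_laplacian_subset h)
      exact closedBall_subset_closedBall (inv_le_of_inv_le₀ hR hb.le) this
    simp [hz, hW, indicator_of_notMem hy]

end Kernel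

/-! ### Minimum principle and Weyl's lemma through radial averages -/

section MeanValue

variable {E : Type*} [NormedAddCommGroup E] [InnerProductSpace ℝ E] [FiniteDimensional ℝ E]
  [MeasurableSpace E] [BorelSpace E]

/-- A continuous function whose distributional Laplacian is negative on radial bumps around `x`
has no interior minimum at `x`. -/
lemma not_min_of_integral_laplacian_neg {w : E → ℝ} {x : E} {R : ℝ} (hR : 0 < R)
    (hw : ContinuousOn w (closedBall x R)) (hnn : ∀ y ∈ closedBall x R, 0 ≤ w y) (hx : w x = 0)
    (hlap : ∀ b, R⁻¹ < b →
      ∫ y, w y * Laplacian.laplacian (fun y => radialBump (b • (x - y))) y < 0) : False := by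
  have hRi : 0 < R⁻¹ := inv_pos.2 hR
  have hder := fun b (hb : R⁻¹ < b) => hasDerivAt_radialAverage hR hb hw
  -- A negative Laplacian makes the averages increase strictly with `b`, towards the limit `w x * ∫
  -- radialKernel = 0`. They are then negative at some scale, although `w` is nonnegative.
  have hmono : StrictMonoOn (radialAverage w x) (Ioi R⁻¹) := by
    refine strictMonoOn_of_deriv_pos (convex_Ioi _)
      (fun b hb => (hder b hb).continuousAt.continuousWithinAt) fun b hb => ?_
    rw [interior_Ioi] at hb
    rw [(hder b hb).deriv]
    have hb0 : 0 < b := hRi.trans hb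
    exact mul_pos_of_neg_of_neg (neg_neg_of_pos (by positivity)) (hlap b hb)
  have hlim := tendsto_radialAverage hR hw
  rw [hx, zero_mul] at hlim
  set b₁ := R⁻¹ + 1
  set b₂ := R⁻¹ + 2
  have h1 : b₁ ∈ Ioi R⁻¹ := by simp [b₁]
  have h2 : b₂ ∈ Ioi R⁻¹ := by simp [b₂]
  have h12 : radialAverage w x b₁ < radialAverage w x b₂ := hmono h1 h2 (by simp [b₁, b₂])
  have h20 : radialAverage w x b₂ ≤ 0 := by
    refine ge_of_tendsto hlim ?_
    filter_upwards [eventually_ge_atTop b₂] with b hb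
    exact hmono.monotoneOn h2 (lt_of_lt_of_le h2 hb) hb
  have h10 : 0 ≤ radialAverage w x b₁ := by
    have hb0 : 0 < b₁ := by positivity
    rw [radialAverage_eq_indicator hb0 (inv_le_of_inv_le₀ hR h1.le)]
    refine integral_nonneg fun y => mul_nonneg (indicator_nonneg hnn y) ?_
    exact mul_nonneg (by positivity) (radialKernel_nonneg _)
  linarith

/-- Mean value property: the average has zero derivative in the scale, so it equals its limit as `b
→ ∞`. -/
lemma radialAverage_eq_of_integral_laplacian_eq_zero {w : E → ℝ} {x : E} {R : ℝ} (hR : 0 < R)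
    (hw : ContinuousOn w (closedBall x R))
    (hlap : ∀ b, R⁻¹ < b →
      ∫ y, w y * Laplacian.laplacian (fun y => radialBump (b • (x - y))) y = 0)
    {b : ℝ} (hb : R⁻¹ < b) :
    radialAverage w x b = w x * ∫ z : E, radialKernel z := by
  have hder := fun b (hb : R⁻¹ < b) => hasDerivAt_radialAverage hR hb hw
  have hconst : ∀ c ∈ Ioi R⁻¹, radialAverage w x c = radialAverage w x b := fun c hc =>
    isOpen_Ioi.is_const_of_deriv_eq_zero isPreconnected_Ioi
      (fun b hb => (hder b hb).differentiableAt.differentiableWithinAt)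
      (fun b hb => by simp [(hder b hb).deriv, hlap b hb]) hc hb
  refine tendsto_nhds_unique ?_ (tendsto_radialAverage hR hw)
  refine tendsto_const_nhds.congr' ?_
  filter_upwards [eventually_gt_atTop R⁻¹] with c hc
  exact (hconst c hc).symm

lemma contDiff_radialAverage {W : E → ℝ} (hW : Integrable W) (b : ℝ) (hb : 0 < b) :
    ContDiff ℝ ∞ (fun x => radialAverage W x b) := by
  set k : E → ℝ := fun z => b ^ Module.finrank ℝ E * radialKernel (b • z)
  have hk : ContDiff ℝ ∞ k := contDiff_const.mul (contDiff_radialKernel.comp (by fun_prop))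
  have hkc : HasCompactSupport k :=
    (hasCompactSupport_radialKernel.comp_smul hb.ne').mul_left
  exact hkc.contDiff_convolution_right (n := ⊤) (ContinuousLinearMap.mul ℝ ℝ)
    hW.locallyIntegrable hk

/-- **Weyl's lemma** for continuous functions. -/
theorem harmonicOnNhd_of_integral_laplacian_eq_zero {w : E → ℝ} {U : Set E} (hU : IsOpen U)
    (hw : ContinuousOn w U)
    (h : ∀ ψ : E → ℝ, ContDiff ℝ ∞ ψ → HasCompactSupport ψ → tsupport ψ ⊆ U →
      ∫ x, w x * Laplacian.laplacian ψ x = 0) :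
    InnerProductSpace.HarmonicOnNhd w U := by
  intro x₀ hx₀
  obtain ⟨r, hr, hrU⟩ := nhds_basis_closedBall.mem_iff.1 (hU.mem_nhds hx₀)
  set R := r / 2 with hRdef
  have hR : 0 < R := by positivity
  set W := (closedBall x₀ r).indicator w
  have hWint : Integrable W := integrable_indicator_closedBall (hw.mono hrU)
  set I := ∫ z : E, radialKernel z
  have hI : 0 < I := integral_radialKernel_pos
  set b := R⁻¹ + 1
  have hb : R⁻¹ < b := by simp [b]
  have hb0 : 0 < b := (inv_pos.2 hR).trans hb
  -- Averaging at one fixed scale `b⁻¹ < R` is a convolution with a smooth kernel, and by the mean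
  -- value property it reproduces `w` on `ball x₀ R`. So `w` is smooth there.
  set G : E → ℝ := fun x => radialAverage W x b * I⁻¹
  have hG : ContDiff ℝ ∞ G := (contDiff_radialAverage hWint b hb0).mul contDiff_const
  have hG2 : ContDiff ℝ 2 G := hG.of_le two_le_infty
  have hsub : ∀ x ∈ ball x₀ R, closedBall x R ⊆ closedBall x₀ r := fun x hx =>
    closedBall_subset_closedBall' (by rw [mem_ball] at hx; linarith)
  have hGw : ∀ x ∈ ball x₀ R, G x = w x := by
    intro x hx
    have h1 : radialAverage W x b = radialAverage w x b := by
      rw [radialAverage_eq_indicator hb0 (inv_le_of_inv_le₀ hR hb.le),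
        radialAverage_eq_indicator hb0 (inv_le_of_inv_le₀ hR hb.le) (w := w),
        indicator_indicator, inter_eq_left.2 (hsub x hx)]
    have h2 := radialAverage_eq_of_integral_laplacian_eq_zero hR
      (hw.mono ((hsub x hx).trans hrU)) (fun c hc => by
        have hc0 : 0 < c := (inv_pos.2 hR).trans hc
        refine h _ (contDiff_scaled_radialBump E c x) (hasCompactSupport_scaled_radialBump hc0 x) ?_
        exact (tsupport_scaled_radialBump hc0 x).trans ((closedBall_subset_closedBall
          (inv_le_of_inv_le₀ hR hc.le)).trans ((hsub x hx).trans hrU))) hb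
    simp only [G]
    rw [h1, h2]
    exact mul_inv_cancel_right₀ hI.ne' _
  have hballU : ball x₀ R ⊆ U :=
    (ball_subset_closedBall.trans (closedBall_subset_closedBall (by linarith))).trans hrU
  have hcont : Continuous (Laplacian.laplacian G) := continuous_laplacian hG2
  -- Now that `G` is smooth, Green's identity moves the Laplacian onto it; testing gives zero almost
  -- everywhere, and continuity gives it everywhere.
  have hae : ∀ᵐ x, x ∈ ball x₀ R → Laplacian.laplacian G x = 0 := by
    refine isOpen_ball.ae_eq_zero_of_integral_contDiff_smul_eq_zero
      (hcont.locallyIntegrable.locallyIntegrableOn _) fun ψ hψ hψc hψs => ?_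
    have e1 : ∫ x, ψ x • Laplacian.laplacian G x = ∫ x, G x * Laplacian.laplacian ψ x := by
      rw [integral_mul_laplacian_eq hG2 (hψ.of_le two_le_infty) hψc]
      simp_rw [smul_eq_mul, mul_comm]
    rw [e1, ← h ψ hψ hψc (hψs.trans hballU)]
    refine integral_congr_ae (Eventually.of_forall fun x => ?_)
    by_cases hx : x ∈ tsupport ψ
    · simp only [hGw x (hψs hx)]
    · have : Laplacian.laplacian ψ x = 0 :=
        image_eq_zero_of_notMem_tsupport fun h' => hx (tsupport_laplacian_subset h')
      simp [this]
  have hzero : EqOn (Laplacian.laplacian G) (fun _ => 0) (ball x₀ R) :=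
    Measure.eqOn_open_of_ae_eq (μ := (volume : Measure E))
      ((ae_restrict_iff' measurableSet_ball).2 hae) isOpen_ball
      hcont.continuousOn continuousOn_const
  have hev : G =ᶠ[𝓝 x₀] w := by
    filter_upwards [ball_mem_nhds x₀ hR] with x hx using hGw x hx
  refine (InnerProductSpace.harmonicAt_congr_nhds hev).1 ⟨hG2.contDiffAt, ?_⟩
  filter_upwards [ball_mem_nhds x₀ hR] with x hx using hzero hx

end MeanValue

/-! ### Minimum principle for strictly superharmonic functions on a ball -/

section MaximumPrinciple

variable {E : Type*} [NormedAddCommGroup E] [InnerProductSpace ℝ E] [FiniteDimensional ℝ E]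
  [MeasurableSpace E] [BorelSpace E]

lemma integrable_mul_scaled_radialBump {g : E → ℝ} (hg : Continuous g) {b : ℝ} (hb : 0 < b)
    (x : E) : Integrable (fun y => g y * radialBump (b • (x - y))) :=
  (hg.mul (contDiff_scaled_radialBump E b x).continuous).integrable_of_hasCompactSupport
    (hasCompactSupport_scaled_radialBump hb x).mul_left

lemma integral_scaled_radialBump_pos {b : ℝ} (hb : 0 < b) (x : E) :
    0 < ∫ y, radialBump (b • (x - y)) :=
  (contDiff_scaled_radialBump E b x).continuous.integral_pos_of_hasCompactSupport_nonneg_nonzero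
    (hasCompactSupport_scaled_radialBump hb x) (fun _ => radialBump_nonneg _) (x := x)
    (by simpa using (radialBump_pos (E := E) (z := 0) (by simp)).ne')

lemma integral_mul_scaled_radialBump_le {g : E → ℝ} (hg : Continuous g) {x : E} {R b c : ℝ}
    (hR : 0 < R) (hb : R⁻¹ < b) (hc : ∀ y ∈ closedBall x R, g y ≤ c) :
    ∫ y, g y * radialBump (b • (x - y)) ≤ c * ∫ y, radialBump (b • (x - y)) := by
  have hb0 : 0 < b := (inv_pos.2 hR).trans hb
  rw [← integral_const_mul]
  refine integral_mono (integrable_mul_scaled_radialBump hg hb0 x)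
    (integrable_mul_scaled_radialBump continuous_const hb0 x) fun y => ?_
  by_cases hy : y ∈ closedBall x R
  · exact mul_le_mul_of_nonneg_right (hc y hy) (radialBump_nonneg _)
  · have : radialBump (b • (x - y)) = 0 := by
      apply image_eq_zero_of_notMem_tsupport (f := fun y => radialBump (b • (x - y)))
      exact fun h => hy (closedBall_subset_closedBall (inv_le_of_inv_le₀ hR hb.le)
        (tsupport_scaled_radialBump hb0 x h))
    simp [this]

lemma nonneg_of_laplacian_neg {h : E → ℝ} (hh : ContDiff ℝ 2 h) {r : ℝ}
    (hlap : ∀ x ∈ ball 0 r, Laplacian.laplacian h x < 0) (hs : ∀ x ∈ sphere 0 r, 0 ≤ h x) :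
    ∀ x ∈ closedBall (0 : E) r, 0 ≤ h x := by
  intro z hz
  obtain ⟨x, hx, hmin⟩ := (isCompact_closedBall (0 : E) r).exists_isMinOn ⟨z, hz⟩
    hh.continuous.continuousOn
  refine le_trans ?_ (hmin hz)
  by_contra hneg
  have hxs : x ∉ sphere (0 : E) r := fun h' => hneg (hs x h')
  have hxb : x ∈ ball (0 : E) r := by
    rw [mem_closedBall] at hx; rw [mem_sphere] at hxs; exact mem_ball.2 (lt_of_le_of_ne hx hxs)
  have hcont := continuous_laplacian hh
  -- Halving the negative value leaves a uniform negative bound near `x` to integrate against bumps.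
  have hnhds : {y | Laplacian.laplacian h y < Laplacian.laplacian h x / 2} ∩ ball 0 r ∈ 𝓝 x :=
    inter_mem ((isOpen_lt hcont continuous_const).mem_nhds (by
      have := hlap x hxb; simp only [mem_ofPred_eq]; linarith)) (isOpen_ball.mem_nhds hxb)
  obtain ⟨R, hR, hRs⟩ := nhds_basis_closedBall.mem_iff.1 hnhds
  have hh' : ContDiff ℝ 2 (fun y => h y - h x) := hh.sub contDiff_const
  refine not_min_of_integral_laplacian_neg (w := fun y => h y - h x) hR hh'.continuous.continuousOn
    (fun y hy => sub_nonneg.2 (hmin (ball_subset_closedBall (hRs hy).2))) (sub_self _)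
    fun b hb => ?_
  have hb0 : 0 < b := (inv_pos.2 hR).trans hb
  have hlapsub : ∀ y, Laplacian.laplacian (fun y => h y - h x) y = Laplacian.laplacian h y := by
    intro y
    have := hh.contDiffAt.laplacian_sub (x := y) (contDiffAt_const (c := h x))
    rw [InnerProductSpace.laplacian_const, Pi.zero_apply, sub_zero] at this
    exact this
  rw [integral_mul_laplacian_eq hh' ((contDiff_scaled_radialBump E b x).of_le two_le_infty)
    (hasCompactSupport_scaled_radialBump hb0 x)]
  simp_rw [hlapsub]
  refine (integral_mul_scaled_radialBump_le hcont hR hb (fun y hy => (hRs hy).1.le)).trans_lt ?_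
  exact mul_neg_of_neg_of_pos (by have := hlap x hxb; linarith)
    (integral_scaled_radialBump_pos hb0 x)

end MaximumPrinciple

/-! ### The Dirichlet problem on a ball for polynomial data -/

section PolynomialDirichlet

set_option linter.unusedSectionVars false

variable {ι : Type*} [Fintype ι]

/-- The polynomial function on Euclidean space given by `p`. -/
noncomputable def polyFun (p : MvPolynomial ι ℝ) (x : EuclideanSpace ℝ ι) : ℝ :=
  MvPolynomial.eval (fun i => x i) p

/-- The Laplacian on polynomials. -/
noncomputable def polyLaplacian : MvPolynomial ι ℝ →ₗ[ℝ] MvPolynomial ι ℝ :=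
  ∑ i, (MvPolynomial.pderiv i).toLinearMap ∘ₗ (MvPolynomial.pderiv i).toLinearMap

/-- The polynomial `r² - ∑ xᵢ²`. -/
noncomputable def sphereDefining (ι : Type*) [Fintype ι] (r : ℝ) : MvPolynomial ι ℝ :=
  MvPolynomial.C (r ^ 2) - ∑ i, MvPolynomial.X i ^ 2

lemma polyLaplacian_apply (p : MvPolynomial ι ℝ) :
    polyLaplacian p = ∑ i, MvPolynomial.pderiv i (MvPolynomial.pderiv i p) := by
  simp [polyLaplacian]

@[simp] lemma polyFun_add (p q : MvPolynomial ι ℝ) (x : EuclideanSpace ℝ ι) :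
    polyFun (p + q) x = polyFun p x + polyFun q x := by simp [polyFun]

@[simp] lemma polyFun_sub (p q : MvPolynomial ι ℝ) (x : EuclideanSpace ℝ ι) :
    polyFun (p - q) x = polyFun p x - polyFun q x := by simp [polyFun]

@[simp] lemma polyFun_mul (p q : MvPolynomial ι ℝ) (x : EuclideanSpace ℝ ι) :
    polyFun (p * q) x = polyFun p x * polyFun q x := by simp [polyFun]

@[simp] lemma polyFun_C (a : ℝ) (x : EuclideanSpace ℝ ι) :
    polyFun (MvPolynomial.C a) x = a := by simp [polyFun]

@[simp] lemma polyFun_X (i : ι) (x : EuclideanSpace ℝ ι) :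
    polyFun (MvPolynomial.X i) x = x i := by simp [polyFun]

lemma polyFun_sphereDefining (r : ℝ) (x : EuclideanSpace ℝ ι) :
    polyFun (sphereDefining ι r) x = r ^ 2 - ‖x‖ ^ 2 := by
  simp [polyFun, sphereDefining, EuclideanSpace.norm_sq_eq]

lemma contDiff_polyFun (p : MvPolynomial ι ℝ) {n : WithTop ℕ∞} : ContDiff ℝ n (polyFun p) := by
  induction p using MvPolynomial.induction_on with
  | C a =>
    have : polyFun (MvPolynomial.C a : MvPolynomial ι ℝ) = fun _ => a := funext fun x => by simp
    rw [this]; exact contDiff_const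
  | add p q hp hq =>
    have : polyFun (p + q) = fun x => polyFun p x + polyFun q x := funext fun x => by simp
    rw [this]; exact hp.add hq
  | mul_X p i hp =>
    have : polyFun (p * MvPolynomial.X i) = fun x => polyFun p x * x i := funext fun x => by simp
    rw [this]; exact hp.mul (EuclideanSpace.proj i : EuclideanSpace ℝ ι →L[ℝ] ℝ).contDiff

lemma fderiv_polyFun [DecidableEq ι] (p : MvPolynomial ι ℝ) (x : EuclideanSpace ℝ ι) (i : ι) :
    fderiv ℝ (polyFun p) x (EuclideanSpace.single i 1) =
      polyFun (MvPolynomial.pderiv i p) x := by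
  induction p using MvPolynomial.induction_on with
  | C a =>
    have : polyFun (MvPolynomial.C a : MvPolynomial ι ℝ) = fun _ => a := funext fun x => by simp
    rw [this]; simp [polyFun]
  | add p q hp hq =>
    have : polyFun (p + q) = fun x => polyFun p x + polyFun q x := funext fun x => by simp
    rw [this, fderiv_fun_add ((contDiff_polyFun p (n := 1)).differentiable (by norm_num) x)
      ((contDiff_polyFun q (n := 1)).differentiable (by norm_num) x)]
    simp [hp, hq]
  | mul_X p j hp =>
    have : polyFun (p * MvPolynomial.X j) = fun x => polyFun p x * x j := funext fun x => by simp
    have h1 : HasFDerivAt (fun x : EuclideanSpace ℝ ι => x j)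
      (EuclideanSpace.proj j : EuclideanSpace ℝ ι →L[ℝ] ℝ) x :=
      (EuclideanSpace.proj j : EuclideanSpace ℝ ι →L[ℝ] ℝ).hasFDerivAt
    have h2 := ((contDiff_polyFun p (n := 1)).differentiable (by norm_num) x).hasFDerivAt
    have h3 : HasFDerivAt (fun x => polyFun p x * x j) _ x := h2.mul h1
    rw [this, h3.fderiv]
    simp only [add_apply, smul_apply, hp, smul_eq_mul, Derivation.leibniz, polyFun_add,
      polyFun_mul, MvPolynomial.pderiv_X, polyFun_X]
    by_cases hij : i = j
    · subst hij; simp [polyFun]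
    · have hji : j ≠ i := fun h => hij h.symm
      simp [polyFun, hji]

lemma laplacian_polyFun (p : MvPolynomial ι ℝ) (x : EuclideanSpace ℝ ι) :
    Laplacian.laplacian (polyFun p) x = polyFun (polyLaplacian p) x := by
  classical
  rw [laplacian_eq_sum_fderiv (EuclideanSpace.basisFun ι ℝ) (contDiff_polyFun p),
    polyLaplacian_apply]
  have h : ∀ i, (fun y => fderiv ℝ (polyFun p) y (EuclideanSpace.basisFun ι ℝ i)) =
      polyFun (MvPolynomial.pderiv i p) := fun i => funext fun y => by
    simpa using fderiv_polyFun p y i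
  simp_rw [h]
  have h2 : polyFun (∑ i, MvPolynomial.pderiv i (MvPolynomial.pderiv i p)) x =
      ∑ i, polyFun (MvPolynomial.pderiv i (MvPolynomial.pderiv i p)) x := by
    simp [polyFun]
  rw [h2]
  exact Finset.sum_congr rfl fun i _ => by simpa using fderiv_polyFun (MvPolynomial.pderiv i p) x i

lemma polyLaplacian_sphereDefining (r : ℝ) :
    polyLaplacian (sphereDefining ι r) = MvPolynomial.C (-(2 * Fintype.card ι : ℝ)) := by
  classical
  have h : ∀ i : ι, MvPolynomial.pderiv i (sphereDefining ι r) = -(2 * MvPolynomial.X i) := by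
    intro i
    simp only [sphereDefining, map_sub, map_sum, MvPolynomial.pderiv_C, zero_sub,
      MvPolynomial.pderiv_pow, MvPolynomial.pderiv_X]
    rw [Finset.sum_eq_single i]
    · simp
    · intro j _ hj; simp [hj]
    · simp
  rw [polyLaplacian_apply]
  simp_rw [h]
  have h2 : ∀ i : ι, MvPolynomial.pderiv i (-(2 * MvPolynomial.X i) : MvPolynomial ι ℝ) =
      MvPolynomial.C (-2) := by
    intro i
    have e : (2 : MvPolynomial ι ℝ) = MvPolynomial.C 2 := (map_ofNat MvPolynomial.C 2).symm
    rw [map_neg, e, MvPolynomial.pderiv_C_mul, MvPolynomial.pderiv_X_self, mul_one, map_neg]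
  simp_rw [h2]
  simp [mul_comm]

lemma totalDegree_pderiv_le {p : MvPolynomial ι ℝ} {k : ℕ} (hp : p.totalDegree ≤ k + 1) (i : ι) :
    (MvPolynomial.pderiv i p).totalDegree ≤ k := by
  refine Finset.sup_le fun m hm => ?_
  rw [MvPolynomial.mem_support_iff, MvPolynomial.coeff_pderiv] at hm
  have hm' : m + Finsupp.single i 1 ∈ p.support :=
    MvPolynomial.mem_support_iff.2 (left_ne_zero_of_mul hm)
  have h1 := MvPolynomial.le_totalDegree hm'
  rw [Finsupp.sum_add_index' (by simp) (by simp)] at h1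
  simp only [Finsupp.sum_single_index] at h1
  omega

lemma totalDegree_polyLaplacian_le {p : MvPolynomial ι ℝ} {k : ℕ}
    (hp : p.totalDegree ≤ k + 2) : (polyLaplacian p).totalDegree ≤ k := by
  rw [polyLaplacian_apply]
  exact MvPolynomial.totalDegree_finsetSum_le fun i _ =>
    totalDegree_pderiv_le (totalDegree_pderiv_le hp i) i

lemma totalDegree_sphereDefining_le (r : ℝ) : (sphereDefining ι r).totalDegree ≤ 2 := by
  refine (MvPolynomial.totalDegree_sub _ _).trans (max_le
    ((MvPolynomial.totalDegree_C _).le.trans zero_le_two) ?_)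
  exact MvPolynomial.totalDegree_finsetSum_le fun i _ => by
    simp [MvPolynomial.totalDegree_X_pow]

/-- Adding `c (r ^ 2 - |x| ^ 2)` with small `c > 0` makes `q` strictly superharmonic without
changing it on the sphere. Strictness needs at least one variable. -/
lemma polyFun_nonneg_of_polyLaplacian_eq_zero [Nonempty ι] {q : MvPolynomial ι ℝ} {r : ℝ}
    (hq : polyLaplacian q = 0) (hs : ∀ x ∈ sphere (0 : EuclideanSpace ℝ ι) r, polyFun q x = 0) :
    ∀ x ∈ ball (0 : EuclideanSpace ℝ ι) r, 0 ≤ polyFun q x := by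
  intro x hx
  have hcard : (0 : ℝ) < Fintype.card ι := by exact_mod_cast Fintype.card_pos
  refine le_of_forall_pos_le_add fun η hη => ?_
  set c : ℝ := η / (r ^ 2 + 1)
  have hc : 0 < c := by positivity
  have h := nonneg_of_laplacian_neg (r := r)
    (contDiff_polyFun (q + MvPolynomial.C c * sphereDefining ι r))
    (fun y _ => by
      rw [laplacian_polyFun, map_add, ← MvPolynomial.smul_eq_C_mul, map_smul,
        polyLaplacian_sphereDefining, hq, MvPolynomial.smul_eq_C_mul]
      simp only [zero_add, polyFun_mul, polyFun_C]
      nlinarith [mul_pos hc hcard])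
    (fun y hy => by
      rw [polyFun_add, hs y hy, polyFun_mul, polyFun_sphereDefining, mem_sphere_zero_iff_norm.1 hy]
      simp)
    x (ball_subset_closedBall hx)
  rw [polyFun_add, polyFun_mul, polyFun_sphereDefining, polyFun_C] at h
  have h2 : c * (r ^ 2 - ‖x‖ ^ 2) ≤ η := by
    have : c * (r ^ 2 + 1) = η := by simp only [c]; field_simp
    nlinarith [sq_nonneg ‖x‖]
  linarith

lemma eq_zero_of_polyFun_eq_zero {p : MvPolynomial ι ℝ} {r : ℝ} (hr : 0 < r)
    (h : ∀ x ∈ ball (0 : EuclideanSpace ℝ ι) r, polyFun p x = 0) : p = 0 := by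
  -- The cube of half side `a` lies in the ball, since `card * a ^ 2 < (card + 1) ^ 2 * a ^ 2 = r ^
  -- 2`.
  set a : ℝ := r / (Fintype.card ι + 1)
  have ha : 0 < a := by positivity
  refine MvPolynomial.funext_set (fun _ => Ioo (-a) a) (fun _ => Ioo_infinite (by linarith)) ?_
  intro x hx
  have h1 := h (WithLp.toLp 2 x) (by
    rw [mem_ball_zero_iff]
    refine lt_of_pow_lt_pow_left₀ 2 hr.le ?_
    rw [EuclideanSpace.norm_sq_eq]
    have h2 : ∀ i ∈ Finset.univ, ‖x i‖ ^ 2 ≤ a ^ 2 := fun i _ => by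
      have := hx i (mem_univ i)
      rw [Real.norm_eq_abs, sq_abs]
      exact sq_le_sq' this.1.le this.2.le
    refine (Finset.sum_le_card_nsmul _ _ _ h2).trans_lt ?_
    rw [Finset.card_univ, nsmul_eq_mul]
    have h3 : r = a * (Fintype.card ι + 1) := by simp only [a]; field_simp
    have h4 : (0 : ℝ) ≤ Fintype.card ι := by positivity
    rw [h3]
    nlinarith [pow_pos ha 2, mul_nonneg h4 h4, mul_nonneg (pow_pos ha 2).le h4,
      mul_nonneg (pow_pos ha 2).le (mul_nonneg h4 h4)])
  simpa [polyFun] using h1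

/-- The product is harmonic and vanishes on the sphere. The minimum principle for it and for its
negative makes it zero in the ball, where the factor `r ^ 2 - |x| ^ 2` is positive. -/
lemma eq_zero_of_polyLaplacian_sphereDefining_mul [Nonempty ι] {p : MvPolynomial ι ℝ} {r : ℝ}
    (hr : 0 < r) (h : polyLaplacian (sphereDefining ι r * p) = 0) : p = 0 := by
  refine eq_zero_of_polyFun_eq_zero hr fun x hx => ?_
  have hz : ∀ q : MvPolynomial ι ℝ, ∀ y ∈ sphere (0 : EuclideanSpace ℝ ι) r,
      polyFun (sphereDefining ι r * q) y = 0 := fun q y hy => by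
    rw [polyFun_mul, polyFun_sphereDefining, mem_sphere_zero_iff_norm.1 hy]; simp
  have h1 := polyFun_nonneg_of_polyLaplacian_eq_zero h (hz p) x hx
  have h2 := polyFun_nonneg_of_polyLaplacian_eq_zero (q := sphereDefining ι r * -p)
    (by rw [mul_neg, map_neg, h, neg_zero]) (hz (-p)) x hx
  have h3 : polyFun (-p) x = -polyFun p x := by simp [polyFun]
  rw [polyFun_mul, polyFun_sphereDefining] at h1 h2
  rw [h3] at h2
  have h4 : 0 < r ^ 2 - ‖x‖ ^ 2 := by
    rw [mem_ball_zero_iff] at hx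
    nlinarith [norm_nonneg x]
  nlinarith

/-- The Dirichlet problem on a ball with polynomial boundary data has a polynomial solution. -/
lemma exists_polyLaplacian_eq_zero [Nonempty ι] (p : MvPolynomial ι ℝ) {r : ℝ} (hr : 0 < r) :
    ∃ q : MvPolynomial ι ℝ, polyLaplacian q = 0 ∧
      ∀ x ∈ sphere (0 : EuclideanSpace ℝ ι) r, polyFun q x = polyFun p x := by
  set k := p.totalDegree
  let V := MvPolynomial.restrictTotalDegree ι ℝ k
  -- Multiplication by `r ^ 2 - |x| ^ 2` raises the degree by at most two and the Laplacian lowers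
  -- it by two. So this map acts on the finite-dimensional space of degree at most `k`, where
  -- injectivity gives surjectivity. A preimage `s` of `Δ p` yields the solution `p - (r ^ 2 - |x| ^
  -- 2) s`.
  let L₀ : MvPolynomial ι ℝ →ₗ[ℝ] MvPolynomial ι ℝ :=
    polyLaplacian ∘ₗ LinearMap.mulLeft ℝ (sphereDefining ι r)
  have hL₀ : ∀ q, L₀ q = polyLaplacian (sphereDefining ι r * q) := fun q => rfl
  have hmaps : ∀ q ∈ V, L₀ q ∈ V := by
    intro q hq
    rw [MvPolynomial.mem_restrictTotalDegree] at hq ⊢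
    refine totalDegree_polyLaplacian_le ((MvPolynomial.totalDegree_mul _ _).trans ?_)
    have := totalDegree_sphereDefining_le (ι := ι) r
    omega
  let L : V →ₗ[ℝ] V := L₀.restrict hmaps
  have hinj : Function.Injective L := by
    rw [← LinearMap.ker_eq_bot, LinearMap.ker_eq_bot']
    intro q hq
    have := congrArg Subtype.val hq
    exact Subtype.ext (eq_zero_of_polyLaplacian_sphereDefining_mul hr this)
  have hsurj : Function.Surjective L := LinearMap.injective_iff_surjective.1 hinj
  have hpV : polyLaplacian p ∈ V := by
    rw [MvPolynomial.mem_restrictTotalDegree]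
    exact totalDegree_polyLaplacian_le (by omega)
  obtain ⟨s, hs⟩ := hsurj ⟨_, hpV⟩
  have hs' : polyLaplacian (sphereDefining ι r * (s : MvPolynomial ι ℝ)) = polyLaplacian p := congrArg Subtype.val hs
  refine ⟨p - sphereDefining ι r * (s : MvPolynomial ι ℝ), by rw [map_sub, hs', sub_self], fun x hx => ?_⟩
  rw [polyFun_sub, polyFun_mul, polyFun_sphereDefining, mem_sphere_zero_iff_norm.1 hx]
  simp

/-- Stone–Weierstrass: the coordinates separate points. -/
lemma exists_polyFun_near {K : Set (EuclideanSpace ℝ ι)} (hK : IsCompact K)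
    {f : EuclideanSpace ℝ ι → ℝ} (hf : ContinuousOn f K) {η : ℝ} (hη : 0 < η) :
    ∃ p : MvPolynomial ι ℝ, ∀ x ∈ K, |polyFun p x - f x| < η := by
  have := isCompact_iff_compactSpace.1 hK
  let X : ι → C(K, ℝ) := fun i => ⟨fun x => (x : EuclideanSpace ℝ ι) i, by fun_prop⟩
  have heval : ∀ (p : MvPolynomial ι ℝ) (x : K), (MvPolynomial.aeval X p) x = polyFun p x := by
    intro p x
    induction p using MvPolynomial.induction_on with
    | C a => simp
    | add p q hp hq => simp [hp, hq]
    | mul_X p i hp => simp [hp, X]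
  have hsep : (MvPolynomial.aeval (R := ℝ) X).range.SeparatesPoints := by
    intro x y hxy
    have : ∃ i, (x : EuclideanSpace ℝ ι) i ≠ (y : EuclideanSpace ℝ ι) i := by
      by_contra! h
      exact hxy (Subtype.ext (PiLp.ext h))
    obtain ⟨i, hi⟩ := this
    exact ⟨X i, ⟨X i, ⟨MvPolynomial.X i, by simp⟩, rfl⟩, hi⟩
  obtain ⟨⟨g, p, hp⟩, hg⟩ :=
    ContinuousMap.exists_mem_subalgebra_near_continuous_of_separatesPoints _ hsep
    (fun x : K => f x) (continuousOn_iff_continuous_domRestrict.1 hf) η hη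
  refine ⟨p, fun x hx => ?_⟩
  have := hg ⟨x, hx⟩
  rw [Real.norm_eq_abs] at this
  have h2 : g ⟨x, hx⟩ = polyFun p x := by rw [← hp]; exact heval p ⟨x, hx⟩
  simpa [h2] using this

end PolynomialDirichlet

/-! ### Smooth functions touching a distributional solution in the interior -/

section InteriorTouching

variable {E : Type*} [NormedAddCommGroup E] [InnerProductSpace ℝ E] [FiniteDimensional ℝ E]
  [MeasurableSpace E] [BorelSpace E]

lemma integrable_mul_of_continuousOn {w k : E → ℝ} {K : Set E} (hK : IsCompact K)
    (hw : ContinuousOn w K) (hk : Continuous k) (hks : tsupport k ⊆ K) :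
    Integrable (fun y => w y * k y) := by
  have h1 : IntegrableOn (fun y => w y * k y) K :=
    (hw.mul hk.continuousOn).integrableOn_compact hK
  refine (integrableOn_iff_integrable_of_support_subset fun y hy => ?_).1 h1
  by_contra h
  exact hy (by simp [image_eq_zero_of_notMem_tsupport fun h' => h (hks h')])

/-- If `-Δ w = F ≤ c` near `x` and the smooth function `W` touches `w` from above at `x`, then
`-Δ W x ≤ c`. -/
lemma le_laplacian_of_touching_above {w W F : E → ℝ} {x : E} {R c : ℝ} (hR : 0 < R)
    (hc : 0 ≤ c) (hw : ContinuousOn w (closedBall x R)) (hW : ContDiff ℝ 2 W)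
    (heq : ∀ ψ : E → ℝ, ContDiff ℝ ∞ ψ → HasCompactSupport ψ → tsupport ψ ⊆ closedBall x R →
      ∫ y, w y * Laplacian.laplacian ψ y = -∫ y, F y * ψ y)
    (hF : ∀ᵐ y, y ∈ closedBall x R → F y ≤ c)
    (hle : ∀ y ∈ closedBall x R, w y ≤ W y) (hx : w x = W x) :
    -c ≤ Laplacian.laplacian W x := by
  by_contra! hlt
  have hcont := continuous_laplacian hW
  -- The midpoint of `ΔW x` and `-c`: it exceeds `ΔW x`, so `ΔW < m` near `x`, and still `m + c <
  -- 0`. This makes the distributional Laplacian of `W - w` negative on bumps, although `W - w` has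
  -- a minimum at `x`.
  set m := (Laplacian.laplacian W x - c) / 2 with hm
  have hnhds : {y | Laplacian.laplacian W y < m} ∩ closedBall x R ∈ 𝓝 x :=
    inter_mem ((isOpen_lt hcont continuous_const).mem_nhds (by
      simp only [mem_ofPred_eq]; linarith)) (closedBall_mem_nhds x hR)
  obtain ⟨S, hS, hSs⟩ := nhds_basis_closedBall.mem_iff.1 hnhds
  have hSR : closedBall x S ⊆ closedBall x R := fun y hy => (hSs hy).2
  refine not_min_of_integral_laplacian_neg (w := fun y => W y - w y) hS
    (hW.continuous.continuousOn.sub (hw.mono hSR)) (fun y hy => sub_nonneg.2 (hle y (hSR hy)))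
    (by simp [hx]) fun b hb => ?_
  have hb0 : 0 < b := (inv_pos.2 hS).trans hb
  set T : E → ℝ := fun y => radialBump (b • (x - y)) with hT
  have hTc : ContDiff ℝ ∞ T := contDiff_scaled_radialBump E b x
  have hT2 : ContDiff ℝ 2 T := hTc.of_le two_le_infty
  have hTs : HasCompactSupport T := hasCompactSupport_scaled_radialBump hb0 x
  have hTS : tsupport T ⊆ closedBall x S := (tsupport_scaled_radialBump hb0 x).trans
    (closedBall_subset_closedBall (inv_le_of_inv_le₀ hS hb.le))
  have hLs : tsupport (Laplacian.laplacian T : E → ℝ) ⊆ closedBall x R :=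
    tsupport_laplacian_subset.trans (hTS.trans hSR)
  have hsplit : ∫ y, (W y - w y) * Laplacian.laplacian T y =
      (∫ y, Laplacian.laplacian W y * T y) + ∫ y, F y * T y := by
    simp_rw [sub_mul]
    rw [integral_sub (integrable_mul_of_continuousOn (isCompact_closedBall x R)
        hW.continuous.continuousOn (continuous_laplacian hT2) hLs)
      (integrable_mul_of_continuousOn (isCompact_closedBall x R) hw (continuous_laplacian hT2) hLs),
      integral_mul_laplacian_eq hW hT2 hTs, heq T hTc hTs (hTS.trans hSR), sub_neg_eq_add]
  rw [hsplit]
  have hpos : 0 < ∫ y, T y := integral_scaled_radialBump_pos hb0 x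
  have h1 : ∫ y, Laplacian.laplacian W y * T y ≤ m * ∫ y, T y :=
    integral_mul_scaled_radialBump_le hcont hS hb fun y hy => (hSs hy).1.le
  have h2 : ∫ y, F y * T y ≤ c * ∫ y, T y := by
    by_cases hint : Integrable (fun y => F y * T y)
    · rw [← integral_const_mul]
      refine integral_mono_ae hint
        (integrable_mul_scaled_radialBump continuous_const hb0 x) ?_
      filter_upwards [hF] with y hy
      by_cases hyS : y ∈ closedBall x R
      · exact mul_le_mul_of_nonneg_right (hy hyS) (radialBump_nonneg _)
      · have : T y = 0 := image_eq_zero_of_notMem_tsupport fun h => hyS (hSR (hTS h))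
        rw [this]; simp
    -- A non-integrable product has integral `0` by convention, and `0 ≤ c`.
    · rw [integral_undef hint]; positivity
  have h3 : m + c < 0 := by simp only [hm]; linarith
  nlinarith

/-- If `-Δ w = F ≥ 0` near `x` and the smooth function `W` touches `w` from below at `x`, then
`Δ W x ≤ 0`. -/
lemma laplacian_le_of_touching_below {w W F : E → ℝ} {x : E} {R : ℝ} (hR : 0 < R)
    (hw : ContinuousOn w (closedBall x R)) (hW : ContDiff ℝ 2 W)
    (heq : ∀ ψ : E → ℝ, ContDiff ℝ ∞ ψ → HasCompactSupport ψ → tsupport ψ ⊆ closedBall x R →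
      ∫ y, w y * Laplacian.laplacian ψ y = -∫ y, F y * ψ y)
    (hF : ∀ᵐ y, y ∈ closedBall x R → 0 ≤ F y)
    (hle : ∀ y ∈ closedBall x R, W y ≤ w y) (hx : w x = W x) :
    Laplacian.laplacian W x ≤ 0 := by
  have h := le_laplacian_of_touching_above (w := fun y => -w y) (W := -W)
    (F := fun y => -F y) (c := 0) hR le_rfl hw.neg hW.neg
    (fun ψ h1 h2 h3 => by
      simp_rw [neg_mul, integral_neg]; rw [heq ψ h1 h2 h3])
    (by filter_upwards [hF] with y hy h'; linarith [hy h'])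
    (fun y hy => neg_le_neg (hle y hy)) (by simp [hx])
  rw [InnerProductSpace.laplacian_neg, Pi.neg_apply] at h
  linarith

end InteriorTouching

/-! ### Tangent balls at regular zeros of `C²` functions -/

section TangentBall

variable {E : Type*} [NormedAddCommGroup E] [InnerProductSpace ℝ E]

/-- The derivative is Lipschitz near `x`; the mean value inequality on `closedBall x ‖h‖` turns this
into a quadratic remainder. -/
lemma exists_quadratic_bound {W : E → ℝ} (hW : ContDiff ℝ 2 W) (x : E) :
    ∃ C : ℝ, 0 < C ∧ ∃ s : ℝ, 0 < s ∧ ∀ h : E, ‖h‖ < s →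
      |W (x + h) - W x - fderiv ℝ W x h| ≤ C * ‖h‖ ^ 2 := by
  obtain ⟨K, t, ht, hK⟩ :=
    ((hW.fderiv_right (m := 1) (by norm_num)).contDiffAt (x := x)).exists_lipschitzOnWith
  obtain ⟨s, hs, hst⟩ := Metric.mem_nhds_iff.1 ht
  refine ⟨K + 1, by positivity, s, hs, fun h hh => ?_⟩
  have hsub : closedBall x ‖h‖ ⊆ t := (closedBall_subset_ball hh).trans hst
  have hxm : x ∈ closedBall x ‖h‖ := mem_closedBall_self (norm_nonneg h)
  have key := (convex_closedBall x ‖h‖).norm_image_sub_le_of_norm_fderiv_le' (𝕜 := ℝ)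
    (f := W) (φ := fderiv ℝ W x) (C := K * ‖h‖) (fun y _ => hW.differentiable (by norm_num) y)
    (fun y hy => by
      refine (hK.norm_sub_le (hsub hy) (hsub hxm)).trans ?_
      rw [mem_closedBall, dist_eq_norm] at hy
      gcongr)
    hxm (y := x + h) (by simp [mem_closedBall, dist_eq_norm])
  rw [Real.norm_eq_abs, add_sub_cancel_left] at key
  refine key.trans ?_
  nlinarith [sq_nonneg ‖h‖]

/-- At a zero with nonzero gradient `a`, the positivity set of a `C²` function has an interior
tangent ball. -/
lemma exists_tangent_ball {W : E → ℝ} (hW : ContDiff ℝ 2 W) {x a : E} (hx : W x = 0)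
    (ha : ∀ h, fderiv ℝ W x h = inner ℝ a h) (ha0 : a ≠ 0) {s : ℝ} (hs : 0 < s) :
    ∃ t : ℝ, 0 < t ∧ ∀ y ∈ closedBall (x + t • a) (t * ‖a‖), y ≠ x → y ∈ ball x s ∧ 0 < W y := by
  obtain ⟨C, hC, s', hs', hq⟩ := exists_quadratic_bound hW x
  have hna : 0 < ‖a‖ := norm_pos_iff.2 ha0
  set m := min s s' with hm
  have hmpos : 0 < m := lt_min hs hs'
  -- One bound with two uses: `4 C t ≤ 1` absorbs the quadratic remainder, and `3 t ‖a‖ ≤ m` keeps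
  -- the ball, of diameter `2 t ‖a‖`, where the expansion holds.
  obtain ⟨t, ht0, ht⟩ : ∃ t : ℝ, 0 < t ∧ t * (4 * C + 3 * ‖a‖ / m) ≤ 1 :=
    ⟨(4 * C + 3 * ‖a‖ / m)⁻¹, by positivity, by rw [inv_mul_cancel₀ (by positivity)]⟩
  refine ⟨t, ht0, fun y hy hyx => ?_⟩
  set h := y - x with hh
  have hy' : ‖h - t • a‖ ≤ t * ‖a‖ := by
    rw [mem_closedBall, dist_eq_norm] at hy
    rwa [hh, sub_sub]
  have hh0 : 0 < ‖h‖ := norm_pos_iff.2 (sub_ne_zero.2 hyx)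
  -- Membership in the ball of centre `t • a` and radius `t * ‖a‖`, squared out. The linear term of
  -- `W` thus dominates `‖h‖ ^ 2 / (2 t)`.
  have h1 : ‖h‖ ^ 2 ≤ 2 * t * inner ℝ a h := by
    have := pow_le_pow_left₀ (norm_nonneg _) hy' 2
    rw [norm_sub_sq_real, norm_smul, Real.norm_of_nonneg ht0.le, inner_smul_right,
      real_inner_comm] at this
    linarith
  have h2 : ‖h‖ ≤ 2 * (t * ‖a‖) := by
    have e1 : ‖h‖ ≤ ‖h - t • a‖ + ‖t • a‖ := by
      simpa using norm_add_le (h - t • a) (t • a)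
    rw [norm_smul, Real.norm_of_nonneg ht0.le] at e1
    linarith
  have ht1 : t * (4 * C) ≤ 1 := by
    have : 0 ≤ t * (3 * ‖a‖ / m) := by positivity
    nlinarith
  have ht2 : t * (3 * ‖a‖) ≤ m := by
    have e1 : t * (3 * ‖a‖ / m) ≤ 1 := by
      have : 0 ≤ t * (4 * C) := by positivity
      nlinarith
    rw [← mul_div_assoc, div_le_one hmpos] at e1
    exact e1
  have h3 : ‖h‖ < m := by nlinarith [mul_pos ht0 hna]
  have hyxh : y = x + h := by simp [hh]
  refine ⟨?_, ?_⟩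
  · rw [mem_ball, dist_eq_norm]
    exact h3.trans_le (min_le_left _ _)
  · have e := hq h (h3.trans_le (min_le_right _ _))
    rw [hx, ha, sub_zero, ← hyxh] at e
    have e2 := (abs_le.1 e).1
    have e3 : 2 * t * (C * ‖h‖ ^ 2) ≤ ‖h‖ ^ 2 / 2 := by nlinarith [sq_nonneg ‖h‖]
    have e4 : 0 < 2 * t * W y := by nlinarith [pow_pos hh0 2]
    exact pos_of_mul_pos_right e4 (by positivity)

end TangentBall

/-! ### Smooth functions touching the two means at the free boundary -/

section BoundaryTouching

variable {d : ℕ}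

lemma isOpen_unitBall : IsOpen (unitBall d) := isOpen_ball

lemma isOpen_posSet {u : Space d → ℝ} (hu : ContinuousOn u (unitBall d)) :
    IsOpen (posSet u) :=
  hu.isOpen_inter_preimage isOpen_unitBall isOpen_Ioi

lemma eq_zero_of_notMem_posSet {u : Space d → ℝ} (hu : ∀ x ∈ unitBall d, 0 ≤ u x) {x : Space d}
    (hx : x ∈ unitBall d) (hx' : x ∉ posSet u) : u x = 0 :=
  le_antisymm (not_lt.1 fun h => hx' ⟨hx, h⟩) (hu x hx)

lemma notMem_posSet_of_mem_frontier {u : Space d → ℝ} (hu : ContinuousOn u (unitBall d))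
    {x : Space d} (hx : x ∈ frontier (posSet u)) : x ∉ posSet u := by
  rw [(isOpen_posSet hu).frontier_eq] at hx
  exact hx.2

lemma tendsto_blowUp_quotient {W : Space d → ℝ} (hW : ContDiff ℝ 2 W) {x a : Space d}
    (hx : W x = 0) (ha : ∀ h, fderiv ℝ W x h = inner ℝ a h) {r : ℕ → ℝ} (hr0 : ∀ k, 0 < r k)
    (hr : Tendsto r atTop (𝓝 0)) (e : Space d) :
    Tendsto (fun k => W (x + r k • e) / r k) atTop (𝓝 (inner ℝ a e)) := by
  have h1 : HasDerivAt (fun t : ℝ => x + t • e) e 0 := by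
    simpa using ((hasDerivAt_id (0 : ℝ)).smul_const e).const_add x
  have h2 : HasDerivAt (fun t : ℝ => W (x + t • e)) (inner ℝ a e) 0 := by
    have h3 : HasFDerivAt W (fderiv ℝ W x) (x + (0 : ℝ) • e) := by
      simpa using (hW.differentiable (by norm_num) x).hasFDerivAt
    have := h3.comp_hasDerivAt (0 : ℝ) h1
    rwa [ha] at this
  have h3 := hasDerivAt_iff_tendsto_slope.1 h2
  have h4 : Tendsto r atTop (𝓝[≠] 0) :=
    tendsto_nhdsWithin_iff.2 ⟨hr, Eventually.of_forall fun k => (hr0 k).ne'⟩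
  refine (h3.comp h4).congr fun k => ?_
  simp [slope_def_field, hx]

lemma eventually_blowUp_mem_ball {x : Space d} {s : ℝ} (hs : 0 < s) {r : ℕ → ℝ}
    (hr : Tendsto r atTop (𝓝 0)) (e : Space d) : ∀ᶠ k in atTop, x + r k • e ∈ ball x s := by
  have h : Tendsto (fun k => x + r k • e) atTop (𝓝 x) := by
    simpa using (hr.smul_const e).const_add x
  exact h.eventually_mem (ball_mem_nhds x hs)

/-- Near `x` the set `{W < 0}` misses the closure of the positivity set, so it provides an outer
tangent ball and the free boundary condition applies. Comparing blow-ups in the direction `ν` gives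
`(α + β) / 2 ≤ ‖a‖`, and `α β ≤ ((α + β) / 2) ^ 2`. -/
lemma boundary_le_of_touching_above {f g Q u v W : Space d → ℝ} (hsol : IsSolution f g Q u v)
    {x a : Space d} {s : ℝ} (hs : 0 < s) (hsB : ball x s ⊆ unitBall d)
    (hxf : x ∈ frontier (posSet u)) (hW : ContDiff ℝ 2 W) (hx : W x = 0)
    (ha : ∀ h, fderiv ℝ W x h = inner ℝ a h) (ha0 : a ≠ 0)
    (hle : ∀ y ∈ ball x s, y ∈ posSet u → (u y + v y) / 2 ≤ W y) :
    Q x ≤ ‖a‖ ^ 2 := by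
  have hxB : x ∈ unitBall d := hsB (mem_ball_self hs)
  have hWcl : ∀ y ∈ ball x s, y ∈ closure (posSet u) → 0 ≤ W y := by
    intro y hy hyc
    have h1 : y ∈ closure (ball x s ∩ posSet u) := isOpen_ball.inter_closure ⟨hy, hyc⟩
    refine closure_minimal (t := {y | 0 ≤ W y}) (fun z hz => ?_)
      (isClosed_le continuous_const hW.continuous) h1
    have h2 := hle z hz.1 hz.2
    have h3 := hsol.nonneg_right z (hsB hz.1)
    have h4 := hz.2.2
    simp only [mem_ofPred_eq]
    linarith
  have hmax : ∀ y ∈ ball x s, (u y + v y) / 2 ≤ max (W y) 0 := by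
    intro y hy
    by_cases hyp : y ∈ posSet u
    · exact (hle y hy hyp).trans (le_max_left _ _)
    · have h1 := eq_zero_of_notMem_posSet hsol.nonneg_left (hsB hy) hyp
      have h2 := eq_zero_of_notMem_posSet hsol.nonneg_right (hsB hy) (hsol.posSet_eq ▸ hyp)
      simp [h1, h2]
  obtain ⟨t, ht0, ht⟩ := exists_tangent_ball (W := -W) hW.neg (x := x) (a := -a) (by simp [hx])
    (fun h => by rw [fderiv_neg]; simp [ha]) (neg_ne_zero.2 ha0) hs
  have hna : 0 < ‖-a‖ := norm_pos_iff.2 (neg_ne_zero.2 ha0)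
  set y₀ := x + t • (-a) with hy₀
  have hout : ∀ y ∈ closedBall y₀ (t * ‖-a‖), y ≠ x → y ∈ (closure (posSet u))ᶜ := by
    intro y hy hyx hyc
    have h1 := ht y hy hyx
    have h2 := hWcl y h1.1 hyc
    have h3 : 0 < -W y := h1.2
    linarith
  have hdist : dist x y₀ = t * ‖-a‖ := by
    rw [dist_comm, dist_eq_norm, hy₀, add_sub_cancel_left, norm_smul, Real.norm_of_nonneg ht0.le]
  have hpos : 0 < t * ‖-a‖ := mul_pos ht0 hna
  have hball : HasOuterTangentBall (posSet u) x := by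
    refine ⟨t * ‖-a‖, hpos, y₀, hout y₀ (mem_closedBall_self hpos.le) ?_, fun y hy => ?_, ?_⟩
    · intro h; rw [h, dist_self] at hdist; exact hpos.ne hdist
    · refine hout y (ball_subset_closedBall hy) ?_
      rintro rfl
      rw [mem_ball, hdist] at hy
      exact lt_irrefl _ hy
    · refine Subset.antisymm (fun y hy => ?_) ?_
      · by_contra hyx
        exact hout y (sphere_subset_closedBall hy.1) hyx (frontier_subset_closure hy.2)
      · rintro y rfl
        exact ⟨hdist, hxf⟩
  obtain ⟨r, hr0, -, hr, α, β, hα, hβ, hαβ, ν, hν, hu, hv⟩ :=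
    hsol.boundary x ⟨hxf, hxB⟩ (Or.inr hball)
  -- Half the unit vector, because the blow-up limits are given only in the open unit ball.
  set e : Space d := (2⁻¹ : ℝ) • ν with he
  have heB : e ∈ unitBall d := by
    rw [unitBall, mem_ball_zero_iff, he, norm_smul, hν]; norm_num
  have hinner : inner ℝ e ν = (2⁻¹ : ℝ) := by
    rw [he, real_inner_smul_left, real_inner_self_eq_norm_sq, hν]; norm_num
  have hlim1 := ((hu.tendsto_at heB).add (hv.tendsto_at heB)).div_const 2
  have hlim2 := (tendsto_blowUp_quotient hW hx ha hr0 hr e).max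
    (tendsto_const_nhds (x := (0 : ℝ)))
  have hcmp := le_of_tendsto_of_tendsto hlim1 hlim2 (by
    filter_upwards [eventually_blowUp_mem_ball hs hr e] with k hk
    have h1 := hmax _ hk
    have h2 : max (W (x + r k • e) / r k) 0 = max (W (x + r k • e)) 0 / r k := by
      rw [← max_div_div_right (hr0 k).le, zero_div]
    rw [h2, ← add_div, div_right_comm]
    exact div_le_div_of_nonneg_right h1 (hr0 k).le)
  rw [hinner] at hcmp
  have h3 : inner ℝ a e ≤ ‖a‖ * 2⁻¹ := by
    refine (real_inner_le_norm a e).trans ?_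
    rw [he, norm_smul, hν]; norm_num
  have h4 : max (inner ℝ a e) 0 ≤ ‖a‖ * 2⁻¹ := max_le h3 (by positivity)
  have h5 : max (2⁻¹ : ℝ) 0 = 2⁻¹ := by norm_num
  rw [h5] at hcmp
  have h6 : (α + β) / 2 ≤ ‖a‖ := by linarith
  rw [← hαβ]
  have h7 : ((α + β) / 2) ^ 2 ≤ ‖a‖ ^ 2 := pow_le_pow_left₀ (by positivity) h6 2
  nlinarith [sq_nonneg (α - β)]

/-- Near `x` the set `{W > 0}` lies in the positivity set, so it provides an inner tangent ball. The
product of the blow-ups has slope `α β` in the square of `(x · ν)_+`, which is at most `‖x‖`. -/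
lemma le_boundary_of_touching_below {f g Q u v W : Space d → ℝ} (hsol : IsSolution f g Q u v)
    {x a : Space d} {s : ℝ} (hs : 0 < s) (hsB : ball x s ⊆ unitBall d)
    (hxf : x ∈ frontier (posSet u)) (hW : ContDiff ℝ 2 W) (hx : W x = 0)
    (ha : ∀ h, fderiv ℝ W x h = inner ℝ a h) (ha0 : a ≠ 0)
    (hle : ∀ y ∈ ball x s, 0 < W y → y ∈ posSet u ∧ W y ^ 2 ≤ u y * v y) :
    ‖a‖ ^ 2 ≤ Q x := by
  have hxB : x ∈ unitBall d := hsB (mem_ball_self hs)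
  obtain ⟨t, ht0, ht⟩ := exists_tangent_ball hW hx ha ha0 hs
  have hna : 0 < ‖a‖ := norm_pos_iff.2 ha0
  set y₀ := x + t • a with hy₀
  have hin : ∀ y ∈ closedBall y₀ (t * ‖a‖), y ≠ x → y ∈ posSet u := fun y hy hyx =>
    (hle y (ht y hy hyx).1 (ht y hy hyx).2).1
  have hdist : dist x y₀ = t * ‖a‖ := by
    rw [dist_comm, dist_eq_norm, hy₀, add_sub_cancel_left, norm_smul, Real.norm_of_nonneg ht0.le]
  have hpos : 0 < t * ‖a‖ := mul_pos ht0 hna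
  have hball : HasInnerTangentBall (posSet u) x := by
    refine ⟨t * ‖a‖, hpos, y₀, hin y₀ (mem_closedBall_self hpos.le) ?_, fun y hy => ?_, ?_⟩
    · intro h; rw [h, dist_self] at hdist; exact hpos.ne hdist
    · refine hin y (ball_subset_closedBall hy) ?_
      rintro rfl
      rw [mem_ball, hdist] at hy
      exact lt_irrefl _ hy
    · refine Subset.antisymm (fun y hy => ?_) ?_
      · by_contra hyx
        exact notMem_posSet_of_mem_frontier hsol.continuousOn_left hy.2
          (hin y (sphere_subset_closedBall hy.1) hyx)
      · rintro y rfl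
        exact ⟨hdist, hxf⟩
  obtain ⟨r, hr0, -, hr, α, β, hα, hβ, hαβ, ν, hν, hu, hv⟩ :=
    hsol.boundary x ⟨hxf, hxB⟩ (Or.inl hball)
  -- The comparison is made along the gradient: `(‖a‖ / 2) ^ 2 ≤ α β (e · ν)_+ ^ 2 ≤ α β / 4`,
  -- whatever `ν` is.
  set e : Space d := (2⁻¹ * ‖a‖⁻¹ : ℝ) • a with he
  have hen : ‖e‖ = 2⁻¹ := by
    rw [he, norm_smul, Real.norm_of_nonneg (by positivity)]; field_simp
  have heB : e ∈ unitBall d := by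
    rw [unitBall, mem_ball_zero_iff, hen]; norm_num
  have hinner : inner ℝ a e = ‖a‖ * 2⁻¹ := by
    rw [he, real_inner_smul_right, real_inner_self_eq_norm_sq]; field_simp
  have hlim1 := (hu.tendsto_at heB).mul (hv.tendsto_at heB)
  have hlim2 := tendsto_blowUp_quotient hW hx ha hr0 hr e
  rw [hinner] at hlim2
  have hposW : ∀ᶠ k in atTop, 0 < W (x + r k • e) / r k :=
    hlim2.eventually (lt_mem_nhds (by positivity))
  have hcmp := le_of_tendsto_of_tendsto (hlim2.pow 2) hlim1 (by
    filter_upwards [eventually_blowUp_mem_ball hs hr e, hposW] with k hk hk2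
    have h1 := (hle _ hk ((div_pos_iff_of_pos_right (hr0 k)).1 hk2)).2
    rw [div_pow, div_mul_div_comm, ← sq]
    exact div_le_div_of_nonneg_right h1 (by positivity))
  have h3 : max (inner ℝ e ν) 0 ≤ 2⁻¹ := max_le (by
    refine (real_inner_le_norm e ν).trans ?_
    rw [hν, hen, mul_one]) (by norm_num)
  have h4 : (max (inner ℝ e ν) 0) ^ 2 ≤ (2⁻¹ : ℝ) ^ 2 :=
    pow_le_pow_left₀ (le_max_right _ _) h3 2
  rw [← hαβ]
  have h5 : 0 < α * β := mul_pos hα hβ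
  nlinarith

end BoundaryTouching

variable {d : ℕ}

/-! ### The height function and the tilted test functions -/

section Height

lemma contDiff_height {n : WithTop ℕ∞} : ContDiff ℝ n (height : Space d → ℝ) :=
  (EuclideanSpace.proj (Fin.last d) : Space d →L[ℝ] ℝ).contDiff

lemma continuous_height : Continuous (height : Space d → ℝ) :=
  (contDiff_height (n := 0)).continuous

@[simp] lemma height_add (x y : Space d) : height (x + y) = height x + height y := rfl

@[simp] lemma height_sub (x y : Space d) : height (x - y) = height x - height y := rfl

@[simp] lemma height_smul (t : ℝ) (x : Space d) : height (t • x) = t * height x := rfl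

@[simp] lemma height_eLast : height (eLast d) = 1 := by simp [height, eLast]

@[simp] lemma height_zero : height (0 : Space d) = 0 := rfl

@[simp] lemma norm_eLast : ‖eLast d‖ = 1 := by simp [eLast]

lemma inner_eLast (x : Space d) : inner ℝ (eLast d) x = height x := by
  simp [eLast, height, EuclideanSpace.inner_single_left]

lemma hasFDerivAt_height (x : Space d) :
    HasFDerivAt height (EuclideanSpace.proj (Fin.last d) : Space d →L[ℝ] ℝ) x :=
  (EuclideanSpace.proj (Fin.last d) : Space d →L[ℝ] ℝ).hasFDerivAt

lemma abs_height_le (x : Space d) : |height x| ≤ ‖x‖ := by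
  rw [← inner_eLast]
  simpa using abs_real_inner_le_norm (eLast d) x

end Height

section ApproximateTest

/-- The test function `x_d + ε (φ + k)`. -/
noncomputable def tiltedTest (ε k : ℝ) (φ : Space d → ℝ) (x : Space d) : ℝ :=
  height x + ε * (φ x + k)

variable {ε k : ℝ} {φ : Space d → ℝ}

lemma contDiff_tiltedTest (hφ : ContDiff ℝ 2 φ) : ContDiff ℝ 2 (tiltedTest ε k φ) :=
  contDiff_height.add (contDiff_const.mul (hφ.add contDiff_const))

lemma fderiv_tiltedTest (hφ : ContDiff ℝ 2 φ) (x h : Space d) :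
    fderiv ℝ (tiltedTest ε k φ) x h = height h + ε * fderiv ℝ φ x h := by
  have h1 : HasFDerivAt (tiltedTest ε k φ) _ x := (hasFDerivAt_height x).add
    (((hφ.differentiable (by norm_num) x).hasFDerivAt.add_const k).const_mul ε)
  rw [h1.fderiv]
  rfl

lemma fderiv_tiltedTest_eq_inner (hφ : ContDiff ℝ 2 φ) (x h : Space d) :
    fderiv ℝ (tiltedTest ε k φ) x h = inner ℝ (eLast d + ε • ∇ φ x) h := by
  rw [fderiv_tiltedTest hφ, inner_add_left, inner_eLast, real_inner_smul_left,
    ← toDual_gradient, InnerProductSpace.toDual_apply_apply]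

lemma laplacian_tiltedTest (hφ : ContDiff ℝ 2 φ) (x : Space d) :
    Laplacian.laplacian (tiltedTest ε k φ) x = ε * Laplacian.laplacian φ x := by
  rw [laplacian_eq_sum_fderiv (stdOrthonormalBasis ℝ (Space d)) (contDiff_tiltedTest hφ),
    laplacian_eq_sum_fderiv (stdOrthonormalBasis ℝ (Space d)) hφ, Finset.mul_sum]
  refine Finset.sum_congr rfl fun i _ => ?_
  simp_rw [fderiv_tiltedTest hφ]
  have h1 := ((contDiff_fderiv_apply (m := 1) hφ (by norm_num)
    (stdOrthonormalBasis ℝ (Space d) i)).differentiable (by norm_num) x)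
  rw [fderiv_const_add, fderiv_const_mul h1]
  rfl

end ApproximateTest

/-! ### Flatness confines the free boundary to a thin strip -/

section Geometry

/-- Applied to vertical segments, whose upper end is in the positivity set by flatness. -/
lemma subset_of_disjoint_frontier {X : Type*} [TopologicalSpace X] {S Ω : Set X}
    (hS : IsPreconnected S) (hΩ : IsOpen Ω) (hdisj : ∀ x ∈ S, x ∉ frontier Ω)
    (hne : (S ∩ Ω).Nonempty) : S ⊆ Ω := by
  refine hS.subset_left_of_subset_union hΩ isClosed_closure.isOpen_compl
    (disjoint_compl_right.mono_left subset_closure |>.mono_right le_rfl) (fun x hx => ?_) hne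
  by_cases h : x ∈ Ω
  · exact Or.inl h
  · refine Or.inr fun hc => hdisj x hx ?_
    rw [hΩ.frontier_eq]
    exact ⟨hc, h⟩

lemma isPreconnected_vertical_segment (y : Space d) (t : ℝ) :
    IsPreconnected ((fun s : ℝ => y + s • eLast d) '' Icc 0 t) :=
  isPreconnected_Icc.image _ (by fun_prop)

variable {u : Space d → ℝ} {ε : ℝ}

lemma IsFlat.mem_posSet (hu : IsFlat ε u) {x : Space d} (hx : x ∈ unitBall d)
    (h : ε < height x) : x ∈ posSet u :=
  ⟨hx, (lt_max_of_lt_left (sub_pos.2 h)).trans_le (hu x hx).1⟩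

lemma IsFlat.neg_lt_height (hu : IsFlat ε u) {x : Space d} (hx : x ∈ posSet u) :
    -ε < height x := by
  by_contra! h
  have h1 := (hu x hx.1).2
  rw [max_eq_right (by linarith)] at h1
  exact absurd hx.2 (not_lt.2 h1)

lemma IsFlat.neg_le_height (hu : IsFlat ε u) {x : Space d} (hx : x ∈ closure (posSet u)) :
    -ε ≤ height x :=
  closure_minimal (t := {x | -ε ≤ height x}) (fun _ hy => (hu.neg_lt_height hy).le)
    (isClosed_le continuous_const continuous_height) hx

lemma IsFlat.height_le_of_notMem (hu : IsFlat ε u) {x : Space d} (hx : x ∈ unitBall d)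
    (h : x ∉ posSet u) : height x ≤ ε :=
  not_lt.1 fun h' => h (hu.mem_posSet hx h')

lemma IsFlat.abs_height_le (hu : IsFlat ε u) (hcont : ContinuousOn u (unitBall d)) {x : Space d}
    (hx : x ∈ unitBall d) (h : x ∈ frontier (posSet u)) : |height x| ≤ ε :=
  abs_le.2 ⟨hu.neg_le_height (frontier_subset_closure h),
    hu.height_le_of_notMem hx (notMem_posSet_of_mem_frontier hcont h)⟩

end Geometry

/-! ### The equations for linear combinations of `u` and `v` -/

section Equation

lemma integrable_mul_test {f ψ : Space d → ℝ} (hf : IsNonnegBounded f) (hψ : Continuous ψ)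
    (hc : HasCompactSupport ψ) (hs : tsupport ψ ⊆ unitBall d) :
    Integrable (fun x => f x * ψ x) := by
  obtain ⟨C, hC⟩ := hψ.bounded_above_of_compact_support hc
  have hfin : IsFiniteMeasure ((volume : Measure (Space d)).restrict (unitBall d)) :=
    ⟨by simpa [unitBall] using measure_ball_lt_top⟩
  have h1 : Integrable f (volume.restrict (unitBall d)) := hf.1.integrable le_top
  have h2 : IntegrableOn (fun x => f x * ψ x) (unitBall d) :=
    h1.mul_bdd hψ.aestronglyMeasurable (Eventually.of_forall hC)
  refine (integrableOn_iff_integrable_of_support_subset fun y hy => ?_).1 h2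
  by_contra h
  exact hy (by simp [image_eq_zero_of_notMem_tsupport fun h' => h (hs h')])

lemma IsSolution.integral_combination {f g Q u v : Space d → ℝ} (hsol : IsSolution f g Q u v)
    (hf : IsNonnegBounded f) (hg : IsNonnegBounded g) (a b : ℝ) {x : Space d} {R : ℝ}
    (hR : closedBall x R ⊆ posSet u) (ψ : Space d → ℝ) (hψ : ContDiff ℝ ∞ ψ)
    (hc : HasCompactSupport ψ) (hs : tsupport ψ ⊆ closedBall x R) :
    ∫ y, (a * u y + b * v y) * Laplacian.laplacian ψ y = -∫ y, (a * f y + b * g y) * ψ y := by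
  have hB : closedBall x R ⊆ unitBall d := fun y hy => (hR hy).1
  have hk := continuous_laplacian (hψ.of_le two_le_infty)
  have hks := tsupport_laplacian_subset.trans hs
  have hK := isCompact_closedBall x R
  have iu := integrable_mul_of_continuousOn hK (hsol.continuousOn_left.mono hB) hk hks
  have iv := integrable_mul_of_continuousOn hK (hsol.continuousOn_right.mono hB) hk hks
  have jf := integrable_mul_test hf hψ.continuous hc (hs.trans hB)
  have jg := integrable_mul_test hg hψ.continuous hc (hs.trans hB)
  simp_rw [add_mul, mul_assoc]
  rw [integral_add (iu.const_mul a) (iv.const_mul b), integral_add (jf.const_mul a) (jg.const_mul b)]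
  simp_rw [integral_const_mul]
  rw [hsol.equation_left ψ hψ hc (hs.trans hR), hsol.equation_right ψ hψ hc (hs.trans hR)]
  ring

lemma ae_add_le_of_supNorm_le {f g : Space d → ℝ} {c : ℝ} (hc : 0 ≤ c)
    (h : supNorm f + supNorm g ≤ ENNReal.ofReal c) :
    ∀ᵐ y, y ∈ unitBall d → f y + g y ≤ c := by
  rw [← ae_restrict_iff' (by exact measurableSet_ball)]
  unfold supNorm at h
  rw [eLpNorm_exponent_top, eLpNorm_exponent_top] at h
  filter_upwards [ae_le_eLpNormEssSup (f := f), ae_le_eLpNormEssSup (f := g)] with y h1 h2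
  have h3 := (add_le_add h1 h2).trans h
  rw [Real.enorm_eq_ofReal_abs, Real.enorm_eq_ofReal_abs,
    ← ENNReal.ofReal_add (abs_nonneg _) (abs_nonneg _), ENNReal.ofReal_le_ofReal_iff hc] at h3
  linarith [le_abs_self (f y), le_abs_self (g y)]

end Equation

/-! ### Comparison of the two linearized means with test functions -/

section Comparison

variable {f g Q u v φ : Space d → ℝ} {ε r : ℝ}

/-- The linearization of the arithmetic mean of `u` and `v`. -/
noncomputable def arithLin (ε : ℝ) (u v : Space d → ℝ) (x : Space d) : ℝ :=
  ((u x + v x) / 2 - height x) / ε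

/-- The linearization of the geometric mean of `u` and `v`. -/
noncomputable def geomLin (ε : ℝ) (u v : Space d → ℝ) (x : Space d) : ℝ :=
  (√(u x * v x) - height x) / ε

lemma closedBall_subset_unitBall (hr : r < 1) : closedBall (0 : Space d) r ⊆ unitBall d :=
  closedBall_subset_ball hr

/-- `arithLin - φ` attains its maximum over the closure of the positivity set in a ball on the
boundary of that ball, if `φ` is a strict supersolution. -/
lemma not_arithLin_max_interior (hsol : IsSolution f g Q u v) (hε : 0 < ε) (hu : IsFlat ε u)
    (hf : IsNonnegBounded f) (hg : IsNonnegBounded g) {c : ℝ} (hc : 0 ≤ c)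
    (hfg : ∀ᵐ y, y ∈ unitBall d → f y + g y ≤ c) (hr : r < 1) (hφ : ContDiff ℝ 2 φ)
    (hlap : ∀ x ∈ closedBall 0 r, ε * Laplacian.laplacian φ x < -c)
    (hgrad : ∀ x ∈ closedBall 0 r, |height x| ≤ ε →
      eLast d + ε • ∇ φ x ≠ 0 ∧ ‖eLast d + ε • ∇ φ x‖ ^ 2 < Q x)
    {p : Space d} (hp : p ∈ closure (posSet u) ∩ closedBall 0 r)
    (hmax : ∀ y ∈ closure (posSet u) ∩ sphere 0 r,
      arithLin ε u v y - φ y < arithLin ε u v p - φ p) : False := by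
  have hK : IsCompact (closure (posSet u) ∩ closedBall (0 : Space d) r) :=
    (isCompact_closedBall 0 r).inter_left isClosed_closure
  have hcl : closedBall (0 : Space d) r ⊆ unitBall d := closedBall_subset_unitBall hr
  have hcont : ContinuousOn (fun y => arithLin ε u v y - φ y)
      (closure (posSet u) ∩ closedBall 0 r) := by
    have h1 := hsol.continuousOn_left.mono (inter_subset_right (s := closure (posSet u)) |>.trans hcl)
    have h2 := hsol.continuousOn_right.mono (inter_subset_right (s := closure (posSet u)) |>.trans hcl)
    exact ((((h1.add h2).div_const 2).sub continuous_height.continuousOn).div_const ε).sub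
      hφ.continuous.continuousOn
  obtain ⟨x, hx, hxmax⟩ := hK.exists_isMaxOn ⟨p, hp⟩ hcont
  have hxs : x ∉ sphere (0 : Space d) r := fun h =>
    absurd (hmax x ⟨hx.1, h⟩) (not_lt.2 (hxmax hp))
  have hxb : x ∈ ball (0 : Space d) r :=
    mem_ball.2 (lt_of_le_of_ne (mem_closedBall.1 hx.2) fun h => hxs (mem_sphere.2 h))
  -- With `k` the maximal value, the tilted test function lies above `(u + v) / 2` on the closure of
  -- the positivity set and touches it at `x`.
  set k := arithLin ε u v x - φ x with hk
  set W := tiltedTest ε k φ with hW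
  have hW2 : ContDiff ℝ 2 W := contDiff_tiltedTest hφ
  have hval : ∀ y, (u y + v y) / 2 = height y + ε * arithLin ε u v y := fun y => by
    simp only [arithLin]; field_simp; ring
  have hle : ∀ y ∈ closure (posSet u) ∩ closedBall 0 r, (u y + v y) / 2 ≤ W y := by
    intro y hy
    have h1 : arithLin ε u v y - φ y ≤ k := hxmax hy
    rw [hval, hW, tiltedTest]
    nlinarith
  have heq : (u x + v x) / 2 = W x := by rw [hval, hW, tiltedTest, hk]; ring
  obtain ⟨s, hs, hsr⟩ := Metric.isOpen_iff.1 isOpen_ball x hxb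
  by_cases hxΩ : x ∈ posSet u
  · have hnhds : posSet u ∩ ball 0 r ∈ 𝓝 x :=
      inter_mem ((isOpen_posSet hsol.continuousOn_left).mem_nhds hxΩ) (isOpen_ball.mem_nhds hxb)
    obtain ⟨R, hR, hRs⟩ := nhds_basis_closedBall.mem_iff.1 hnhds
    have hRΩ : closedBall x R ⊆ posSet u := fun y hy => (hRs hy).1
    have hRB : closedBall x R ⊆ unitBall d := fun y hy => (hRΩ hy).1
    have h := le_laplacian_of_touching_above (w := fun y => 2⁻¹ * u y + 2⁻¹ * v y)
      (F := fun y => 2⁻¹ * f y + 2⁻¹ * g y) (c := c) hR hc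
      (((hsol.continuousOn_left.mono hRB).const_mul _).add
        ((hsol.continuousOn_right.mono hRB).const_mul _)) hW2
      (fun ψ h1 h2 h3 => hsol.integral_combination hf hg 2⁻¹ 2⁻¹ hRΩ ψ h1 h2 h3)
      (by filter_upwards [hfg] with y hy h'; linarith [hy (hRB h')])
      (fun y hy => by
        have := hle y ⟨subset_closure (hRΩ hy), ball_subset_closedBall (hRs hy).2⟩
        linarith)
      (by linarith)
    rw [hW, laplacian_tiltedTest hφ] at h
    linarith [hlap x hx.2]
  · have hxf : x ∈ frontier (posSet u) := by
      rw [(isOpen_posSet hsol.continuousOn_left).frontier_eq]; exact ⟨hx.1, hxΩ⟩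
    have hxB := hcl hx.2
    have hg' := hgrad x hx.2 (hu.abs_height_le hsol.continuousOn_left hxB hxf)
    have hux := eq_zero_of_notMem_posSet hsol.nonneg_left hxB hxΩ
    have hvx := eq_zero_of_notMem_posSet hsol.nonneg_right hxB (hsol.posSet_eq ▸ hxΩ)
    have h := boundary_le_of_touching_above hsol hs
      (hsr.trans (ball_subset_closedBall.trans hcl)) hxf hW2 (by rw [← heq, hux, hvx]; norm_num)
      (fun h => fderiv_tiltedTest_eq_inner hφ x h) hg'.1
      (fun y hy hyΩ => hle y ⟨subset_closure hyΩ, ball_subset_closedBall (hsr hy)⟩)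
    exact absurd hg'.2 (not_lt.2 h)

/-- `geomLin - φ` attains its minimum over the closure of the positivity set in a ball near the
boundary of that ball, if `φ` is a strict subsolution. -/
lemma not_geomLin_min_interior (hsol : IsSolution f g Q u v) (hε : 0 < ε) (hu : IsFlat ε u)
    (hf : IsNonnegBounded f) (hg : IsNonnegBounded g) (hr : r < 1) (hφ : ContDiff ℝ 2 φ)
    (hlap : ∀ x ∈ closedBall 0 r, 0 < Laplacian.laplacian φ x)
    (hmono : ∀ x ∈ closedBall 0 r, 0 < 1 + ε * fderiv ℝ φ x (eLast d))
    (hgrad : ∀ x ∈ closedBall 0 r, |height x| ≤ ε → Q x < ‖eLast d + ε • ∇ φ x‖ ^ 2)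
    {p : Space d} (hp : p ∈ closure (posSet u) ∩ closedBall 0 r)
    (hmin : ∀ y ∈ closure (posSet u) ∩ closedBall 0 r, r - 5 * ε ≤ ‖y‖ →
      geomLin ε u v p - φ p < geomLin ε u v y - φ y) : False := by
  have hK : IsCompact (closure (posSet u) ∩ closedBall (0 : Space d) r) :=
    (isCompact_closedBall 0 r).inter_left isClosed_closure
  have hcl : closedBall (0 : Space d) r ⊆ unitBall d := closedBall_subset_unitBall hr
  have hcont : ContinuousOn (fun y => geomLin ε u v y - φ y)
      (closure (posSet u) ∩ closedBall 0 r) := by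
    have h1 := hsol.continuousOn_left.mono (inter_subset_right (s := closure (posSet u)) |>.trans hcl)
    have h2 := hsol.continuousOn_right.mono (inter_subset_right (s := closure (posSet u)) |>.trans hcl)
    exact (((h1.mul h2).sqrt.sub continuous_height.continuousOn).div_const ε).sub
      hφ.continuous.continuousOn
  obtain ⟨x, hx, hxmin⟩ := hK.exists_isMinOn ⟨p, hp⟩ hcont
  -- Room for points within `ε` of `x` to be raised by up to `4 * ε` without leaving the ball.
  have hxn : ‖x‖ < r - 5 * ε := by
    by_contra! h
    exact absurd (hmin x hx h) (not_lt.2 (hxmin hp))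
  have hxb : x ∈ ball (0 : Space d) r := by rw [mem_ball_zero_iff]; linarith
  set k := geomLin ε u v x - φ x with hk
  set W := tiltedTest ε k φ with hW
  have hW2 : ContDiff ℝ 2 W := contDiff_tiltedTest hφ
  have hval : ∀ y, √(u y * v y) = height y + ε * geomLin ε u v y := fun y => by
    simp only [geomLin]; field_simp; ring
  have hle : ∀ y ∈ closure (posSet u) ∩ closedBall 0 r, W y ≤ √(u y * v y) := by
    intro y hy
    have h1 : k ≤ geomLin ε u v y - φ y := hxmin hy
    rw [hval, hW, tiltedTest]
    nlinarith
  have heq : √(u x * v x) = W x := by rw [hval, hW, tiltedTest, hk]; ring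
  by_cases hxΩ : x ∈ posSet u
  · have hnhds : posSet u ∩ ball 0 r ∈ 𝓝 x :=
      inter_mem ((isOpen_posSet hsol.continuousOn_left).mem_nhds hxΩ) (isOpen_ball.mem_nhds hxb)
    obtain ⟨R, hR, hRs⟩ := nhds_basis_closedBall.mem_iff.1 hnhds
    have hRΩ : closedBall x R ⊆ posSet u := fun y hy => (hRs hy).1
    have hRB : closedBall x R ⊆ unitBall d := fun y hy => (hRΩ hy).1
    have hux : 0 < u x := hxΩ.2
    have hvx : 0 < v x := (hsol.posSet_eq ▸ hxΩ : x ∈ posSet v).2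
    set a := √(u x) with ha
    set b := √(v x) with hb
    have ha0 : 0 < a := Real.sqrt_pos.2 hux
    have hb0 : 0 < b := Real.sqrt_pos.2 hvx
    have hua : u x = a ^ 2 := (Real.sq_sqrt hux.le).symm
    have hvb : v x = b ^ 2 := (Real.sq_sqrt hvx.le).symm
    -- The square root is replaced by a linear majorant: `√(u v) ≤ (b / 2a) u + (a / 2b) v` by
    -- AM-GM, with equality at `x` for `a = √(u x)` and `b = √(v x)`. The right side is
    -- superharmonic since `f, g ≥ 0`.
    have h := laplacian_le_of_touching_below
      (w := fun y => (b / (2 * a)) * u y + (a / (2 * b)) * v y)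
      (F := fun y => (b / (2 * a)) * f y + (a / (2 * b)) * g y) hR
      (((hsol.continuousOn_left.mono hRB).const_mul _).add
        ((hsol.continuousOn_right.mono hRB).const_mul _)) hW2
      (fun ψ h1 h2 h3 => hsol.integral_combination hf hg _ _ hRΩ ψ h1 h2 h3)
      (by
        have h1 := hf.2
        have h2 := hg.2
        rw [ae_restrict_iff' (by exact measurableSet_ball)] at h1 h2
        filter_upwards [h1, h2] with y h1 h2 h'
        have := h1 (hRB h')
        have := h2 (hRB h')
        positivity)
      (fun y hy => by
        refine (hle y ⟨subset_closure (hRΩ hy), ball_subset_closedBall (hRs hy).2⟩).trans ?_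
        have h1 := hsol.nonneg_left y (hRB hy)
        have h2 := hsol.nonneg_right y (hRB hy)
        refine Real.sqrt_le_iff.2 ⟨by positivity, ?_⟩
        have h3 : u y * v y = 4 * ((b / (2 * a) * u y) * (a / (2 * b) * v y)) := by
          field_simp; norm_num
        rw [h3]
        nlinarith [sq_nonneg (b / (2 * a) * u y - a / (2 * b) * v y)])
      (by
        rw [← heq, hua, hvb, ← mul_pow, Real.sqrt_sq (by positivity)]
        field_simp; norm_num)
    rw [hW, laplacian_tiltedTest hφ] at h
    have := mul_pos hε (hlap x hx.2)
    linarith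
  · have hxf : x ∈ frontier (posSet u) := by
      rw [(isOpen_posSet hsol.continuousOn_left).frontier_eq]; exact ⟨hx.1, hxΩ⟩
    have hxB := hcl hx.2
    have hxh := hu.abs_height_le hsol.continuousOn_left hxB hxf
    have hg' := hgrad x hx.2 hxh
    have hzero : ∀ y ∈ unitBall d, y ∉ posSet u → √(u y * v y) = 0 := fun y hy hyΩ => by
      rw [eq_zero_of_notMem_posSet hsol.nonneg_left hy hyΩ]; simp
    -- Its component along `e_d` is `1 + ε ∂_d φ > 0`.
    have ha0 : eLast d + ε • ∇ φ x ≠ 0 := by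
      intro h0
      have h1 := hmono x hx.2
      have h2 := fderiv_tiltedTest_eq_inner (ε := ε) (k := k) hφ x (eLast d)
      rw [fderiv_tiltedTest hφ, h0, inner_zero_left, height_eLast] at h2
      linarith
    have hnorm : ∀ y ∈ ball x ε, ∀ t ∈ Icc (0 : ℝ) (4 * ε), ‖y + t • eLast d‖ < r := by
      intro y hy t ht
      have h1 : ‖y‖ ≤ ‖y - x‖ + ‖x‖ := by simpa using norm_add_le (y - x) x
      have h2 := norm_add_le y (t • eLast d)
      rw [norm_smul, norm_eLast, mul_one, Real.norm_of_nonneg ht.1] at h2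
      rw [mem_ball, dist_eq_norm] at hy
      linarith [ht.2]
    have hmem : ∀ y ∈ ball x ε, ∀ t ∈ Icc (0 : ℝ) (4 * ε), y + t • eLast d ∈ closedBall 0 r :=
      fun y hy t ht => mem_closedBall_zero_iff.2 (hnorm y hy t ht).le
    have hup : ∀ y ∈ ball x ε, ∀ t ∈ Icc (0 : ℝ) (4 * ε), W y ≤ W (y + t • eLast d) := by
      intro y hy t ht
      have hder : ∀ s : ℝ, HasDerivAt (fun s : ℝ => W (y + s • eLast d))
          (1 + ε * fderiv ℝ φ (y + s • eLast d) (eLast d)) s := by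
        intro s
        have h1 : HasDerivAt (fun s : ℝ => y + s • eLast d) (eLast d) s := by
          simpa using ((hasDerivAt_id s).smul_const (eLast d)).const_add y
        have h2 := (hW2.differentiable (by norm_num) (y + s • eLast d)).hasFDerivAt.comp_hasDerivAt
          s h1
        rwa [hW, fderiv_tiltedTest hφ, height_eLast] at h2
      have hm : MonotoneOn (fun s : ℝ => W (y + s • eLast d)) (Icc 0 (4 * ε)) := by
        refine monotoneOn_of_deriv_nonneg (convex_Icc _ _)
          (fun s _ => (hder s).continuousAt.continuousWithinAt)
          (fun s _ => (hder s).differentiableAt.differentiableWithinAt) fun s hs => ?_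
        rw [(hder s).deriv]
        exact (hmono _ (hmem y hy s (interior_subset hs))).le
      simpa using hm (left_mem_Icc.2 (by linarith)) ht ht.1
    -- The inequality `W ≤ √(u v)` is known only on the closure of the positivity set, so it does
    -- not by itself exclude `W > 0` outside. But `W` increases upwards, so it stays positive on the
    -- vertical segment above `y`. That segment then has no free boundary point, where `W ≤ 0`, and
    -- it ends above height `-2ε + 4ε > ε`, inside the positivity set.
    have hin : ∀ y ∈ ball x ε, 0 < W y → y ∈ posSet u := by
      intro y hy hWy
      have h4 : (4 * ε) ∈ Icc (0 : ℝ) (4 * ε) := right_mem_Icc.2 (by linarith)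
      have h0 : (0 : ℝ) ∈ Icc (0 : ℝ) (4 * ε) := left_mem_Icc.2 (by linarith)
      have hsub := subset_of_disjoint_frontier (isPreconnected_vertical_segment y (4 * ε))
        (isOpen_posSet hsol.continuousOn_left) (by
          rintro _ ⟨t, ht, rfl⟩ hfr
          have h1 := hle _ ⟨frontier_subset_closure hfr, hmem y hy t ht⟩
          rw [hzero _ (hcl (hmem y hy t ht))
            (notMem_posSet_of_mem_frontier hsol.continuousOn_left hfr)] at h1
          linarith [hup y hy t ht])
        (by
          refine ⟨y + (4 * ε) • eLast d, ⟨_, h4, rfl⟩, hu.mem_posSet (hcl (hmem y hy _ h4)) ?_⟩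
          have h1 := abs_height_le (y - x)
          rw [mem_ball, dist_eq_norm] at hy
          have h2 := (abs_le.1 hxh).1
          have h3 := (abs_le.1 h1).1
          simp only [height_add, height_sub, height_smul, height_eLast] at h3 ⊢
          linarith)
      exact hsub ⟨0, h0, by simp⟩
    have hball : ball x ε ⊆ closedBall 0 r := fun y hy => by
      simpa using hmem y hy 0 (left_mem_Icc.2 (by linarith))
    have h := le_boundary_of_touching_below hsol hε (hball.trans hcl) hxf hW2
      (by rw [← heq, hzero x hxB hxΩ])
      (fun h => fderiv_tiltedTest_eq_inner hφ x h) ha0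
      (fun y hy hWy => by
        have hyΩ := hin y hy hWy
        refine ⟨hyΩ, ?_⟩
        have h1 := hle y ⟨subset_closure hyΩ, hball hy⟩
        exact (Real.le_sqrt hWy.le (mul_nonneg (hsol.nonneg_left y hyΩ.1)
          (hsol.nonneg_right y hyΩ.1))).1 h1)
    exact absurd hg' (not_lt.2 h)

end Comparison

/-! ### Projections used to extend the limits slightly below the hyperplane -/

section Clamp

/-- The projection onto the closed upper half space. -/
noncomputable def clamp (x : Space d) : Space d := x + (max (height x) 0 - height x) • eLast d

/-- The projection onto the hyperplane `{x_d = 0}`. -/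
noncomputable def flatten (x : Space d) : Space d := x - height x • eLast d

@[simp] lemma height_clamp (x : Space d) : height (clamp x) = max (height x) 0 := by simp [clamp]

@[simp] lemma height_flatten (x : Space d) : height (flatten x) = 0 := by simp [flatten]

lemma clamp_eq_self {x : Space d} (hx : 0 ≤ height x) : clamp x = x := by simp [clamp, hx]

lemma norm_add_smul_eLast_sq (x : Space d) (t : ℝ) :
    ‖x + t • eLast d‖ ^ 2 = ‖x‖ ^ 2 + 2 * t * height x + t ^ 2 := by
  rw [norm_add_sq_real, norm_smul, norm_eLast, mul_one, real_inner_smul_right, real_inner_comm,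
    inner_eLast, Real.norm_eq_abs, sq_abs]
  ring

lemma norm_flatten_le (x : Space d) : ‖flatten x‖ ≤ ‖x‖ := by
  refine (pow_le_pow_iff_left₀ (norm_nonneg _) (norm_nonneg _) two_ne_zero).1 ?_
  rw [flatten, sub_eq_add_neg, ← neg_smul, norm_add_smul_eLast_sq]
  nlinarith [sq_nonneg (height x)]

lemma norm_clamp_le (x : Space d) : ‖clamp x‖ ≤ ‖x‖ := by
  rcases le_total 0 (height x) with h | h
  · rw [clamp_eq_self h]
  · have : clamp x = flatten x := by
      simp [clamp, flatten, max_eq_right h, sub_eq_add_neg]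
    rw [this]; exact norm_flatten_le x

lemma continuous_clamp : Continuous (clamp : Space d → Space d) := by
  have := continuous_height (d := d)
  unfold clamp
  fun_prop

lemma dist_flatten (x : Space d) : dist x (flatten x) = |height x| := by
  simp [flatten, norm_smul]

lemma dist_clamp_le {x q : Space d} (hq : 0 ≤ height q) : dist x (clamp x) ≤ dist x q := by
  have h1 := abs_height_le (x - q)
  rw [dist_eq_norm, dist_eq_norm, clamp, sub_add_cancel_left, norm_neg, norm_smul, norm_eLast,
    mul_one, Real.norm_eq_abs]
  refine le_trans ?_ h1
  rw [height_sub]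
  rcases le_total 0 (height x) with h | h
  · rw [max_eq_left h, sub_self, abs_zero]; positivity
  · rw [max_eq_right h, zero_sub, abs_neg, abs_of_nonpos h, abs_of_nonpos (by linarith)]
    linarith

lemma clamp_mem_closedHalfBall {x : Space d} (hx : x ∈ unitBall d) :
    clamp x ∈ closedHalfBall d := by
  refine ⟨?_, by simp⟩
  rw [unitBall, mem_ball_zero_iff] at *
  exact (norm_clamp_le x).trans_lt hx

lemma continuousOn_comp_clamp {U : Space d → ℝ} (hU : ContinuousOn U (closedHalfBall d)) :
    ContinuousOn (fun x => U (clamp x)) (unitBall d) :=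
  hU.comp continuous_clamp.continuousOn fun _ hx => clamp_mem_closedHalfBall hx

end Clamp

/-! ### Uniform margins near the hyperplane and near the upper hemisphere -/

section Compactness

/-- Carries conditions on the flat boundary over to a strip, which contains the free boundary once
`ε` is small. -/
lemma exists_abs_sub_flatten_lt {q : Space d → ℝ} {ρ : ℝ}
    (hq : ContinuousOn q (closedBall 0 ρ)) {η : ℝ} (hη : 0 < η) :
    ∃ κ : ℝ, 0 < κ ∧ ∀ x ∈ closedBall (0 : Space d) ρ, |height x| ≤ κ →
      |q x - q (flatten x)| < η := by
  have huc := (isCompact_closedBall (0 : Space d) ρ).uniformContinuousOn_of_continuous hq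
  obtain ⟨κ, hκ, h⟩ := Metric.uniformContinuousOn_iff.1 huc η hη
  refine ⟨κ / 2, by positivity, fun x hx hxh => ?_⟩
  refine h x hx (flatten x) ?_ (by rw [dist_flatten]; linarith)
  rw [mem_closedBall_zero_iff] at *
  exact (norm_flatten_le x).trans hx

/-- The collar must reach below the hyperplane because the positivity sets do, by at most `ε`. -/
lemma exists_gap_near_upper_sphere {G : Space d → ℝ} {r : ℝ} (hG : ContinuousOn G (closedBall 0 r))
    (hS : ∀ x ∈ sphere (0 : Space d) r, 0 ≤ height x → G x < 0) :
    ∃ γ : ℝ, 0 < γ ∧ ∃ s : ℝ, 0 < s ∧ ∀ y ∈ closedBall (0 : Space d) r, r - s ≤ ‖y‖ →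
      -s ≤ height y → G y < -γ := by
  have hSc : IsCompact (sphere (0 : Space d) r ∩ {x | 0 ≤ height x}) :=
    (isCompact_sphere 0 r).inter_right (isClosed_le continuous_const continuous_height)
  obtain ⟨γ, hγ, hγS⟩ := hSc.exists_forall_le' (f := fun x => -G x) (a := 0)
    ((hG.mono (inter_subset_left.trans sphere_subset_closedBall)).neg)
    (fun x hx => neg_pos.2 (hS x hx.1 hx.2))
  have hA : IsCompact (closedBall (0 : Space d) r ∩ G ⁻¹' Ici (-(γ / 2))) :=
    (isCompact_closedBall 0 r).of_isClosed_subset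
      (hG.preimage_isClosed_of_isClosed isClosed_closedBall isClosed_Ici) inter_subset_left
  -- Where this maximum is nonpositive, `y` is on the closed upper hemisphere and `G y ≤ -γ`. So it
  -- has a positive minimum on the compact set `{G ≥ -γ / 2}`.
  obtain ⟨s, hs, hsA⟩ := hA.exists_forall_le' (f := fun y => max (r - ‖y‖) (-height y)) (a := 0)
    (((continuous_const.sub continuous_norm).max continuous_height.neg).continuousOn)
    (fun y hy => by
      by_contra! h
      obtain ⟨h1, h2⟩ := max_le_iff.1 h
      have h3 : ‖y‖ ≤ r := mem_closedBall_zero_iff.1 hy.1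
      have h4 := hγS y ⟨mem_sphere_zero_iff_norm.2 (by linarith), by
        simp only [mem_ofPred_eq]; linarith⟩
      have h5 : -(γ / 2) ≤ G y := hy.2
      linarith)
  refine ⟨γ / 2, by positivity, s / 2, by positivity, fun y hy h1 h2 => ?_⟩
  by_contra! h
  have h3 := hsA y ⟨hy, h⟩
  have h4 : max (r - ‖y‖) (-height y) ≤ s / 2 := max_le (by linarith) (by linarith)
  linarith

end Compactness

/-! ### Convergence of the linearizations and comparison for the limit -/

section Limits

variable {ε δ : ℕ → ℝ} {f g Q u v : ℕ → Space d → ℝ} {U V : Space d → ℝ}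

/-- `w n` converges to `U` on the sets `A n`, locally uniformly in `B_1`. -/
def ConvergesOn (A : ℕ → Set (Space d)) (w : ℕ → Space d → ℝ) (U : Space d → ℝ) : Prop :=
  ∀ ρ : ℝ, ρ < 1 → ∀ η : ℝ, 0 < η → ∀ᶠ n in atTop, ∀ p ∈ A n ∩ ball 0 ρ, |w n p - U p| < η

/-- A nearby point `q` of the limit graph is within twice its distance of `clamp p`, since `clamp p`
is a nearest point of the half space. Uniform continuity of `U` does the rest. -/
lemma GraphsConverge.convergesOn {A : ℕ → Set (Space d)} {w : ℕ → Space d → ℝ}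
    (hU : ContinuousOn U (closedHalfBall d)) (h : GraphsConverge A w (closedHalfBall d) U) :
    ConvergesOn A w (fun x => U (clamp x)) := by
  intro ρ hρ η hη
  set ρ' := (1 + ρ) / 2 with hρ'
  have hK : IsCompact (closedBall (0 : Space d) ρ' ∩ {x | 0 ≤ height x}) :=
    (isCompact_closedBall 0 ρ').inter_right (isClosed_le continuous_const continuous_height)
  have hsub : closedBall (0 : Space d) ρ' ∩ {x | 0 ≤ height x} ⊆ closedHalfBall d :=
    fun x hx => ⟨closedBall_subset_unitBall (by linarith) hx.1, hx.2⟩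
  obtain ⟨κ, hκ, hκU⟩ := Metric.uniformContinuousOn_iff.1
    (hK.uniformContinuousOn_of_continuous (hU.mono hsub)) (η / 2) (by positivity)
  -- The three bounds control the error in value, the distance from `clamp p` to `q`, and the norm
  -- of `q`.
  set θ := min (η / 2) (min (κ / 2) ((1 - ρ) / 2)) with hθ
  have hθpos : 0 < θ := by
    refine lt_min (by positivity) (lt_min (by positivity) (by linarith))
  filter_upwards [h ρ hρ θ hθpos] with n hn p hp
  obtain ⟨_, ⟨q, hq, rfl⟩, hdist⟩ := mem_thickening_iff.1 (hn.1 ⟨p, hp, rfl⟩)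
  rw [Prod.dist_eq, max_lt_iff] at hdist
  obtain ⟨h1, h2⟩ := hdist
  simp only [Real.dist_eq] at h1 h2
  have hθ1 : θ ≤ η / 2 := min_le_left _ _
  have hθ2 : θ ≤ κ / 2 := (min_le_right _ _).trans (min_le_left _ _)
  have hθ3 : θ ≤ (1 - ρ) / 2 := (min_le_right _ _).trans (min_le_right _ _)
  have hpn : ‖p‖ < ρ := mem_ball_zero_iff.1 hp.2
  have hq0 : 0 ≤ height q := hq.1.2
  have hqn : ‖q‖ ≤ ρ' := by
    have h3 : ‖q‖ ≤ ‖q - p‖ + ‖p‖ := by simpa using norm_add_le (q - p) p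
    rw [dist_comm, dist_eq_norm] at h1
    linarith
  have hcq : dist (clamp p) q < κ := by
    have h3 := dist_triangle (clamp p) p q
    have h4 := dist_clamp_le (x := p) hq0
    rw [dist_comm] at h4
    linarith
  have h5 := hκU (clamp p) ⟨mem_closedBall_zero_iff.2 ((norm_clamp_le p).trans (by linarith)),
    by simp⟩ q ⟨mem_closedBall_zero_iff.2 hqn, hq0⟩ hcq
  rw [Real.dist_eq] at h5
  have h6 := abs_sub_le (w n p) (U q) (U (clamp p))
  rw [abs_sub_comm (U q)] at h6
  linarith

lemma arithLin_eq (ε : ℝ) (u v : Space d → ℝ) (x : Space d) :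
    arithLin ε u v x = (linearization ε u x + linearization ε v x) / 2 := by
  simp only [arithLin, linearization]; ring

lemma ConvergesOn.arithLin {A : ℕ → Set (Space d)}
    (hU : ConvergesOn A (fun n => linearization (ε n) (u n)) U)
    (hV : ConvergesOn A (fun n => linearization (ε n) (v n)) V) :
    ConvergesOn A (fun n => arithLin (ε n) (u n) (v n)) (fun x => (U x + V x) / 2) := by
  intro ρ hρ η hη
  filter_upwards [hU ρ hρ η hη, hV ρ hρ η hη] with n h1 h2 p hp
  have h1 := abs_lt.1 (h1 p hp)
  have h2 := abs_lt.1 (h2 p hp)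
  rw [arithLin_eq, abs_lt]
  constructor <;> linarith

lemma geomLin_le_arithLin {ε : ℝ} (hε : 0 < ε) {u v : Space d → ℝ} {x : Space d} (hu : 0 ≤ u x)
    (hv : 0 ≤ v x) : geomLin ε u v x ≤ arithLin ε u v x := by
  refine div_le_div_of_nonneg_right (sub_le_sub_right ?_ _) hε.le
  refine Real.sqrt_le_iff.2 ⟨by positivity, ?_⟩
  nlinarith [sq_nonneg (u x - v x)]

/-- The gap equals `(√a - √b) ^ 2 / 2`. The first bound serves near the hyperplane, where `u - v` is
`o(ε)`; the second away from it, where `u - v` is `O(ε)` and `u + v` is bounded below. -/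
lemma half_add_sub_sqrt_le {a b : ℝ} (ha : 0 ≤ a) (hb : 0 ≤ b) :
    (a + b) / 2 - √(a * b) ≤ |a - b| / 2 ∧
      ((a + b) / 2 - √(a * b)) * (a + b) ≤ (a - b) ^ 2 / 2 := by
  have h1 : a = √a ^ 2 := (Real.sq_sqrt ha).symm
  have h2 : b = √b ^ 2 := (Real.sq_sqrt hb).symm
  rw [Real.sqrt_mul ha]
  set s := √a
  set t := √b
  have hs : 0 ≤ s := Real.sqrt_nonneg _
  have ht : 0 ≤ t := Real.sqrt_nonneg _
  rw [h1, h2]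
  constructor
  · have h3 : |s ^ 2 - t ^ 2| = |s - t| * (s + t) := by
      rw [← abs_of_nonneg (add_nonneg hs ht), ← abs_mul]; congr 1; ring
    have h4 : |s - t| ≤ s + t := abs_sub_le_iff.2 ⟨by linarith, by linarith⟩
    have h5 : |s - t| ^ 2 = (s - t) ^ 2 := sq_abs _
    rw [h3]
    nlinarith [abs_nonneg (s - t)]
  · have : 0 ≤ (s - t) ^ 2 * (s * t) := by positivity
    nlinarith

/-- The geometric means of the linearizations have the same limit as the arithmetic ones, because
the linearizations agree in the limit on the flat boundary. -/
lemma ConvergesOn.geomLin (hε_pos : ∀ n, 0 < ε n) (hε : Tendsto ε atTop (𝓝 0))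
    (hsol : ∀ n, IsSolution (f n) (g n) (Q n) (u n) (v n))
    (hu : ∀ n, IsFlat (ε n) (u n)) (hv : ∀ n, IsFlat (ε n) (v n))
    (hUc : ContinuousOn U (unitBall d)) (hVc : ContinuousOn V (unitBall d))
    (hUV : ∀ x ∈ flatBoundary d, U x = V x)
    (hU : ConvergesOn (fun n => closure (posSet (u n))) (fun n => linearization (ε n) (u n)) U)
    (hV : ConvergesOn (fun n => closure (posSet (u n))) (fun n => linearization (ε n) (v n)) V) :
    ConvergesOn (fun n => closure (posSet (u n))) (fun n => geomLin (ε n) (u n) (v n))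
      (fun x => (U x + V x) / 2) := by
  intro ρ hρ η hη
  have hρB : closedBall (0 : Space d) ρ ⊆ unitBall d := closedBall_subset_unitBall hρ
  obtain ⟨κ, hκ, hκq⟩ := exists_abs_sub_flatten_lt (q := fun x => U x - V x) (ρ := ρ)
    ((hUc.sub hVc).mono hρB) (show 0 < η / 4 by positivity)
  have hsmall : ∀ᶠ n in atTop, ε n < min (κ / 2) (η * κ / 8) :=
    hε.eventually (gt_mem_nhds (lt_min (by positivity) (by positivity)))
  filter_upwards [hU ρ hρ (η / 8) (by positivity), hV ρ hρ (η / 8) (by positivity),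
    (hU.arithLin hV) ρ hρ (η / 2) (by positivity), hsmall] with n h1 h2 h3 h4 p hp
  have hpc : p ∈ closedBall (0 : Space d) ρ := ball_subset_closedBall hp.2
  have hpB := hρB hpc
  have hup := (hsol n).nonneg_left p hpB
  have hvp := (hsol n).nonneg_right p hpB
  have hεn := hε_pos n
  have hκn := h4.trans_le (min_le_left _ _)
  have hηn := h4.trans_le (min_le_right _ _)
  have hle := geomLin_le_arithLin hεn hup hvp
  have h1 := h1 p hp
  have h2 := h2 p hp
  have h3 := abs_lt.1 (h3 p hp)
  have hdiff : FreeBoundarySystem.arithLin (ε n) (u n) (v n) p -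
      FreeBoundarySystem.geomLin (ε n) (u n) (v n) p =
      ((u n p + v n p) / 2 - √(u n p * v n p)) / ε n := by
    simp only [FreeBoundarySystem.arithLin, FreeBoundarySystem.geomLin]; ring
  obtain ⟨ha, hb⟩ := half_add_sub_sqrt_le hup hvp
  have hkey : ((u n p + v n p) / 2 - √(u n p * v n p)) / ε n ≤ η / 2 := by
    rw [div_le_iff₀ hεn]
    -- Near the hyperplane `U` and `V` almost agree, so `|u - v| ≤ (η / 2) ε`. Above the strip
    -- flatness gives `|u - v| ≤ 2 ε` and `u + v ≥ κ`, so the gap is at most `2 ε ^ 2 / κ`.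
    by_cases hh : |height p| ≤ κ
    · have h5 := hκq p hpc hh
      have h6 : flatten p ∈ flatBoundary d := by
        refine ⟨hρB (mem_closedBall_zero_iff.2 ((norm_flatten_le p).trans
          (mem_closedBall_zero_iff.1 hpc))), by simp⟩
      rw [hUV _ h6, sub_self, sub_zero] at h5
      have h7 : |u n p - v n p| = |linearization (ε n) (u n) p - linearization (ε n) (v n) p| *
          ε n := by
        rw [← abs_of_pos hεn, ← abs_mul, abs_of_pos hεn]
        congr 1
        simp only [linearization]; field_simp; ring
      have h8 : |linearization (ε n) (u n) p - linearization (ε n) (v n) p| ≤ η / 2 := by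
        have e1 := abs_lt.1 h1
        have e2 := abs_lt.1 h2
        have e3 := abs_lt.1 h5
        rw [abs_le]
        constructor <;> linarith
      rw [h7] at ha
      have h9 := mul_le_mul_of_nonneg_right h8 hεn.le
      nlinarith
    · have h5 : κ < height p := by
        have := (hu n).neg_le_height hp.1
        rcases le_total 0 (height p) with h | h
        · rw [abs_of_nonneg h] at hh; exact not_le.1 hh
        · rw [abs_of_nonpos h] at hh; linarith [not_le.1 hh]
      have e1 := hu n p hpB
      have e2 := hv n p hpB
      rw [max_eq_left (by linarith : 0 ≤ height p - ε n),
        max_eq_left (by linarith : 0 ≤ height p + ε n)] at e1 e2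
      have h6 : (u n p - v n p) ^ 2 ≤ (2 * ε n) ^ 2 := sq_le_sq' (by linarith) (by linarith)
      have h7 : κ ≤ u n p + v n p := by linarith
      have h8 : 0 ≤ (u n p + v n p) / 2 - √(u n p * v n p) := by
        rw [sub_nonneg]
        refine Real.sqrt_le_iff.2 ⟨by positivity, ?_⟩
        nlinarith [sq_nonneg (u n p - v n p)]
      have h9 := mul_le_mul_of_nonneg_left h7 h8
      have h10 : ε n * ε n ≤ η * κ / 8 * ε n := mul_le_mul_of_nonneg_right hηn.le hεn.le
      have h11 : ((u n p + v n p) / 2 - √(u n p * v n p)) * κ ≤ (η / 2 * ε n) * κ := by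
        nlinarith
      exact le_of_mul_le_mul_right h11 hκ
  rw [← hdiff] at hkey
  rw [abs_lt]
  constructor <;> linarith

/-- The two limits agree on the flat boundary, because `u n = v n = 0` on the free boundary. -/
lemma eq_on_flatBoundary (hε_pos : ∀ n, 0 < ε n) (hε : Tendsto ε atTop (𝓝 0))
    (hsol : ∀ n, IsSolution (f n) (g n) (Q n) (u n) (v n))
    (hu : ∀ n, IsFlat (ε n) (u n))
    (hUc : ContinuousOn U (unitBall d)) (hVc : ContinuousOn V (unitBall d))
    (hU : ConvergesOn (fun n => closure (posSet (u n))) (fun n => linearization (ε n) (u n)) U)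
    (hV : ConvergesOn (fun n => closure (posSet (u n))) (fun n => linearization (ε n) (v n)) V) :
    ∀ x ∈ flatBoundary d, U x = V x := by
  intro x hx
  have hxn : ‖x‖ < 1 := by have := hx.1; rwa [unitBall, mem_ball_zero_iff] at this
  have hcont : ContinuousAt (fun y => U y - V y) x :=
    (hUc.sub hVc).continuousAt (isOpen_unitBall.mem_nhds hx.1)
  have hsmall : ∀ η > 0, |U x - V x| ≤ η := by
    intro η hη
    obtain ⟨κ, hκ, hκq⟩ := Metric.continuousAt_iff.1 hcont (η / 2) (by positivity)
    set ρ := (1 + ‖x‖) / 2 with hρ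
    have hev : ∀ᶠ n in atTop, ε n < min (κ / 4) ((ρ - ‖x‖) / 4) :=
      hε.eventually (gt_mem_nhds (lt_min (by positivity) (by linarith)))
    obtain ⟨n, h1, h2, h3⟩ := ((hU ρ (by linarith) (η / 4) (by positivity)).and
      ((hV ρ (by linarith) (η / 4) (by positivity)).and hev)).exists
    have hεn := hε_pos n
    have hκn := h3.trans_le (min_le_left _ _)
    have hρn := h3.trans_le (min_le_right _ _)
    -- The segment runs from height `-2ε`, outside the positivity set, to height `2ε`, inside it. It
    -- therefore contains a free boundary point, where both linearizations are `-height / ε`.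
    set y := x - (2 * ε n) • eLast d with hy
    have hdist : ∀ t ∈ Icc (0 : ℝ) (4 * ε n), dist (y + t • eLast d) x ≤ 2 * ε n := by
      intro t ht
      have : y + t • eLast d - x = (t - 2 * ε n) • eLast d := by rw [hy]; module
      rw [dist_eq_norm, this, norm_smul, norm_eLast, mul_one, Real.norm_eq_abs, abs_le]
      constructor <;> linarith [ht.1, ht.2]
    have hball : ∀ t ∈ Icc (0 : ℝ) (4 * ε n), y + t • eLast d ∈ ball (0 : Space d) ρ := by
      intro t ht
      have e1 := hdist t ht
      rw [dist_eq_norm] at e1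
      have e2 : ‖y + t • eLast d‖ ≤ ‖y + t • eLast d - x‖ + ‖x‖ := by
        simpa using norm_add_le (y + t • eLast d - x) x
      rw [mem_ball_zero_iff]
      linarith
    have hρB : ball (0 : Space d) ρ ⊆ unitBall d := ball_subset_ball (by linarith)
    have h0 : (0 : ℝ) ∈ Icc (0 : ℝ) (4 * ε n) := left_mem_Icc.2 (by linarith)
    have h4 : (4 * ε n) ∈ Icc (0 : ℝ) (4 * ε n) := right_mem_Icc.2 (by linarith)
    have hxh : height x = 0 := hx.2
    obtain ⟨t, ht, htf⟩ : ∃ t ∈ Icc (0 : ℝ) (4 * ε n),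
        y + t • eLast d ∈ frontier (posSet (u n)) := by
      by_contra! hno
      have hsub := subset_of_disjoint_frontier (isPreconnected_vertical_segment y (4 * ε n))
        (isOpen_posSet (hsol n).continuousOn_left) (by
          rintro _ ⟨t, ht, rfl⟩; exact hno t ht)
        ⟨y + (4 * ε n) • eLast d, ⟨_, h4, rfl⟩, (hu n).mem_posSet (hρB (hball _ h4)) (by
          rw [hy]; simp only [height_add, height_sub, height_smul, height_eLast, hxh]; linarith)⟩
      have h5 : y ∈ posSet (u n) := hsub ⟨0, h0, by simp⟩
      have h6 := (hu n).neg_lt_height h5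
      rw [hy] at h6
      simp only [height_sub, height_smul, height_eLast, hxh] at h6
      linarith
    set p := y + t • eLast d
    have hpΩ := notMem_posSet_of_mem_frontier (hsol n).continuousOn_left htf
    have hpb : p ∈ ball (0 : Space d) ρ := hball t ht
    have hup := eq_zero_of_notMem_posSet (hsol n).nonneg_left (hρB hpb) hpΩ
    have hvp := eq_zero_of_notMem_posSet (hsol n).nonneg_right (hρB hpb)
      ((hsol n).posSet_eq ▸ hpΩ)
    have h5 := abs_lt.1 (h1 p ⟨frontier_subset_closure htf, hpb⟩)
    have h6 := abs_lt.1 (h2 p ⟨frontier_subset_closure htf, hpb⟩)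
    have h7 := hκq (x := p) ((hdist t ht).trans_lt (by linarith))
    rw [Real.dist_eq] at h7
    have h7 := abs_lt.1 h7
    simp only [linearization, hup, hvp] at h5 h6
    rw [abs_le]
    constructor <;> linarith [h5.1, h5.2, h6.1, h6.2, h7.1, h7.2]
  have h0 : |U x - V x| ≤ 0 := le_of_forall_pos_le_add fun η hη => by
    rw [zero_add]; exact hsmall η hη
  exact sub_eq_zero.1 (abs_nonpos_iff.1 h0)

lemma norm_eLast_add_smul_sq {φ : Space d → ℝ} (ε : ℝ) (x : Space d) :
    ‖eLast d + ε • ∇ φ x‖ ^ 2 = 1 + 2 * ε * fderiv ℝ φ x (eLast d) + ε ^ 2 * ‖∇ φ x‖ ^ 2 := by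
  rw [norm_add_sq_real, norm_eLast, real_inner_smul_right, norm_smul, ← toDual_gradient,
    InnerProductSpace.toDual_apply_apply, real_inner_comm, mul_pow, Real.norm_eq_abs, sq_abs]
  ring

lemma norm_gradient {φ : Space d → ℝ} (x : Space d) : ‖∇ φ x‖ = ‖fderiv ℝ φ x‖ := by
  rw [← toDual_gradient, LinearIsometryEquiv.norm_map]

lemma exists_norm_gradient_bound {φ : Space d → ℝ} (hφ : ContDiff ℝ 2 φ) (r : ℝ) :
    ∃ C : ℝ, 0 < C ∧ ∀ x ∈ closedBall (0 : Space d) r, ‖∇ φ x‖ ≤ C := by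
  obtain ⟨C, hC⟩ := (isCompact_closedBall (0 : Space d) r).exists_bound_of_continuousOn
    (hφ.continuous_fderiv (by norm_num)).continuousOn
  refine ⟨max C 1, lt_max_of_lt_right one_pos, fun x hx => ?_⟩
  rw [norm_gradient]
  exact (hC x hx).trans (le_max_left _ _)

lemma abs_fderiv_eLast_le {φ : Space d → ℝ} (x : Space d) :
    |fderiv ℝ φ x (eLast d)| ≤ ‖∇ φ x‖ := by
  rw [norm_gradient]
  simpa using (fderiv ℝ φ x).le_opNorm (eLast d)

/-- Comparison of the limit with strict supersolutions of the Neumann problem. -/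
lemma limit_le_of_supersolution (hε_pos : ∀ n, 0 < ε n) (hε : Tendsto ε atTop (𝓝 0))
    (hδ : Tendsto δ atTop (𝓝 0)) (hδ_nonneg : ∀ n, 0 ≤ δ n)
    (hf : ∀ n, IsNonnegBounded (f n)) (hg : ∀ n, IsNonnegBounded (g n))
    (hfg : ∀ n, supNorm (f n) + supNorm (g n) ≤ ENNReal.ofReal (δ n * ε n))
    (hQ : ∀ n, ∀ x ∈ unitBall d, |Q n x - 1| ≤ δ n * ε n)
    (hsol : ∀ n, IsSolution (f n) (g n) (Q n) (u n) (v n))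
    (hu : ∀ n, IsFlat (ε n) (u n)) {M : Space d → ℝ} (hMc : ContinuousOn M (unitBall d))
    (hM : ConvergesOn (fun n => closure (posSet (u n)))
      (fun n => arithLin (ε n) (u n) (v n)) M)
    {r : ℝ} (hr : r < 1) {φ : Space d → ℝ} (hφ : ContDiff ℝ 2 φ) {τ σ : ℝ} (hτ : 0 < τ)
    (hσ : 0 < σ) (hlap : ∀ x ∈ closedBall 0 r, Laplacian.laplacian φ x ≤ -τ)
    (hder : ∀ x ∈ closedBall 0 r, height x = 0 → fderiv ℝ φ x (eLast d) ≤ -σ)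
    (hsphere : ∀ x ∈ sphere (0 : Space d) r, 0 ≤ height x → M x < φ x)
    {z : Space d} (hz : z ∈ closedBall 0 r) (hzh : 0 < height z) : M z ≤ φ z := by
  by_contra! hlt
  have hrB : closedBall (0 : Space d) r ⊆ unitBall d := closedBall_subset_unitBall hr
  obtain ⟨γ, hγ, s, hs, hgap⟩ := exists_gap_near_upper_sphere (G := fun x => M x - φ x)
    ((hMc.mono hrB).sub hφ.continuous.continuousOn)
    (fun x hx hxh => sub_neg.2 (hsphere x hx hxh))
  obtain ⟨C, hC, hCb⟩ := exists_norm_gradient_bound hφ r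
  have hφ' : Continuous (fun x => fderiv ℝ φ x (eLast d)) :=
    (contDiff_fderiv_apply (m := 1) hφ (by norm_num) _).continuous
  obtain ⟨κ, hκ, hκq⟩ := exists_abs_sub_flatten_lt (ρ := r) hφ'.continuousOn
    (show 0 < σ / 2 by positivity)
  -- Once this is below `σ`, `‖∇W‖ ^ 2 ≤ 1 - ε σ + ε ^ 2 C ^ 2 < 1 - δ ε ≤ Q` on the strip. The
  -- condition `ε C < 1` below keeps the gradient nonzero.
  have hlim : Tendsto (fun n => ε n * C ^ 2 + δ n) atTop (𝓝 0) := by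
    simpa using (hε.mul_const (C ^ 2)).add hδ
  have hlim2 : Tendsto (fun n => ε n * C) atTop (𝓝 0) := by simpa using hε.mul_const C
  obtain ⟨n, h1, h2, h3, h4, h5⟩ := ((hM ((1 + r) / 2) (by linarith) (γ / 2)
    (by positivity)).and ((hε.eventually (gt_mem_nhds (lt_min (lt_min hκ hs) hzh))).and
      ((hδ.eventually (gt_mem_nhds hτ)).and ((hlim.eventually (gt_mem_nhds hσ)).and
        (hlim2.eventually (gt_mem_nhds one_pos)))))).exists
  have hεn := hε_pos n
  have hεκ : ε n < κ := h2.trans_le ((min_le_left _ _).trans (min_le_left _ _))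
  have hεs : ε n < s := h2.trans_le ((min_le_left _ _).trans (min_le_right _ _))
  have hεz : ε n < height z := h2.trans_le (min_le_right _ _)
  have hδε : 0 ≤ δ n * ε n := mul_nonneg (hδ_nonneg n) hεn.le
  have hball : closedBall (0 : Space d) r ⊆ ball 0 ((1 + r) / 2) :=
    closedBall_subset_ball (by linarith)
  have hzΩ : z ∈ closure (posSet (u n)) := subset_closure ((hu n).mem_posSet (hrB hz) hεz)
  refine not_arithLin_max_interior (hsol n) hεn (hu n) (hf n) (hg n) hδε
    (ae_add_le_of_supNorm_le hδε (hfg n)) hr hφ (fun x hx => ?_) (fun x hx hxh => ?_)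
    (p := z) ⟨hzΩ, hz⟩ (fun y hy => ?_)
  · have := hlap x hx
    nlinarith
  · have hd : fderiv ℝ φ x (eLast d) ≤ -(σ / 2) := by
      have e1 := abs_lt.1 (hκq x hx (hxh.trans hεκ.le))
      have e2 := hder (flatten x) (mem_closedBall_zero_iff.2 ((norm_flatten_le x).trans
        (mem_closedBall_zero_iff.1 hx))) (height_flatten x)
      linarith [e1.2]
    have hgC := hCb x hx
    constructor
    · intro h0
      have e1 : ‖eLast d‖ = ‖ε n • ∇ φ x‖ := by
        rw [eq_neg_of_add_eq_zero_left h0, norm_neg]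
      rw [norm_eLast, norm_smul, Real.norm_of_nonneg hεn.le] at e1
      have := mul_le_mul_of_nonneg_left hgC hεn.le
      linarith
    · rw [norm_eLast_add_smul_sq]
      have e1 := (abs_le.1 (hQ n x (hrB hx))).1
      have e2 : ‖∇ φ x‖ ^ 2 ≤ C ^ 2 := pow_le_pow_left₀ (norm_nonneg _) hgC 2
      have e3 : ε n * (ε n * C ^ 2 + δ n) < ε n * σ := mul_lt_mul_of_pos_left h4 hεn
      have e4 : ε n ^ 2 * ‖∇ φ x‖ ^ 2 ≤ ε n ^ 2 * C ^ 2 :=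
        mul_le_mul_of_nonneg_left e2 (by positivity)
      have e5 : ε n * fderiv ℝ φ x (eLast d) ≤ ε n * (-(σ / 2)) :=
        mul_le_mul_of_nonneg_left hd hεn.le
      nlinarith
  -- On the sphere the difference is below `-γ + γ / 2`, while at `z` it is above `-γ / 2`.
  · have hyc : y ∈ closedBall (0 : Space d) r := sphere_subset_closedBall hy.2
    have e1 := abs_lt.1 (h1 y ⟨hy.1, hball hyc⟩)
    have e2 := abs_lt.1 (h1 z ⟨hzΩ, hball hz⟩)
    have e3 := hgap y hyc (by rw [mem_sphere_zero_iff_norm.1 hy.2]; linarith)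
      (by linarith [(hu n).neg_le_height hy.1])
    linarith [e1.2, e2.1]

/-- Comparison of the limit with strict subsolutions of the Neumann problem. -/
lemma le_limit_of_subsolution (hε_pos : ∀ n, 0 < ε n) (hε : Tendsto ε atTop (𝓝 0))
    (hδ : Tendsto δ atTop (𝓝 0))
    (hf : ∀ n, IsNonnegBounded (f n)) (hg : ∀ n, IsNonnegBounded (g n))
    (hQ : ∀ n, ∀ x ∈ unitBall d, |Q n x - 1| ≤ δ n * ε n)
    (hsol : ∀ n, IsSolution (f n) (g n) (Q n) (u n) (v n))
    (hu : ∀ n, IsFlat (ε n) (u n)) {M : Space d → ℝ} (hMc : ContinuousOn M (unitBall d))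
    (hM : ConvergesOn (fun n => closure (posSet (u n)))
      (fun n => geomLin (ε n) (u n) (v n)) M)
    {r : ℝ} (hr : r < 1) {φ : Space d → ℝ} (hφ : ContDiff ℝ 2 φ) {σ : ℝ}
    (hσ : 0 < σ) (hlap : ∀ x ∈ closedBall 0 r, 0 < Laplacian.laplacian φ x)
    (hder : ∀ x ∈ closedBall 0 r, height x = 0 → σ ≤ fderiv ℝ φ x (eLast d))
    (hsphere : ∀ x ∈ sphere (0 : Space d) r, 0 ≤ height x → φ x < M x)
    {z : Space d} (hz : z ∈ closedBall 0 r) (hzh : 0 < height z) : φ z ≤ M z := by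
  by_contra! hlt
  have hrB : closedBall (0 : Space d) r ⊆ unitBall d := closedBall_subset_unitBall hr
  obtain ⟨γ, hγ, s, hs, hgap⟩ := exists_gap_near_upper_sphere (G := fun x => φ x - M x)
    (hφ.continuous.continuousOn.sub (hMc.mono hrB))
    (fun x hx hxh => sub_neg.2 (hsphere x hx hxh))
  obtain ⟨C, hC, hCb⟩ := exists_norm_gradient_bound hφ r
  have hφ' : Continuous (fun x => fderiv ℝ φ x (eLast d)) :=
    (contDiff_fderiv_apply (m := 1) hφ (by norm_num) _).continuous
  obtain ⟨κ, hκ, hκq⟩ := exists_abs_sub_flatten_lt (ρ := r) hφ'.continuousOn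
    (show 0 < σ / 2 by positivity)
  have hlim2 : Tendsto (fun n => ε n * C) atTop (𝓝 0) := by simpa using hε.mul_const C
  obtain ⟨n, h1, h2, h4, h5⟩ := ((hM ((1 + r) / 2) (by linarith) (γ / 2)
    -- The bound `ε < s / 5` puts the collar of width `5 * ε` of `not_geomLin_min_interior` inside
    -- the collar of width `s`.
    (by positivity)).and ((hε.eventually (gt_mem_nhds (lt_min (lt_min hκ
      (show 0 < s / 5 by positivity)) hzh))).and
      ((hδ.eventually (gt_mem_nhds hσ)).and
        (hlim2.eventually (gt_mem_nhds one_pos))))).exists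
  have hεn := hε_pos n
  have hεκ : ε n < κ := h2.trans_le ((min_le_left _ _).trans (min_le_left _ _))
  have hεs : ε n < s / 5 := h2.trans_le ((min_le_left _ _).trans (min_le_right _ _))
  have hεz : ε n < height z := h2.trans_le (min_le_right _ _)
  have hball : closedBall (0 : Space d) r ⊆ ball 0 ((1 + r) / 2) :=
    closedBall_subset_ball (by linarith)
  have hzΩ : z ∈ closure (posSet (u n)) := subset_closure ((hu n).mem_posSet (hrB hz) hεz)
  refine not_geomLin_min_interior (hsol n) hεn (hu n) (hf n) (hg n) hr hφ hlap
    (fun x hx => ?_) (fun x hx hxh => ?_) (p := z) ⟨hzΩ, hz⟩ (fun y hy hyn => ?_)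
  · have e1 := (abs_le.1 ((abs_fderiv_eLast_le x).trans (hCb x hx))).1
    have e2 := mul_le_mul_of_nonneg_left e1 hεn.le
    linarith
  · have hd : σ / 2 < fderiv ℝ φ x (eLast d) := by
      have e1 := abs_lt.1 (hκq x hx (hxh.trans hεκ.le))
      have e2 := hder (flatten x) (mem_closedBall_zero_iff.2 ((norm_flatten_le x).trans
        (mem_closedBall_zero_iff.1 hx))) (height_flatten x)
      linarith [e1.1]
    rw [norm_eLast_add_smul_sq]
    have e1 := (abs_le.1 (hQ n x (hrB hx))).2
    -- For subsolutions the quadratic term has the favourable sign and is dropped.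
    have e2 : 0 ≤ ε n ^ 2 * ‖∇ φ x‖ ^ 2 := by positivity
    have e3 : δ n * ε n < σ * ε n := mul_lt_mul_of_pos_right h4 hεn
    have e4 := mul_lt_mul_of_pos_left hd hεn
    nlinarith
  · have e1 := abs_lt.1 (h1 y ⟨hy.1, hball hy.2⟩)
    have e2 := abs_lt.1 (h1 z ⟨hzΩ, hball hz⟩)
    have e3 := hgap y hy.2 (by linarith) (by linarith [(hu n).neg_le_height hy.1])
    linarith [e1.1, e2.2]

end Limits

/-! ### Harmonicity of the limits in the open half ball -/

section InteriorLimit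

lemma isOpen_halfBall : IsOpen (halfBall d) :=
  isOpen_unitBall.inter (isOpen_lt continuous_const continuous_height)

lemma integral_height_mul_laplacian {ψ : Space d → ℝ} (hψ : ContDiff ℝ ∞ ψ)
    (hc : HasCompactSupport ψ) : ∫ x, height x * Laplacian.laplacian ψ x = 0 := by
  rw [integral_mul_laplacian_eq contDiff_height (hψ.of_le two_le_infty) hc]
  have h : (height : Space d → ℝ) = tiltedTest 0 0 (fun _ => 0) := by
    funext x; simp [tiltedTest]
  have h2 : ∀ x, Laplacian.laplacian (height : Space d → ℝ) x = 0 := fun x => by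
    rw [h, laplacian_tiltedTest contDiff_const, zero_mul]
  simp [h2]

lemma exists_radius_of_tsupport_subset {ψ : Space d → ℝ} (hs : tsupport ψ ⊆ unitBall d) :
    ∃ r : ℝ, 0 < r ∧ r < 1 ∧ tsupport ψ ⊆ ball 0 r := by
  obtain ⟨r, hr, hrs⟩ := exists_lt_subset_ball (isClosed_tsupport ψ) hs
  exact ⟨max r 2⁻¹, lt_max_of_lt_right (by norm_num), max_lt hr (by norm_num),
    hrs.trans (ball_subset_ball (le_max_left _ _))⟩

/-- A locally uniform limit of linearizations is harmonic in the half ball. -/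
lemma harmonicOnNhd_of_convergesOn {ε δ : ℕ → ℝ} {f u w : ℕ → Space d → ℝ} {U : Space d → ℝ}
    (hε_pos : ∀ n, 0 < ε n) (hε : Tendsto ε atTop (𝓝 0)) (hδ : Tendsto δ atTop (𝓝 0))
    (hf : ∀ n, ∀ᵐ y, y ∈ unitBall d → 0 ≤ f n y ∧ f n y ≤ δ n * ε n)
    (hw : ∀ n, ContinuousOn (w n) (unitBall d)) (hu : ∀ n, IsFlat (ε n) (u n))
    (heq : ∀ n, SolvesPoisson (posSet (u n)) (w n) (f n))
    (hUc : ContinuousOn U (halfBall d))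
    (hU : ConvergesOn (fun n => closure (posSet (u n))) (fun n => linearization (ε n) (w n)) U) :
    InnerProductSpace.HarmonicOnNhd U (halfBall d) := by
  refine harmonicOnNhd_of_integral_laplacian_eq_zero isOpen_halfBall hUc fun ψ hψ hc hs => ?_
  set k := (Laplacian.laplacian ψ : Space d → ℝ) with hk
  have hkc : Continuous k := continuous_laplacian (hψ.of_le two_le_infty)
  have hkcs : HasCompactSupport k := hasCompactSupport_laplacian hc
  have hks : tsupport k ⊆ tsupport ψ := tsupport_laplacian_subset
  have hψB : tsupport ψ ⊆ unitBall d := fun x hx => (hs hx).1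
  obtain ⟨ρ, -, hρ, hψρ⟩ := exists_radius_of_tsupport_subset hψB
  have hψK : IsCompact (tsupport ψ) := hc
  obtain ⟨κ, hκ, hκψ⟩ := hψK.exists_forall_le' continuous_height.continuousOn (a := 0)
    (fun x hx => (hs hx).2)
  have hkint : Integrable (fun x => |k x|) := (hkc.integrable_of_hasCompactSupport hkcs).abs
  have hψint : Integrable (fun x => |ψ x|) :=
    (hψ.continuous.integrable_of_hasCompactSupport hc).abs
  set A := ∫ x, |k x|
  set B := ∫ x, |ψ x|
  -- The first term is the uniform error of the linearization, the second the source divided by `ε`.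
  -- For large `n` the support of `ψ`, at height at least `κ > ε`, lies in the positivity set.
  have hbound : ∀ η > 0, ∀ᶠ n in atTop, |∫ x, U x * k x| ≤ η * A + δ n * B := by
    intro η hη
    filter_upwards [hU ρ hρ η hη, hε.eventually (gt_mem_nhds hκ)] with n h1 h2
    have hεn := hε_pos n
    have hsub : tsupport ψ ⊆ posSet (u n) := fun x hx =>
      (hu n).mem_posSet (hψB hx) (h2.trans_le (hκψ x hx))
    have i1 : Integrable (fun x => U x * k x) :=
      integrable_mul_of_continuousOn hψK (hUc.mono hs) hkc hks
    have i2 : Integrable (fun x => w n x * k x) :=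
      integrable_mul_of_continuousOn hψK ((hw n).mono hψB) hkc hks
    have i3 : Integrable (fun x => height x * k x) :=
      integrable_mul_of_continuousOn hψK continuous_height.continuousOn hkc hks
    have e1 : ∫ x, linearization (ε n) (w n) x * k x = -(∫ x, f n x * ψ x) / ε n := by
      have : ∀ x, linearization (ε n) (w n) x * k x =
          (ε n)⁻¹ * (w n x * k x - height x * k x) := fun x => by
        simp only [linearization]; ring
      simp_rw [this]
      rw [integral_const_mul, integral_sub i2 i3, integral_height_mul_laplacian hψ hc,
        heq n ψ hψ hc hsub]
      field_simp
      ring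
    have i4 : Integrable (fun x => linearization (ε n) (w n) x * k x) := by
      refine integrable_mul_of_continuousOn hψK ?_ hkc hks
      exact (((hw n).mono hψB).sub continuous_height.continuousOn).div_const _
    have e2 : |∫ x, f n x * ψ x| ≤ (δ n * ε n) * B := by
      rw [← integral_const_mul, ← Real.norm_eq_abs]
      refine norm_integral_le_of_norm_le (hψint.const_mul _) ?_
      filter_upwards [hf n] with x hx
      rw [norm_mul, Real.norm_eq_abs, Real.norm_eq_abs]
      by_cases hxψ : x ∈ tsupport ψ
      · obtain ⟨h3, h4⟩ := hx (hψB hxψ)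
        rw [abs_of_nonneg h3]
        exact mul_le_mul_of_nonneg_right h4 (abs_nonneg _)
      · simp [image_eq_zero_of_notMem_tsupport hxψ]
    have e3 : |∫ x, (U x * k x - linearization (ε n) (w n) x * k x)| ≤ η * A := by
      rw [← integral_const_mul, ← Real.norm_eq_abs]
      refine norm_integral_le_of_norm_le (hkint.const_mul _) (Eventually.of_forall fun x => ?_)
      rw [← sub_mul, norm_mul, Real.norm_eq_abs, Real.norm_eq_abs]
      by_cases hxψ : x ∈ tsupport ψ
      · refine mul_le_mul_of_nonneg_right ?_ (abs_nonneg _)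
        rw [abs_sub_comm]
        exact (h1 x ⟨subset_closure (hsub hxψ), hψρ hxψ⟩).le
      · simp [image_eq_zero_of_notMem_tsupport fun h => hxψ (hks h)]
    rw [integral_sub i1 i4, e1] at e3
    have e4 : |(-∫ x, f n x * ψ x) / ε n| ≤ δ n * B := by
      rw [abs_div, abs_neg, abs_of_pos hεn, div_le_iff₀ hεn]
      linarith
    have e5 := abs_sub_abs_le_abs_sub (∫ x, U x * k x) ((-∫ x, f n x * ψ x) / ε n)
    linarith
  have hA : 0 ≤ A := integral_nonneg fun _ => abs_nonneg _
  have hle : ∀ η > 0, |∫ x, U x * k x| ≤ η * A := fun η hη => by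
    have h1 : Tendsto (fun n => η * A + δ n * B) atTop (𝓝 (η * A + 0 * B)) :=
      tendsto_const_nhds.add (hδ.mul_const B)
    simpa using ge_of_tendsto h1 (hbound η hη)
  have h0 : |∫ x, U x * k x| ≤ 0 := le_of_forall_pos_le_add fun η hη => by
    have h1 := hle (η / (A + 1)) (by positivity)
    have h2 : η / (A + 1) * A ≤ η := by
      rw [div_mul_eq_mul_div, div_le_iff₀ (by positivity)]
      nlinarith
    linarith
  exact abs_nonpos_iff.1 h0

end InteriorLimit

/-! ### Even reflection in the hyperplane -/

section Reflection

/-- The reflection in the hyperplane `{x_d = 0}`. -/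
noncomputable def flipLast (d : ℕ) : Space d ≃ₗᵢ[ℝ] Space d where
  toLinearEquiv := LinearEquiv.ofInvolutive
    { toFun := fun x => x - (2 * height x) • eLast d
      map_add' := fun x y => by rw [height_add]; module
      map_smul' := fun t x => by rw [height_smul, RingHom.id_apply]; module }
    (fun x => by
      simp only [LinearMap.coe_mk, AddHom.coe_mk, height_sub, height_smul, height_eLast]
      module)
  norm_map' := fun x => by
    refine (pow_left_inj₀ (norm_nonneg _) (norm_nonneg _) two_ne_zero).1 ?_
    change ‖x - (2 * height x) • eLast d‖ ^ 2 = ‖x‖ ^ 2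
    rw [sub_eq_add_neg, ← neg_smul, norm_add_smul_eLast_sq]
    ring

lemma flipLast_apply (x : Space d) : flipLast d x = x - (2 * height x) • eLast d := rfl

@[simp] lemma height_flipLast (x : Space d) : height (flipLast d x) = -height x := by
  rw [flipLast_apply, height_sub, height_smul, height_eLast]; ring

@[simp] lemma flipLast_flipLast (x : Space d) : flipLast d (flipLast d x) = x := by
  rw [flipLast_apply, height_flipLast, flipLast_apply]; module

lemma flipLast_add_smul {x : Space d} (hx : height x = 0) (t : ℝ) :
    flipLast d (x + t • eLast d) = x + (-t) • eLast d := by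
  rw [flipLast_apply, height_add, height_smul, height_eLast, hx]; module

/-- The point of the closed upper half space with the same distance to `{x_d = 0}`. -/
noncomputable def fold (x : Space d) : Space d := x + (|height x| - height x) • eLast d

lemma continuous_fold : Continuous (fold : Space d → Space d) := by
  have := continuous_height (d := d)
  unfold fold
  fun_prop

@[simp] lemma height_fold (x : Space d) : height (fold x) = |height x| := by simp [fold]

lemma fold_eq_self {x : Space d} (hx : 0 ≤ height x) : fold x = x := by
  simp [fold, abs_of_nonneg hx]

lemma fold_flipLast (x : Space d) : fold (flipLast d x) = fold x := by
  rw [fold, height_flipLast, abs_neg, fold, flipLast_apply]; module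

lemma norm_fold (x : Space d) : ‖fold x‖ = ‖x‖ := by
  rcases le_total 0 (height x) with h | h
  · rw [fold_eq_self h]
  · rw [← fold_flipLast, fold_eq_self (by simpa using h), LinearIsometryEquiv.norm_map]

lemma continuousOn_comp_fold {M : Space d → ℝ} (hM : ContinuousOn M (closedHalfBall d)) :
    ContinuousOn (fun x => M (fold x)) (unitBall d) := by
  refine hM.comp continuous_fold.continuousOn fun x hx => ⟨?_, by simp⟩
  rw [unitBall, mem_ball_zero_iff] at *
  rwa [norm_fold]

/-- Along the normal line `F` is an even function of `t`, so its derivative at `0` equals its own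
negative. -/
lemma deriv_eq_zero_of_even {F : Space d → ℝ} (hF : ∀ x, F (flipLast d x) = F x) {x : Space d}
    (hx : height x = 0) (hd : DifferentiableAt ℝ F x) :
    HasDerivAt (fun t : ℝ => F (x + t • eLast d)) 0 0 ∧ fderiv ℝ F x (eLast d) = 0 := by
  have h1 : HasDerivAt (fun t : ℝ => x + t • eLast d) (eLast d) 0 := by
    simpa using ((hasDerivAt_id (0 : ℝ)).smul_const (eLast d)).const_add x
  have h2 : HasDerivAt (fun t : ℝ => F (x + t • eLast d)) (fderiv ℝ F x (eLast d)) 0 := by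
    have h3 : HasFDerivAt F (fderiv ℝ F x) (x + (0 : ℝ) • eLast d) := by
      simpa using hd.hasFDerivAt
    exact h3.comp_hasDerivAt (0 : ℝ) h1
  have h4 : HasDerivAt (fun t : ℝ => F (x + (-t) • eLast d)) (-fderiv ℝ F x (eLast d)) 0 := by
    have h5 : HasDerivAt (fun t : ℝ => F (x + t • eLast d)) (fderiv ℝ F x (eLast d)) (-0) := by
      rwa [neg_zero]
    have h6 := h5.comp (0 : ℝ) (hasDerivAt_neg (0 : ℝ))
    rwa [mul_neg_one] at h6
  have h6 : (fun t : ℝ => F (x + (-t) • eLast d)) = fun t : ℝ => F (x + t • eLast d) :=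
    funext fun t => by rw [← flipLast_add_smul hx, hF]
  rw [h6] at h4
  have h7 : fderiv ℝ F x (eLast d) = 0 := by linarith [h2.unique h4]
  rw [h7] at h2
  exact ⟨h2, h7⟩

end Reflection

/-! ### The barrier and even harmonic polynomials -/

section Barrier

/-- The polynomial `c + θ (3 - |x|² - x_d)`. -/
noncomputable def barrier (d : ℕ) (c θ : ℝ) : MvPolynomial (Fin (d + 1)) ℝ :=
  MvPolynomial.C c + MvPolynomial.C θ *
    (sphereDefining (Fin (d + 1)) √3 - MvPolynomial.X (Fin.last d))

variable {c θ : ℝ}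

lemma polyFun_barrier (x : Space d) :
    polyFun (barrier d c θ) x = c + θ * (3 - ‖x‖ ^ 2 - height x) := by
  simp only [barrier, polyFun_add, polyFun_mul, polyFun_C, polyFun_sub, polyFun_sphereDefining,
    polyFun_X, Real.sq_sqrt (zero_le_three (α := ℝ))]
  rfl

/-- With the normal derivative `-θ` on the hyperplane, this makes the barrier a strict supersolution
of the Neumann problem for `θ > 0` and a strict subsolution for `θ < 0`. -/
lemma laplacian_barrier (x : Space d) :
    Laplacian.laplacian (polyFun (barrier d c θ)) x = -(2 * θ * (d + 1)) := by
  rw [laplacian_polyFun, barrier, map_add, ← MvPolynomial.smul_eq_C_mul, map_smul, map_sub,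
    polyLaplacian_sphereDefining]
  have h1 : polyLaplacian (MvPolynomial.C c : MvPolynomial (Fin (d + 1)) ℝ) = 0 := by
    simp [polyLaplacian_apply]
  have h2 : polyLaplacian (MvPolynomial.X (Fin.last d) : MvPolynomial (Fin (d + 1)) ℝ) = 0 := by
    rw [polyLaplacian_apply]
    refine Finset.sum_eq_zero fun i _ => ?_
    by_cases hi : i = Fin.last d
    · subst hi; simp
    · rw [MvPolynomial.pderiv_X_of_ne (Ne.symm hi), map_zero]
  rw [h1, h2, MvPolynomial.smul_eq_C_mul, zero_add, sub_zero, polyFun_mul, polyFun_C, polyFun_C,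
    Fintype.card_fin]
  push_cast
  ring

lemma fderiv_barrier {x : Space d} (hx : height x = 0) :
    fderiv ℝ (polyFun (barrier d c θ)) x (eLast d) = -θ := by
  have h1 : HasDerivAt (fun t : ℝ => x + t • eLast d) (eLast d) 0 := by
    simpa using ((hasDerivAt_id (0 : ℝ)).smul_const (eLast d)).const_add x
  have h2 : HasDerivAt (fun t : ℝ => polyFun (barrier d c θ) (x + t • eLast d))
      (fderiv ℝ (polyFun (barrier d c θ)) x (eLast d)) 0 := by
    have h3 : HasFDerivAt (polyFun (barrier d c θ)) (fderiv ℝ (polyFun (barrier d c θ)) x)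
        (x + (0 : ℝ) • eLast d) := by
      simpa using ((contDiff_polyFun (barrier d c θ) (n := 1)).differentiable (by norm_num)
        x).hasFDerivAt
    exact h3.comp_hasDerivAt (0 : ℝ) h1
  have h3 : (fun t : ℝ => polyFun (barrier d c θ) (x + t • eLast d)) =
      fun t => c + θ * (3 - (‖x‖ ^ 2 + t ^ 2) - t) := funext fun t => by
    rw [polyFun_barrier, norm_add_smul_eLast_sq, height_add, height_smul, height_eLast, hx]
    ring
  rw [h3] at h2
  have h4 : HasDerivAt (fun t : ℝ => c + θ * (3 - (‖x‖ ^ 2 + t ^ 2) - t))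
      (θ * (-(2 * (0 : ℝ) ^ 1 * 1) - 1)) 0 := by
    exact (((((((hasDerivAt_id (0 : ℝ)).pow 2).const_add (‖x‖ ^ 2)).const_sub 3).sub
      (hasDerivAt_id 0)).const_mul θ).const_add c)
  rw [h2.unique h4]; ring

/-- Approximate `F` on the sphere by a polynomial, solve the Dirichlet problem, and average the
solution with its reflection. The average stays harmonic, and the error survives because `F` is
even. -/
lemma exists_even_harmonic_near {F : Space d → ℝ} {r : ℝ} (hr : 0 < r)
    (hF : ContinuousOn F (sphere 0 r)) (heven : ∀ x, F (flipLast d x) = F x) {η : ℝ} (hη : 0 < η) :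
    ∃ h : Space d → ℝ, ContDiff ℝ ∞ h ∧ (∀ x, Laplacian.laplacian h x = 0) ∧
      (∀ x, h (flipLast d x) = h x) ∧ ∀ x ∈ sphere (0 : Space d) r, |h x - F x| < η := by
  obtain ⟨p, hp⟩ := exists_polyFun_near (isCompact_sphere (0 : Space d) r) hF hη
  obtain ⟨q, hq, hqs⟩ := exists_polyLaplacian_eq_zero p hr
  have hqc : ContDiff ℝ ∞ (polyFun q) := contDiff_polyFun q
  have hqc' : ContDiff ℝ ∞ (fun x => polyFun q (flipLast d x)) :=
    hqc.comp (flipLast d).toContinuousLinearEquiv.contDiff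
  have hlap : ∀ x, Laplacian.laplacian (polyFun q) x = 0 := fun x => by
    rw [laplacian_polyFun, hq]; simp [polyFun]
  refine ⟨(2⁻¹ : ℝ) • (polyFun q + fun x => polyFun q (flipLast d x)),
    contDiff_const.smul (hqc.add hqc'), fun x => ?_, fun x => ?_, fun x hx => ?_⟩
  · have h1 := (hqc.of_le two_le_infty).contDiffAt (x := x)
    have h2 := (hqc'.of_le two_le_infty).contDiffAt (x := x)
    have h3 : ContDiffAt ℝ 2 (polyFun q + fun x => polyFun q (flipLast d x)) x := h1.add h2
    rw [InnerProductSpace.laplacian_smul _ h3, h1.laplacian_add h2,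
      laplacian_comp_linearIsometryEquiv (flipLast d) (contDiff_polyFun q), hlap, hlap]
    simp
  · simp only [Pi.smul_apply, Pi.add_apply, flipLast_flipLast]
    rw [add_comm]
  · have hfx : flipLast d x ∈ sphere (0 : Space d) r := by
      rw [mem_sphere_zero_iff_norm] at *
      rwa [LinearIsometryEquiv.norm_map]
    have h1 := hp x hx
    have h2 := hp _ hfx
    rw [heven] at h2
    simp only [Pi.smul_apply, Pi.add_apply, smul_eq_mul]
    rw [hqs x hx, hqs _ hfx]
    rw [abs_lt] at *
    constructor <;> linarith [h1.1, h1.2, h2.1, h2.2]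

end Barrier

/-! ### From comparison to the classical Neumann problem -/

section NeumannLimit

/-- A function comparable with strict sub- and supersolutions of the Neumann problem in the half
ball is a classical solution. -/
lemma isClassicalNeumannSolution_of_comparison {M : Space d → ℝ}
    (hM : ContinuousOn M (closedHalfBall d))
    (hsup : ∀ r < 1, ∀ φ : Space d → ℝ, ContDiff ℝ 2 φ → ∀ τ > 0, ∀ σ > 0,
      (∀ x ∈ closedBall 0 r, Laplacian.laplacian φ x ≤ -τ) →
      (∀ x ∈ closedBall 0 r, height x = 0 → fderiv ℝ φ x (eLast d) ≤ -σ) →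
      (∀ x ∈ sphere (0 : Space d) r, 0 ≤ height x → M x < φ x) →
      ∀ z ∈ closedBall 0 r, 0 < height z → M z ≤ φ z)
    (hsub : ∀ r < 1, ∀ φ : Space d → ℝ, ContDiff ℝ 2 φ → ∀ σ > 0,
      (∀ x ∈ closedBall 0 r, 0 < Laplacian.laplacian φ x) →
      (∀ x ∈ closedBall 0 r, height x = 0 → σ ≤ fderiv ℝ φ x (eLast d)) →
      (∀ x ∈ sphere (0 : Space d) r, 0 ≤ height x → φ x < M x) →
      ∀ z ∈ closedBall 0 r, 0 < height z → φ z ≤ M z) :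
    IsClassicalNeumannSolution M := by
  set F : Space d → ℝ := fun x => M (fold x) with hFdef
  have hFc : ContinuousOn F (unitBall d) := continuousOn_comp_fold hM
  have hFM : ∀ x, 0 ≤ height x → F x = M x := fun x hx => by simp only [hFdef, fold_eq_self hx]
  have hFeven : ∀ x, F (flipLast d x) = F x := fun x => by simp only [hFdef, fold_flipLast]
  have happrox : ∀ r, 0 < r → r < 1 → ∀ η > 0, ∃ h : Space d → ℝ, ContDiff ℝ ∞ h ∧
      (∀ x, Laplacian.laplacian h x = 0) ∧ ∀ x ∈ ball (0 : Space d) r, |F x - h x| ≤ η := by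
    intro r hr hr1 η hη
    have hrB : closedBall (0 : Space d) r ⊆ unitBall d := closedBall_subset_unitBall hr1
    obtain ⟨h, hh, hlap, heven, hsph⟩ := exists_even_harmonic_near hr
      (hFc.mono (sphere_subset_closedBall.trans hrB)) hFeven (half_pos hη)
    refine ⟨h, hh, hlap, ?_⟩
    have hh2 : ContDiff ℝ 2 h := hh.of_le two_le_infty
    have hφ : ∀ c θ : ℝ, ContDiff ℝ 2 (h + polyFun (barrier d c θ)) := fun c θ =>
      hh2.add (contDiff_polyFun _)
    have hφlap : ∀ c θ : ℝ, ∀ x, Laplacian.laplacian (h + polyFun (barrier d c θ)) x =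
        -(2 * θ * (d + 1)) := fun c θ x => by
      rw [hh2.contDiffAt.laplacian_add (contDiff_polyFun _).contDiffAt, hlap, laplacian_barrier,
        zero_add]
    -- The even `h` has no normal derivative, so only the barrier contributes.
    have hφder : ∀ c θ : ℝ, ∀ x, height x = 0 →
        fderiv ℝ (h + polyFun (barrier d c θ)) x (eLast d) = -θ := fun c θ x hx => by
      have hd := hh2.differentiable (by norm_num) x
      rw [fderiv_add hd ((contDiff_polyFun (barrier d c θ) (n := 1)).differentiable
        (by norm_num) x), add_apply,
        (deriv_eq_zero_of_even heven hx hd).2, fderiv_barrier hx, zero_add]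
    have hb : ∀ x ∈ closedBall (0 : Space d) r, 0 < 3 - ‖x‖ ^ 2 - height x ∧
        3 - ‖x‖ ^ 2 - height x ≤ 4 := by
      intro x hx
      rw [mem_closedBall_zero_iff] at hx
      have h1 := abs_le.1 (abs_height_le x)
      have h2 := norm_nonneg x
      constructor <;> nlinarith [h1.1, h1.2]
    -- The barrier is at most `η / 2 + 4 θ = η`. Its part `η / 2` covers the error on the sphere,
    -- and the positive `θ` part makes all inequalities strict.
    set θ := η / 8 with hθ
    have hθ0 : 0 < θ := by positivity
    have hd1 : (0 : ℝ) < d + 1 := by positivity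
    have hpos : ∀ z ∈ ball (0 : Space d) r, 0 < height z → |F z - h z| ≤ η := by
      intro z hz hzh
      have hzc := ball_subset_closedBall hz
      have up := hsup r hr1 _ (hφ (η / 2) θ) (2 * θ * (d + 1)) (by positivity) θ hθ0
        (fun x _ => (hφlap _ _ x).le) (fun x _ hx => (hφder _ _ x hx).le)
        (fun x hx hxh => by
          have h1 := abs_lt.1 (hsph x hx)
          have h2 := mul_pos hθ0 (hb x (sphere_subset_closedBall hx)).1
          rw [Pi.add_apply, polyFun_barrier, ← hFM x hxh]
          linarith [h1.1]) z hzc hzh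
      have lo := hsub r hr1 _ (hφ (-(η / 2)) (-θ)) θ hθ0
        (fun x _ => by rw [hφlap]; nlinarith [mul_pos hθ0 hd1])
        (fun x _ hx => by rw [hφder _ _ x hx, neg_neg])
        (fun x hx hxh => by
          have h1 := abs_lt.1 (hsph x hx)
          have h2 := mul_pos hθ0 (hb x (sphere_subset_closedBall hx)).1
          rw [Pi.add_apply, polyFun_barrier, ← hFM x hxh]
          linarith [h1.2]) z hzc hzh
      rw [Pi.add_apply, polyFun_barrier] at up lo
      have h3 := mul_le_mul_of_nonneg_left (hb z hzc).2 hθ0.le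
      rw [hFM z hzh.le, abs_le]
      constructor <;> linarith
    intro z hz
    -- Comparison holds only above the hyperplane; evenness gives the lower half and continuity the
    -- hyperplane.
    rcases lt_trichotomy (height z) 0 with hzh | hzh | hzh
    · rw [← hFeven z, ← heven z]
      refine hpos _ ?_ (by simpa using hzh)
      rw [mem_ball_zero_iff] at *
      rwa [LinearIsometryEquiv.norm_map]
    · have hpath : Tendsto (fun t : ℝ => z + t • eLast d) (𝓝[>] 0) (𝓝 z) := by
        have : Continuous (fun t : ℝ => z + t • eLast d) := by fun_prop
        simpa using (this.tendsto 0).mono_left nhdsWithin_le_nhds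
      have hFz : ContinuousAt (fun x => |F x - h x|) z :=
        ((hFc.continuousAt (isOpen_unitBall.mem_nhds (hrB (ball_subset_closedBall hz)))).sub
          hh.continuous.continuousAt).abs
      refine le_of_tendsto (hFz.tendsto.comp hpath) ?_
      filter_upwards [hpath.eventually_mem (isOpen_ball.mem_nhds hz), self_mem_nhdsWithin]
        with t ht ht0
      exact hpos _ ht (by simpa [hzh] using ht0)
    · exact hpos z hz hzh
  -- The reflected function is harmonic across the hyperplane, so regularity of `M` up to the flat
  -- boundary is interior regularity of `F`.
  have hharm : InnerProductSpace.HarmonicOnNhd F (unitBall d) := by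
    refine harmonicOnNhd_of_integral_laplacian_eq_zero isOpen_unitBall hFc fun ψ hψ hc hs => ?_
    set k := (Laplacian.laplacian ψ : Space d → ℝ) with hk
    have hkc : Continuous k := continuous_laplacian (hψ.of_le two_le_infty)
    have hks : tsupport k ⊆ tsupport ψ := tsupport_laplacian_subset
    have hψK : IsCompact (tsupport ψ) := hc
    have hkint : Integrable (fun x => |k x|) :=
      (hkc.integrable_of_hasCompactSupport (hasCompactSupport_laplacian hc)).abs
    obtain ⟨r, hr0, hr1, hrψ⟩ := exists_radius_of_tsupport_subset hs
    set A := ∫ x, |k x|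
    have hA : 0 ≤ A := integral_nonneg fun _ => abs_nonneg _
    refine abs_nonpos_iff.1 (le_of_forall_pos_le_add fun η hη => ?_)
    obtain ⟨h, hh, hlap, hclose⟩ := happrox r hr0 hr1 (η / (A + 1)) (by positivity)
    have e1 : ∫ x, h x * k x = 0 := by
      rw [integral_mul_laplacian_eq (hh.of_le two_le_infty) (hψ.of_le two_le_infty) hc]
      simp [hlap]
    have e2 : ∫ x, F x * k x = ∫ x, (F x * k x - h x * k x) := by
      rw [integral_sub (integrable_mul_of_continuousOn hψK (hFc.mono hs) hkc hks)
        (integrable_mul_of_continuousOn hψK hh.continuous.continuousOn hkc hks), e1, sub_zero]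
    have e3 : |∫ x, (F x * k x - h x * k x)| ≤ η / (A + 1) * A := by
      rw [← integral_const_mul, ← Real.norm_eq_abs]
      refine norm_integral_le_of_norm_le (hkint.const_mul _) (Eventually.of_forall fun x => ?_)
      rw [← sub_mul, norm_mul, Real.norm_eq_abs, Real.norm_eq_abs]
      by_cases hxψ : x ∈ tsupport ψ
      · exact mul_le_mul_of_nonneg_right (hclose x (hrψ hxψ)) (abs_nonneg _)
      · simp [image_eq_zero_of_notMem_tsupport fun h => hxψ (hks h)]
    have e4 : η / (A + 1) * A ≤ η := by
      rw [div_mul_eq_mul_div, div_le_iff₀ (by positivity)]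
      nlinarith
    rw [e2]
    linarith
  refine ⟨?_, fun x hx => ?_, fun x hx => ?_⟩
  · have h1 : ContDiffOn ℝ 1 F (closedHalfBall d) :=
      (hharm.contDiffOn.of_le (by norm_num)).mono fun x hx => hx.1
    exact h1.congr fun x hx => (hFM x hx.2).symm
  · refine (InnerProductSpace.harmonicAt_congr_nhds ?_).1 (hharm x hx.1)
    filter_upwards [isOpen_halfBall.mem_nhds hx] with y hy using hFM y hy.2.le
  · have hxd : DifferentiableAt ℝ F x := (hharm x hx.1).1.differentiableAt (by norm_num)
    have h1 := (deriv_eq_zero_of_even hFeven hx.2 hxd).1.hasDerivWithinAt (s := Ici 0)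
    have h2 : ∀ t ∈ Ici (0 : ℝ), M (x + t • eLast d) = F (x + t • eLast d) := fun t ht => by
      have hxh : height x = 0 := hx.2
      exact (hFM _ (by simpa [hxh] using ht)).symm
    exact h1.congr h2 (h2 0 (mem_Ici.2 le_rfl))

end NeumannLimit

end FreeBoundarySystem

/-! ### The linearized system -/

open FreeBoundarySystem

theorem lemma5p2 (d : ℕ)
    (ε δ : ℕ → ℝ) (f g Q u v : ℕ → FreeBoundarySystem.Space d → ℝ)
    (uInf vInf : FreeBoundarySystem.Space d → ℝ)
    (hε_pos : ∀ n, 0 < ε n) (hε : Tendsto ε atTop (𝓝 0))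
    -- the data are `o(ε n)`-close to `f = 0`, `g = 0`, `Q = 1`
    (hδ : Tendsto δ atTop (𝓝 0))
    (hf : ∀ n, FreeBoundarySystem.IsNonnegBounded (f n))
    (hg : ∀ n, FreeBoundarySystem.IsNonnegBounded (g n))
    (hfg : ∀ n, FreeBoundarySystem.supNorm (f n) + FreeBoundarySystem.supNorm (g n) ≤
      ENNReal.ofReal (δ n * ε n))
    (hQ : ∀ n, ∀ x ∈ FreeBoundarySystem.unitBall d, |Q n x - 1| ≤ δ n * ε n)
    -- flat solutions with the origin on their free boundary
    (hsol : ∀ n, FreeBoundarySystem.IsSolution (f n) (g n) (Q n) (u n) (v n))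
    (hzero : ∀ n, (0 : FreeBoundarySystem.Space d) ∈ frontier (FreeBoundarySystem.posSet (u n)))
    (hu_flat : ∀ n, FreeBoundarySystem.IsFlat (ε n) (u n))
    (hv_flat : ∀ n, FreeBoundarySystem.IsFlat (ε n) (v n))
    -- the limits of the linearizing sequences
    (hu_cont : ContinuousOn uInf (FreeBoundarySystem.closedHalfBall d))
    (hv_cont : ContinuousOn vInf (FreeBoundarySystem.closedHalfBall d))
    (hu_lim : FreeBoundarySystem.GraphsConverge
      (fun n => closure (FreeBoundarySystem.posSet (u n)))
      (fun n => FreeBoundarySystem.linearization (ε n) (u n))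
      (FreeBoundarySystem.closedHalfBall d) uInf)
    (hv_lim : FreeBoundarySystem.GraphsConverge
      (fun n => closure (FreeBoundarySystem.posSet (u n)))
      (fun n => FreeBoundarySystem.linearization (ε n) (v n))
      (FreeBoundarySystem.closedHalfBall d) vInf) :
    FreeBoundarySystem.IsClassicalNeumannSolution (fun x => (uInf x + vInf x) / 2) ∧
    FreeBoundarySystem.IsClassicalDirichletSolution (fun x => (uInf x - vInf x) / 2) := by
  -- The sign of `δ n` is read off from the bound on `Q n` at the origin.
  have hδε : ∀ n, 0 ≤ δ n * ε n := fun n =>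
    (abs_nonneg _).trans (hQ n 0 (mem_ball_self one_pos))
  have hδ_nonneg : ∀ n, 0 ≤ δ n := fun n => nonneg_of_mul_nonneg_left (hδε n) (hε_pos n)
  have hU := hu_lim.convergesOn hu_cont
  have hV := hv_lim.convergesOn hv_cont
  have hUc := continuousOn_comp_clamp hu_cont
  have hVc := continuousOn_comp_clamp hv_cont
  have hflat := eq_on_flatBoundary hε_pos hε hsol hu_flat hUc hVc hU hV
  have harith := hU.arithLin hV
  have hgeom := ConvergesOn.geomLin hε_pos hε hsol hu_flat hv_flat hUc hVc hflat hU hV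
  have hMc : ContinuousOn (fun x => (uInf (clamp x) + vInf (clamp x)) / 2) (unitBall d) :=
    (hUc.add hVc).div_const 2
  have hclamp : ∀ (W : Space d → ℝ) (x : Space d), 0 ≤ height x → W (clamp x) = W x :=
    fun W x hx => by rw [clamp_eq_self hx]
  -- The arithmetic mean supplies comparison with supersolutions, the geometric mean comparison with
  -- subsolutions.
  refine ⟨isClassicalNeumannSolution_of_comparison ((hu_cont.add hv_cont).div_const 2) ?_ ?_, ?_⟩
  · intro r hr φ hφ τ hτ σ hσ hlap hder hsphere z hz hzh
    have := limit_le_of_supersolution hε_pos hε hδ hδ_nonneg hf hg hfg hQ hsol hu_flat hMc harith hr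
      hφ hτ hσ hlap hder (fun x hx hxh => by
        rw [hclamp uInf x hxh, hclamp vInf x hxh]; exact hsphere x hx hxh) hz hzh
    rwa [hclamp uInf z hzh.le, hclamp vInf z hzh.le] at this
  · intro r hr φ hφ σ hσ hlap hder hsphere z hz hzh
    have := le_limit_of_subsolution hε_pos hε hδ hf hg hQ hsol hu_flat hMc hgeom hr
      hφ hσ hlap hder (fun x hx hxh => by
        rw [hclamp uInf x hxh, hclamp vInf x hxh]; exact hsphere x hx hxh) hz hzh
    rwa [hclamp uInf z hzh.le, hclamp vInf z hzh.le] at this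
  have hbounds : ∀ n, ∀ᵐ y, y ∈ unitBall d →
      (0 ≤ f n y ∧ f n y ≤ δ n * ε n) ∧ (0 ≤ g n y ∧ g n y ≤ δ n * ε n) := by
    intro n
    have h1 := (hf n).2
    have h2 := (hg n).2
    rw [ae_restrict_iff' (by exact measurableSet_ball)] at h1 h2
    filter_upwards [h1, h2, ae_add_le_of_supNorm_le (hδε n) (hfg n)] with y h1 h2 h3 hy
    have := h1 hy
    have := h2 hy
    have := h3 hy
    exact ⟨⟨by assumption, by linarith⟩, by assumption, by linarith⟩
  have hsub : halfBall d ⊆ unitBall d := fun x hx => hx.1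
  have hUh := harmonicOnNhd_of_convergesOn hε_pos hε hδ
    (fun n => (hbounds n).mono fun y h hy => (h hy).1) (fun n => (hsol n).continuousOn_left) hu_flat
    (fun n => (hsol n).equation_left) (hUc.mono hsub) hU
  have hVh := harmonicOnNhd_of_convergesOn hε_pos hε hδ
    (fun n => (hbounds n).mono fun y h hy => (h hy).2) (fun n => (hsol n).continuousOn_right) hu_flat
    (fun n => (hsol n).equation_right) (hVc.mono hsub) hV
  refine ⟨(hu_cont.sub hv_cont).div_const 2, fun x hx => ?_, fun x hx => ?_⟩
  · refine (InnerProductSpace.harmonicAt_congr_nhds ?_).1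
      (((hUh x hx).sub (hVh x hx)).const_smul (c := (2⁻¹ : ℝ)))
    filter_upwards [isOpen_halfBall.mem_nhds hx] with y hy
    simp only [Pi.smul_apply, Pi.sub_apply, smul_eq_mul]
    rw [hclamp uInf y hy.2.le, hclamp vInf y hy.2.le]
    ring
  · have h := hflat x hx
    have hxh : 0 ≤ height x := (hx.2 : height x = 0).ge
    simp only [hclamp uInf x hxh, hclamp vInf x hxh] at h
    simp [h]
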